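/- **Notation.** For $r>0$ let $\rho_r(j)=\exp(-\pi j^2/r^2)$, and let $\mathcal D_{\mathbb Z,r}$ be the distribution on $\mathbb Z$ with mass proportional to $\rho_r$. All parameters are functions of $\kappa\in\mathbb N$: a dimension $n\ge 1$, a modulus $N\ge 2$, a number of samples $\ell\ge n$, and a real $r>0$, where $n$, $\log N$ and $\ell$ are bounded by polynomials in $\kappa$. * *Decisional LWE*, $\mathrm{dLWE}_{n,N,\alpha}^{\ell}$: distinguish $\ell$ samples $(\mathbf a_k,\langle \mathbf a_k,\mathbf s\rangle+e_k)\in\mathbb Z_N^n\times\mathbb Z_N$, with a uniform common secret $\mathbf s\in\mathbb Z_N^n$, uniform independent $\mathbf a_k$ and independent $e_k\hookleftarrow\mathcal D_{\mathbb Z,\alpha N}$, from $\ell$ uniform elements of $\mathbb Z_N^n\times\mathbb Z_N$. * *Decisional Gaussian extrapolated dihedral coset problem*, $\mathrm{dG\text{-}EDCP}_{n,N,r}^{\ell}$: distinguish $\ell$ (normalized) states $\sum_{j\in\mathbb Z}\rho_r(j)\,|j\rangle|\mathbf x_k+j\mathbf s \bmod N\rangle$, with arbitrary $\mathbf x_k\in\mathbb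 Z_N^n$ and an arbitrary common $\mathbf s\in\mathbb Z_N^n$, from $\ell$ random states $|j_k\rangle|\mathbf x_k\rangle$, where the $j_k$ are independent with mass proportional to $\rho_r^2$ and the $\mathbf x_k\in\mathbb Z_N^n$ are independent and uniform. An algorithm *solves* one of these problems if, for all large $\kappa$, the difference of its acceptance probabilities in the two cases is at least $C/(n\log N)^c$ for some constants $C,c>0$. For EDCP this is required for every $\mathbf s$ and all $\mathbf x_k$ (with a sign of the difference that does not depend on them). **Corollary (dEDCP $\le$ dLWE).** Suppose that $\ell=\Omega(\kappa)$, $r=\Omega(\sqrt\kappa)$ and $\sqrt\kappa\, r=O(N)$, and let $\alpha=1/r$. Then there is a quantum reduction, with run-time polynomial in $\kappa$, from $\mathrm{dG\text{-}EDCP}_{n,N,r}^{\ell}$ to $\mathrm{dLWE}_{n,N,\alpha}^{\ell}$. That is, there is a quantum oracle algorithm $P$ with input $\kappa,n,N,\ell,r$ and the $\ell$ states, the same for all choices of the parameter functions, such that for each choice of them $P$ runs in time polynomial in $\kappa$ with any oracle, and solves $\mathrm{dG\text{-}EDCP}_{n,N,r}^{\ell}$ whenever its oracle solves $\mathrm{dLWE}_{n,N,\alpha}^{\ell}$.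 Here a quantum algorithm is a program for a random access machine with logarithmic-cost classical integer memory, evaluation of integer parts of real expressions (charged by the lengths of the values), and quantum registers, on which arithmetic modulo $m$, quantum Fourier transforms over $\mathbb Z_m$ and measurements modulo $m$ are elementary operations of cost polynomial in $\log m$. -/

import Mathlib

open Filter Asymptotics

/-! ### A random access machine with classical and quantum memory

The classical memory is an array of integers, with logarithmic (bit length) cost.  The quantum
memory is an array of quantum registers, the Hilbert space of each being `ℓ²(ℤ)`: the basis states
of the whole memory are the integer arrays with finitely many nonzero entries.  Arithmetic in
superposition, Fourier transforms and measurements act on the residue of a register modulo a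
modulus `m` held in classical memory and leave the quotient by `m` alone, so that a register
takes the part of an `m`-level system; their cost is polynomial in the bit length of `m`.
Control flow is classical, with loops whose length is known on entry. -/

namespace QMachine

/-- Real expressions in the real input parameter, the constant `π` and the classical memory. -/
inductive RealExpr where
  | param
  | pi
  | const (z : ℤ)
  | reg (i : ℕ)
  | add (e f : RealExpr)
  | sub (e f : RealExpr)
  | mul (e f : RealExpr)
  | div (e f : RealExpr)
  | exp (e : RealExpr)

inductive ArithOp where
  | add
  | sub
  | mul
  | div
  | mod

/-- Programs.  A natural number names a cell of the classical memory; below, `r i` is the content of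
cell `i`, and `Q i` is the quantum register whose number is `r i`.
* `const d z`: `r d := z`.
* `arith o d a b`: `r d := r a o r b`.
* `load d a`: `r d := r (r a)`; `store a b`: `r (r a) := r b`.
* `floor d e`: `r d := ⌊e⌋`.
* `shift q a`: the unitary `|y⟩ ↦ |y + r a⟩` on `Q q`.
* `mulAdd q₁ q₂ q₃ m`: the residue of `Q q₁` modulo `r m` is increased by `Q q₂ * Q q₃`.
* `fourier q m`: the quantum Fourier transform over `ℤ / (r m) ℤ` on the residue of `Q q`.
* `measure d q m`: the residue of `Q q` modulo `r m` is measured and stored in `r d`.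
* `query d a`: the oracle is called on the block of classical memory that starts at cell `r a`, and
  its answer, `1` or `0`, is stored in `r d`.
* `loop i b c`: `c` is executed for `r i = 0, 1, …, r b - 1` (with the value of `r b` on entry).
* `ifLt a b c₁ c₂`: `c₁` if `r a < r b`, and `c₂` otherwise. -/
inductive Cmd where
  | skip
  | const (d : ℕ) (z : ℤ)
  | arith (o : ArithOp) (d a b : ℕ)
  | load (d a : ℕ)
  | store (a b : ℕ)
  | floor (d : ℕ) (e : RealExpr)
  | shift (q a : ℕ)
  | mulAdd (q₁ q₂ q₃ m : ℕ)
  | fourier (q m : ℕ)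
  | measure (d q m : ℕ)
  | query (d a : ℕ)
  | seq (c₁ c₂ : Cmd)
  | ifLt (a b : ℕ) (c₁ c₂ : Cmd)
  | loop (i b : ℕ) (c : Cmd)

/-- What a run is relative to: the real input parameter, the length of the oracle's input, and
the oracle, which answers `1` with a probability that depends on its (classical) input. -/
structure Env where
  param : ℝ
  queryLen : ℕ
  oracle : (ℕ → ℤ) → unitInterval

/-- One branch of a run: the content of the classical memory, the state of the quantum memory
(unnormalized: its squared norm is the probability of the branch) and the time used. -/
structure Config where
  mem : ℕ → ℤ
  amp : (ℕ →₀ ℤ) → ℂ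
  time : ℕ

/-- The cost of handling the integer `z`: its length in binary, sign included. -/
def bits (z : ℤ) : ℕ := z.natAbs.size + 1

noncomputable section

def RealExpr.eval (r : ℝ) (mem : ℕ → ℤ) : RealExpr → ℝ
  | .param => r
  | .pi => Real.pi
  | .const z => z
  | .reg i => mem i
  | .add e f => e.eval r mem + f.eval r mem
  | .sub e f => e.eval r mem - f.eval r mem
  | .mul e f => e.eval r mem * f.eval r mem
  | .div e f => e.eval r mem / f.eval r mem
  | .exp e => Real.exp (e.eval r mem)

/-- The length of the integral part of a real number. -/
def realBits (x : ℝ) : ℕ := bits ⌈|x|⌉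

/-- The cost of a real expression: the lengths of the values of all its subexpressions. -/
def RealExpr.cost (r : ℝ) (mem : ℕ → ℤ) : RealExpr → ℕ
  | .param => realBits r
  | .pi => realBits Real.pi
  | .const z => bits z
  | .reg i => bits (mem i)
  | .add e f => e.cost r mem + f.cost r mem + realBits (e.eval r mem + f.eval r mem)
  | .sub e f => e.cost r mem + f.cost r mem + realBits (e.eval r mem - f.eval r mem)
  | .mul e f => e.cost r mem + f.cost r mem + realBits (e.eval r mem * f.eval r mem)
  | .div e f => e.cost r mem + f.cost r mem + realBits (e.eval r mem / f.eval r mem)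
  | .exp e => e.cost r mem + realBits (Real.exp (e.eval r mem))

def ArithOp.apply : ArithOp → ℤ → ℤ → ℤ
  | .add, x, y => x + y
  | .sub, x, y => x - y
  | .mul, x, y => x * y
  | .div, x, y => x / y
  | .mod, x, y => x % y

/-- `y` with its residue modulo `m` replaced by that of `v`. -/
def setResidue (m : ℕ) (y v : ℤ) : ℤ := m * (y / m) + v % m

/-- `|y⟩ ↦ |y + c⟩` on register `q`. -/
def shiftGate (q : ℕ) (c : ℤ) (ψ : (ℕ →₀ ℤ) → ℂ) : (ℕ →₀ ℤ) → ℂ :=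
  fun b => ψ (b.update q (b q - c))

/-- `|y₁⟩|y₂⟩|y₃⟩ ↦ |y₁ + y₂ y₃⟩|y₂⟩|y₃⟩`, the sum being taken on residues modulo `m`; nothing
happens if the target is one of the two other registers, or if `m = 0`. -/
def mulAddGate (q₁ q₂ q₃ m : ℕ) (ψ : (ℕ →₀ ℤ) → ℂ) : (ℕ →₀ ℤ) → ℂ :=
  if q₁ = q₂ ∨ q₁ = q₃ ∨ m = 0 then ψ
  else fun b => ψ (b.update q₁ (setResidue m (b q₁) (b q₁ - b q₂ * b q₃)))

/-- `|m u + v⟩ ↦ m ^ (-1/2) ∑_w exp (2 π i v w / m) |m u + w⟩` on register `q`, where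
`0 ≤ v, w < m`; nothing happens if `m = 0`. -/
def fourierGate (q m : ℕ) (ψ : (ℕ →₀ ℤ) → ℂ) : (ℕ →₀ ℤ) → ℂ :=
  if m = 0 then ψ
  else fun b => ((Real.sqrt m : ℝ) : ℂ)⁻¹ * ∑ v ∈ Finset.range m,
    Complex.exp (2 * Real.pi * Complex.I * v * ((b q % m : ℤ) : ℂ) / m) *
      ψ (b.update q (setResidue m (b q) v))

/-- The projection to the states in which register `q` is congruent to `v` modulo `m`. -/
def project (q m : ℕ) (v : ℤ) (ψ : (ℕ →₀ ℤ) → ℂ) : (ℕ →₀ ℤ) → ℂ :=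
  fun b => if b q % m = v then ψ b else 0

/-- Use `t` units of time. -/
def Config.tick (s : Config) (t : ℕ) : Config := { s with time := s.time + t }

/-- `r d := z`, using `t` units of time. -/
def Config.write (s : Config) (d : ℕ) (z : ℤ) (t : ℕ) : Config :=
  { s with mem := Function.update s.mem d z, time := s.time + t }

/-- Apply `g` to the quantum memory, using `t` units of time. -/
def Config.gate (s : Config) (g : ((ℕ →₀ ℤ) → ℂ) → ((ℕ →₀ ℤ) → ℂ)) (t : ℕ) : Config :=
  { s with amp := g s.amp, time := s.time + t }

/-- The probability of a branch. -/
def Config.weight (s : Config) : ℝ := ∑' b, ‖s.amp b‖ ^ 2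

/-- The branches in which the execution of a program on a configuration can end. -/
def run (E : Env) : Cmd → Config → List Config
  | .skip, s => [s]
  | .const d z, s => [s.write d z (bits z)]
  | .arith o d a b, s =>
      [s.write d (o.apply (s.mem a) (s.mem b)) (bits (s.mem a) + bits (s.mem b))]
  | .load d a, s =>
      [s.write d (s.mem (s.mem a).toNat) (bits (s.mem a) + bits (s.mem (s.mem a).toNat))]
  | .store a b, s =>
      [s.write (s.mem a).toNat (s.mem b) (bits (s.mem a) + bits (s.mem b))]
  | .floor d e, s =>
      [s.write d ⌊e.eval E.param s.mem⌋ (e.cost E.param s.mem)]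
  | .shift q a, s =>
      [s.gate (shiftGate (s.mem q).toNat (s.mem a)) (bits (s.mem q) + bits (s.mem a))]
  | .mulAdd q₁ q₂ q₃ m, s =>
      [s.gate (mulAddGate (s.mem q₁).toNat (s.mem q₂).toNat (s.mem q₃).toNat (s.mem m).toNat)
        (bits (s.mem q₁) + bits (s.mem q₂) + bits (s.mem q₃) + bits (s.mem m) ^ 2)]
  | .fourier q m, s =>
      [s.gate (fourierGate (s.mem q).toNat (s.mem m).toNat)
        (bits (s.mem q) + bits (s.mem m) ^ 3)]
  | .measure d q m, s =>
      if (s.mem m).toNat = 0 then [s.tick (bits (s.mem q) + bits (s.mem m))]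
      else (List.range (s.mem m).toNat).map fun v =>
        (s.gate (project (s.mem q).toNat (s.mem m).toNat v) 0).write d v
          (bits (s.mem q) + bits (s.mem m))
  | .query d a, s =>
      let p : ℝ := E.oracle fun t => s.mem ((s.mem a).toNat + t)
      let cost := bits (s.mem a) +
        ∑ t ∈ Finset.range E.queryLen, bits (s.mem ((s.mem a).toNat + t))
      [(s.gate (fun ψ b => ((Real.sqrt p : ℝ) : ℂ) * ψ b) 0).write d 1 cost,
       (s.gate (fun ψ b => ((Real.sqrt (1 - p) : ℝ) : ℂ) * ψ b) 0).write d 0 cost]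
  | .seq c₁ c₂, s => (run E c₁ s).flatMap fun s' => run E c₂ s'
  | .ifLt a b c₁ c₂, s =>
      if s.mem a < s.mem b then run E c₁ (s.tick (bits (s.mem a) + bits (s.mem b)))
      else run E c₂ (s.tick (bits (s.mem a) + bits (s.mem b)))
  | .loop i b c, s =>
      (List.range (s.mem b).toNat).foldl
        (fun L t => L.flatMap fun s' => run E c (s'.write i t (bits t)))
        [s.tick (bits (s.mem b))]

/-- The probability that cell `0` contains `1` at the end of the run. -/
def acceptProb (E : Env) (P : Cmd) (s : Config) : ℝ :=
  ((run E P s).map fun s' => if s'.mem 0 = 1 then s'.weight else 0).sum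

end

end QMachine

/-! ### Discrete Gaussians, decisional LWE and decisional EDCP -/

noncomputable section

/-- `ρ_r(j) = exp (-π j² / r²)`. -/
def gaussWeight (r : ℝ) (j : ℤ) : ℝ := Real.exp (-Real.pi * (j : ℝ) ^ 2 / r ^ 2)

/-- The discrete Gaussian distribution on `ℤ` with parameter `r`. -/
def discreteGaussian (r : ℝ) (j : ℤ) : ℝ := gaussWeight r j / ∑' i : ℤ, gaussWeight r i

/-- The distribution proportional to the square of `D`. -/
def squareDist (D : ℤ → ℝ) (j : ℤ) : ℝ := D j ^ 2 / ∑' i : ℤ, D i ^ 2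

/-- `ℓ` samples in `ℤ_N^n × ℤ_N`. -/
abbrev LWESamples (n N l : ℕ) : Type := Fin l → (Fin n → ZMod N) × ZMod N

/-- The probability that `A` accepts `ℓ` LWE samples with error distribution `χ`: the secret is
uniform, the vectors `a k` are uniform, and the errors are drawn from `χ`. -/
def lweAccept {n N l : ℕ} [NeZero N] (χ : ℤ → ℝ) (A : LWESamples n N l → unitInterval) : ℝ :=
  ((N : ℝ) ^ n)⁻¹ * ∑ s : Fin n → ZMod N,
    ((N : ℝ) ^ (n * l))⁻¹ * ∑ a : Fin l → Fin n → ZMod N,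
      ∑' e : Fin l → ℤ, (∏ k, χ (e k)) * (A fun k => (a k, a k ⬝ᵥ s + (e k : ZMod N)) : ℝ)

/-- The probability that `A` accepts `ℓ` uniform samples. -/
def uniformAccept {n N l : ℕ} [NeZero N] (A : LWESamples n N l → unitInterval) : ℝ :=
  ((N : ℝ) ^ ((n + 1) * l))⁻¹ * ∑ w : LWESamples n N l, (A w : ℝ)

/-- The normalized state `∑_j D(j) |j⟩|x + j s mod N⟩`. -/
def edcpState {n N : ℕ} (D : ℤ → ℝ) (s x : Fin n → ZMod N) : ℤ × (Fin n → ZMod N) → ℂ :=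
  fun y => if y.2 = x + y.1 • s then ((D y.1 / Real.sqrt (∑' i : ℤ, D i ^ 2) : ℝ) : ℂ) else 0

/-- The basis state `|j⟩|x⟩`. -/
def basisState {n N : ℕ} (j : ℤ) (x : Fin n → ZMod N) : ℤ × (Fin n → ZMod N) → ℂ :=
  fun y => if y = (j, x) then 1 else 0

open scoped Classical in
/-- The state of the quantum memory of the machine that holds the tensor product of `ℓ` states:
the `k`-th one is held by `n + 1` consecutive registers, beginning with number `k (n + 1)`,
residues are represented by `0, …, N - 1`, and all other registers hold `0`. -/
def loadStates {n N l : ℕ} (φ : Fin l → ℤ × (Fin n → ZMod N) → ℂ) : (ℕ →₀ ℤ) → ℂ := fun b =>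
  if (∀ (k : Fin l) (i : Fin n), 0 ≤ b (k * (n + 1) + 1 + i) ∧ b (k * (n + 1) + 1 + i) < N) ∧
      ∀ q, l * (n + 1) ≤ q → b q = 0 then
    ∏ k : Fin l, φ k (b (k * (n + 1)), fun i => (b (k * (n + 1) + 1 + i) : ZMod N))
  else 0

/-- Parameters of the two problems: the dimension, the modulus, the number of samples, and the
Gaussian parameter `r` of the EDCP states. -/
structure EDCPParams where
  n : ℕ
  N : ℕ
  l : ℕ
  r : ℝ
  one_le_n : 1 ≤ n
  two_le_N : 2 ≤ N
  n_le_l : n ≤ l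
  r_pos : 0 < r

instance (p : EDCPParams) : NeZero p.N := ⟨by have := p.two_le_N; omega⟩

namespace EDCPParams

/-- The machine gets the real number `r` as its parameter.  Its oracle is an algorithm `A` for
decisional LWE, which reads `ℓ` blocks of `n + 1` integers, one for each sample. -/
def env (p : EDCPParams) (A : LWESamples p.n p.N p.l → unitInterval) : QMachine.Env where
  param := p.r
  queryLen := p.l * (p.n + 1)
  oracle w := A fun k =>
    (fun i => (w (k * (p.n + 1) + i) : ZMod p.N), (w (k * (p.n + 1) + p.n) : ZMod p.N))

/-- At the beginning, the first four cells contain `κ`, `n`, `N` and `ℓ`. -/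
def start (p : EDCPParams) (κ : ℕ) (ψ : (ℕ →₀ ℤ) → ℂ) : QMachine.Config where
  mem
    | 0 => κ
    | 1 => p.n
    | 2 => p.N
    | 3 => p.l
    | _ => 0
  amp := ψ
  time := 0

/-- `ℓ` Gaussian EDCP states with common secret `s`. -/
def edcpInput (p : EDCPParams) (s : Fin p.n → ZMod p.N) (x : Fin p.l → Fin p.n → ZMod p.N) :
    (ℕ →₀ ℤ) → ℂ :=
  loadStates fun k => edcpState (discreteGaussian p.r) s (x k)

/-- `ℓ` basis states `|j k⟩|x k⟩`. -/
def basisInput (p : EDCPParams) (j : Fin p.l → ℤ) (x : Fin p.l → Fin p.n → ZMod p.N) :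
    (ℕ →₀ ℤ) → ℂ :=
  loadStates fun k => basisState (j k) (x k)

/-- The probability that `P`, with oracle `A`, accepts `ℓ` Gaussian EDCP states. -/
def edcpAccept (p : EDCPParams) (κ : ℕ) (P : QMachine.Cmd)
    (A : LWESamples p.n p.N p.l → unitInterval)
    (s : Fin p.n → ZMod p.N) (x : Fin p.l → Fin p.n → ZMod p.N) : ℝ :=
  QMachine.acceptProb (p.env A) P (p.start κ (p.edcpInput s x))

/-- The probability that `P`, with oracle `A`, accepts `ℓ` random states `|j k⟩|x k⟩`, where
`j k` is drawn from the distribution proportional to the squared Gaussian and `x k` is uniform. -/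
def randomAccept (p : EDCPParams) (κ : ℕ) (P : QMachine.Cmd)
    (A : LWESamples p.n p.N p.l → unitInterval) : ℝ :=
  ((p.N : ℝ) ^ (p.n * p.l))⁻¹ * ∑ x : Fin p.l → Fin p.n → ZMod p.N,
    ∑' j : Fin p.l → ℤ, (∏ k, squareDist (discreteGaussian p.r) (j k)) *
      QMachine.acceptProb (p.env A) P (p.start κ (p.basisInput j x))

/-- Every run of `P` on an input of the decisional EDCP takes at most `T` steps. -/
def RunsInTime (p : EDCPParams) (κ : ℕ) (P : QMachine.Cmd)
    (A : LWESamples p.n p.N p.l → unitInterval) (T : ℕ) : Prop :=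
  ∀ ψ, ((∃ s x, ψ = p.edcpInput s x) ∨ ∃ j x, ψ = p.basisInput j x) →
    ∀ c ∈ QMachine.run (p.env A) P (p.start κ ψ), c.amp ≠ 0 → c.time ≤ T

end EDCPParams

/-- `ε` is at least an inverse polynomial in `n log N`. -/
def NonNegligible (p : ℕ → EDCPParams) (ε : ℕ → ℝ) : Prop :=
  ∃ C > (0 : ℝ), ∃ c : ℕ, ∀ᶠ κ in atTop, C / ((p κ).n * Real.log (p κ).N) ^ c ≤ ε κ

/-- The family `A` solves the decisional LWE with error distribution `D_{ℤ, α N}`: it tells LWE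
samples from uniform samples with advantage inverse polynomial in `n log N`. -/
def SolvesDLWE (p : ℕ → EDCPParams) (α : ℕ → ℝ)
    (A : ∀ κ, LWESamples (p κ).n (p κ).N (p κ).l → unitInterval) : Prop :=
  NonNegligible p fun κ =>
    |lweAccept (discreteGaussian (α κ * (p κ).N)) (A κ) - uniformAccept (A κ)|

/-- The program `P`, with access to the oracles `A κ`, solves the decisional Gaussian EDCP: it
tells EDCP states, for every secret `s` and all shifts `x`, from random states, with advantage
inverse polynomial in `n log N`. -/
def SolvesDGEDCP (p : ℕ → EDCPParams) (P : QMachine.Cmd)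
    (A : ∀ κ, LWESamples (p κ).n (p κ).N (p κ).l → unitInterval) : Prop :=
  ∃ ε : ℕ → ℝ, NonNegligible p ε ∧ ∀ κ,
    (∀ s x, ε κ ≤ (p κ).edcpAccept κ P (A κ) s x - (p κ).randomAccept κ P (A κ)) ∨
    (∀ s x, ε κ ≤ (p κ).randomAccept κ P (A κ) - (p κ).edcpAccept κ P (A κ) s x)

/-- `P` is a quantum reduction, with run-time polynomial in `κ`, from the decisional Gaussian EDCP
to the decisional LWE with relative error `α`. -/
def IsQuantumReduction (p : ℕ → EDCPParams) (α : ℕ → ℝ) (P : QMachine.Cmd) : Prop :=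
  (∃ c : ℕ, ∀ᶠ κ in atTop, ∀ A, (p κ).RunsInTime κ P A (κ ^ c)) ∧
  ∀ A : ∀ κ, LWESamples (p κ).n (p κ).N (p κ).l → unitInterval,
    SolvesDLWE p α A → SolvesDGEDCP p P A

end

/-! Consider a block with amplitude `f j` on `|j⟩|x + j σ⟩`. Fourier transforming and measuring its
residues gives a uniform vector `a` and leaves `|j⟩` with the phase of `j ⟨a, σ⟩ / N`, up to a
global phase. A Fourier transform of `j` modulo `N` with outcome `b` makes `z = ⟨a, σ⟩ + b` follow
the normalized squared Fourier transform of `f`. For `f = ρ_r` Poisson summation shows that this law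
is nearly the discrete Gaussian with weight `exp (-2 π (r e / N)²)`, so that `(a, -b)` is an LWE
sample with error `-z` and parameter `N / (√2 r)`. Adding an independent error of the same law
brings the parameter to `N / r = α N`, and adding `⟨a, S⟩` for a uniform `S` makes the secret `σ +
S` uniform. For a basis state `f` is a point mass, its transform is flat, and the sample is exactly
uniform. Hence on random states the reduction accepts exactly as often as the oracle does on uniform
samples, and on EDCP states it is off by at most `ℓ` times an exponentially small error, which is
below half of the assumed advantage.

There are three approximations. The Fourier gate leaves the quotient of `j` by `N` alone, so
different quotients do not interfere; `j` is shifted by `N / 2` beforehand so that nearly all of the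
Gaussian lies in one window, which needs `N / r` large. The squared wrapped Gaussian is nearly a
wrapped Gaussian if `r` is large. The difference of two discrete Gaussians is nearly a discrete
Gaussian, again by Poisson summation. Every one of these errors is a multiple of `theta A - 1` with
`A ≥ c κ`, hence exponentially small. The remaining error is that of the rejection sampler which
supplies the added noise; its randomness comes from measuring the Fourier transform of a register
that holds `0`.

`branches_reduction` executes the program symbolically, with time bounds, for arbitrary amplitudes
`f`, and so covers both kinds of input. `acceptProb_reduction` turns this into a sum over products
of `blockLaw`, which `blockLaw_eq` and `blockLaw_single` identify. The distance to LWE is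
`sum_abs_blockError_le`, assembled from `sum_abs_outcomeProb_sub_le`, `sum_abs_noiseLaw_sub_le` and
`sum_abs_diffLaw_gauss_le`. The running time rests on `size_memBound_le`: all numbers that occur
have polynomial length. -/

namespace QMachine

/-! ### Branching runs indexed by finite types -/

/-- The branches of the run of `c` on `s` are indexed by `ι`, take at most `m * D` units of time,
and the branch with index `i` satisfies `Post i`. -/
def Branches (E : Env) (D : ℕ) (c : Cmd) (s : Config) (ι : Type) [Fintype ι] (m : ℕ)
    (Post : ι → Config → Prop) : Prop :=
  ∃ g : ι → Config, (↑(run E c s) : Multiset Config) = (Finset.univ : Finset ι).val.map g ∧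
    ∀ i, (g i).time ≤ s.time + m * D ∧ Post i (g i)

/-- All cells of the classical memory are bounded by `X`. -/
def Bdd (X : ℕ) (s : Config) : Prop := ∀ i, |s.mem i| ≤ X

/-- A bound for the time of a single command if the memory is bounded by `X`. -/
def stepCost (X : ℕ) : ℕ := 100 * (X.size + 1) ^ 3

theorem bits_le {X : ℕ} {z : ℤ} (h : |z| ≤ X) : bits z ≤ X.size + 1 := by
  unfold bits
  have : z.natAbs ≤ X := by
    rw [Int.abs_eq_natAbs] at h
    exact_mod_cast h
  have := Nat.size_le_size this
  omega

/-- The Fourier transform is the dominant command: its cost is cubic in the length of the modulus.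
The linear terms leave room for the addresses and for the evaluation of real expressions. -/
theorem pow_size_le_stepCost (X : ℕ) :
    X.size + 1 + (X.size + 1) ^ 3 + 98 * (X.size + 1) ≤ stepCost X := by
  unfold stepCost
  nlinarith [Nat.pow_le_pow_left (Nat.succ_le_succ (Nat.zero_le X.size)) 2, Nat.zero_le X.size,
    Nat.zero_le (X.size ^ 2), Nat.zero_le (X.size ^ 3)]

theorem size_le_stepCost (X : ℕ) : 99 * (X.size + 1) ≤ stepCost X := by
  have := pow_size_le_stepCost X
  have h2 : X.size + 1 ≤ (X.size + 1) ^ 3 := Nat.le_self_pow (by norm_num) _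
  omega

theorem realBits_le {X : ℕ} {x : ℝ} (h : |x| ≤ X) : realBits x ≤ X.size + 1 := by
  apply bits_le
  rw [abs_of_nonneg (Int.ceil_nonneg (abs_nonneg x))]
  exact Int.ceil_le.2 (by exact_mod_cast h)

variable {E : Env} {X D : ℕ} {s : Config} {c c₁ c₂ : Cmd}

theorem Bdd.write (h : Bdd X s) {d : ℕ} {z : ℤ} (hz : |z| ≤ X) (t : ℕ) :
    Bdd X (s.write d z t) := by
  intro i
  by_cases hi : i = d
  · subst hi; simpa [Config.write] using hz
  · simpa [Config.write, hi] using h i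

theorem Bdd.of_mem_eq {s' : Config} (h : Bdd X s) (e : s'.mem = s.mem) : Bdd X s' := by
  intro i; rw [e]; exact h i

theorem Branches.mono {ι : Type} [Fintype ι] {m m' : ℕ} {P Q : ι → Config → Prop}
    (h : Branches E D c s ι m P) (hm : m ≤ m') (hPQ : ∀ i s', P i s' → Q i s') :
    Branches E D c s ι m' Q := by
  obtain ⟨g, h1, h2⟩ := h
  exact ⟨g, h1, fun i => ⟨(h2 i).1.trans (by gcongr), hPQ i _ (h2 i).2⟩⟩

theorem Branches.reindex {ι κ : Type} [Fintype ι] [Fintype κ] {m : ℕ}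
    {P : ι → Config → Prop} {Q : κ → Config → Prop}
    (h : Branches E D c s ι m P) (e : κ ≃ ι) (hPQ : ∀ i s', P (e i) s' → Q i s') :
    Branches E D c s κ m Q := by
  obtain ⟨g, h1, h2⟩ := h
  refine ⟨g ∘ e, ?_, fun i => ⟨(h2 (e i)).1, hPQ i _ (h2 (e i)).2⟩⟩
  rw [h1, ← Multiset.map_map]
  congr 1
  rw [← Finset.map_univ_equiv e]
  rfl

theorem Branches.skip {P : Unit → Config → Prop} (h : P () s) :
    Branches E D .skip s Unit 0 P :=
  ⟨fun _ => s, by simp [run], fun _ => ⟨by simp, h⟩⟩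

/-- Branches are compared as multisets, so their order is irrelevant and a flat map becomes an
enumeration of pairs. The second postcondition may depend on the index of the first branch, which
carries measurement outcomes through the program. -/
theorem Branches.seq {ι κ : Type} [Fintype ι] [Fintype κ] {m m' : ℕ}
    {P : ι → Config → Prop} {Q : ι × κ → Config → Prop}
    (h₁ : Branches E D c₁ s ι m P)
    (h₂ : ∀ i s', P i s' → Branches E D c₂ s' κ m' fun j => Q (i, j)) :
    Branches E D (.seq c₁ c₂) s (ι × κ) (m + m') Q := by
  obtain ⟨g, hg, hg'⟩ := h₁
  choose g₂ hg₂ hg₂' using fun i => h₂ i (g i) (hg' i).2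
  refine ⟨fun p => g₂ p.1 p.2, ?_, fun p => ⟨?_, (hg₂' p.1 p.2).2⟩⟩
  · rw [run, ← Multiset.coe_bind, hg, Multiset.bind_map]
    simp_rw [hg₂]
    rw [← Finset.univ_product_univ, Finset.product_val]
    simp [SProd.sprod, Multiset.product, Multiset.map_bind]
  · have h1 := (hg' p.1).1
    have h2 := (hg₂' p.1 p.2).1
    simp only [add_mul]
    omega

/-- A command with a single branch leaves the index type alone, so straight-line code adds no
trivial factors to it. -/
theorem Branches.det {ι : Type} [Fintype ι] {m : ℕ} {P : ι → Config → Prop} {s' : Config}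
    (hr : run E c₁ s = [s']) (ht : s'.time ≤ s.time + D) (h : Branches E D c₂ s' ι m P) :
    Branches E D (.seq c₁ c₂) s ι (m + 1) P := by
  obtain ⟨g, h1, h2⟩ := h
  refine ⟨g, by simp [run, hr, h1], fun i => ⟨?_, (h2 i).2⟩⟩
  have := (h2 i).1
  simp only [add_mul, one_mul]
  omega

/-! ### Rules for single commands in continuation form, exposing only memory, amplitude and the
bound of the new configuration. -/

section steps
variable {ι : Type} [Fintype ι] {m : ℕ} {P : ι → Config → Prop}

theorem Branches.const (hb : Bdd X s) (d : ℕ) (z : ℤ) (hz : |z| ≤ X)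
    (h : ∀ s', s'.mem = Function.update s.mem d z → s'.amp = s.amp → Bdd X s' →
      Branches E (stepCost X) c s' ι m P) :
    Branches E (stepCost X) (.seq (.const d z) c) s ι (m + 1) P := by
  refine Branches.det rfl ?_ (h _ rfl rfl (hb.write hz _))
  have := bits_le hz
  have := size_le_stepCost X
  simp only [Config.write]
  omega

theorem Branches.arith (hb : Bdd X s) (o : ArithOp) (d a b : ℕ)
    (hz : |o.apply (s.mem a) (s.mem b)| ≤ X)
    (h : ∀ s', s'.mem = Function.update s.mem d (o.apply (s.mem a) (s.mem b)) →
      s'.amp = s.amp → Bdd X s' → Branches E (stepCost X) c s' ι m P) :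
    Branches E (stepCost X) (.seq (.arith o d a b) c) s ι (m + 1) P := by
  refine Branches.det rfl ?_ (h _ rfl rfl (hb.write hz _))
  have := bits_le (hb a)
  have := bits_le (hb b)
  have := size_le_stepCost X
  simp only [Config.write]
  omega

theorem Branches.load (hb : Bdd X s) (d a : ℕ)
    (h : ∀ s', s'.mem = Function.update s.mem d (s.mem (s.mem a).toNat) →
      s'.amp = s.amp → Bdd X s' → Branches E (stepCost X) c s' ι m P) :
    Branches E (stepCost X) (.seq (.load d a) c) s ι (m + 1) P := by
  refine Branches.det rfl ?_ (h _ rfl rfl (hb.write (hb _) _))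
  have := bits_le (hb a)
  have := bits_le (hb (s.mem a).toNat)
  have := size_le_stepCost X
  simp only [Config.write]
  omega

theorem Branches.store (hb : Bdd X s) (a b : ℕ)
    (h : ∀ s', s'.mem = Function.update s.mem (s.mem a).toNat (s.mem b) →
      s'.amp = s.amp → Bdd X s' → Branches E (stepCost X) c s' ι m P) :
    Branches E (stepCost X) (.seq (.store a b) c) s ι (m + 1) P := by
  refine Branches.det rfl ?_ (h _ rfl rfl (hb.write (hb _) _))
  have := bits_le (hb a)
  have := bits_le (hb b)
  have := size_le_stepCost X
  simp only [Config.write]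
  omega

theorem Branches.floor (hb : Bdd X s) (d : ℕ) (e : RealExpr)
    (hz : |⌊e.eval E.param s.mem⌋| ≤ X) (hc : e.cost E.param s.mem ≤ 99 * (X.size + 1))
    (h : ∀ s', s'.mem = Function.update s.mem d ⌊e.eval E.param s.mem⌋ →
      s'.amp = s.amp → Bdd X s' → Branches E (stepCost X) c s' ι m P) :
    Branches E (stepCost X) (.seq (.floor d e) c) s ι (m + 1) P := by
  refine Branches.det rfl ?_ (h _ rfl rfl (hb.write hz _))
  have := size_le_stepCost X
  simp only [Config.write]
  omega

theorem Branches.shift (hb : Bdd X s) (q a : ℕ)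
    (h : ∀ s', s'.mem = s.mem → s'.amp = shiftGate (s.mem q).toNat (s.mem a) s.amp →
      Bdd X s' → Branches E (stepCost X) c s' ι m P) :
    Branches E (stepCost X) (.seq (.shift q a) c) s ι (m + 1) P := by
  refine Branches.det rfl ?_ (h _ rfl rfl (hb.of_mem_eq rfl))
  have := bits_le (hb a)
  have := bits_le (hb q)
  have := size_le_stepCost X
  simp only [Config.gate]
  omega

theorem Branches.fourier (hb : Bdd X s) (q a : ℕ)
    (h : ∀ s', s'.mem = s.mem →
      s'.amp = fourierGate (s.mem q).toNat (s.mem a).toNat s.amp →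
      Bdd X s' → Branches E (stepCost X) c s' ι m P) :
    Branches E (stepCost X) (.seq (.fourier q a) c) s ι (m + 1) P := by
  refine Branches.det rfl ?_ (h _ rfl rfl (hb.of_mem_eq rfl))
  have h1 := Nat.pow_le_pow_left (bits_le (hb a)) 3
  have h2 := bits_le (hb q)
  have := pow_size_le_stepCost X
  simp only [Config.gate]
  omega

theorem Branches.measure (hb : Bdd X s) (d q a : ℕ) {N : ℕ} (hN : s.mem a = N) (h0 : 0 < N)
    {P : Fin N × ι → Config → Prop}
    (h : ∀ (v : Fin N) s', s'.mem = Function.update s.mem d (v : ℕ) →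
      s'.amp = project (s.mem q).toNat N (v : ℕ) s.amp →
      Bdd X s' → Branches E (stepCost X) c s' ι m fun i => P (v, i)) :
    Branches E (stepCost X) (.seq (.measure d q a) c) s (Fin N × ι) (m + 1) P := by
  have hN' := hb a
  rw [hN] at hN'
  rw [add_comm]
  refine Branches.seq (ι := Fin N) (m := 1) (P := fun v s' =>
    s'.mem = Function.update s.mem d (v : ℕ) ∧
      s'.amp = project (s.mem q).toNat N (v : ℕ) s.amp ∧ Bdd X s') ?_
    (fun v s' hs => h v s' hs.1 hs.2.1 hs.2.2)
  refine ⟨fun v => (s.gate (project (s.mem q).toNat N (v : ℕ)) 0).write d (v : ℕ)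
    (bits (s.mem q) + bits (s.mem a)), ?_, fun v => ⟨?_, rfl, rfl, ?_⟩⟩
  · simp only [run, hN, Int.toNat_natCast, h0.ne', if_false]
    rw [Fin.univ_def]
    simp only [Multiset.map_coe]
    rw [← List.map_coe_finRange_eq_range]
    simp only [List.pure_def, List.bind_eq_flatMap, List.flatMap_map, List.map_flatMap,
      List.map_cons, List.map_nil]
    rw [List.map_eq_flatMap]
  · have := bits_le (hb a)
    have := bits_le (hb q)
    have := size_le_stepCost X
    simp only [Config.write, Config.gate]
    omega
  · refine Bdd.write (s := s.gate (project (s.mem q).toNat N (v : ℕ)) 0) (hb.of_mem_eq rfl) ?_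
      (bits (s.mem q) + bits (s.mem a))
    have := v.2
    rw [abs_of_nonneg (by positivity)] at hN' ⊢
    omega

end steps

theorem Branches.ifLt {ι : Type} [Fintype ι] {m : ℕ} {P : ι → Config → Prop}
    (hb : Bdd X s) (a b : ℕ)
    (h₁ : s.mem a < s.mem b → ∀ s', s'.mem = s.mem → s'.amp = s.amp → Bdd X s' →
      Branches E (stepCost X) c₁ s' ι m P)
    (h₂ : ¬ s.mem a < s.mem b → ∀ s', s'.mem = s.mem → s'.amp = s.amp → Bdd X s' →
      Branches E (stepCost X) c₂ s' ι m P) :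
    Branches E (stepCost X) (.ifLt a b c₁ c₂) s ι (m + 1) P := by
  have e1 := bits_le (hb a)
  have e2 := bits_le (hb b)
  have e3 := size_le_stepCost X
  by_cases hab : s.mem a < s.mem b
  · obtain ⟨g, g1, g2⟩ := h₁ hab (s.tick _) rfl rfl (hb.of_mem_eq rfl)
    refine ⟨g, by rw [run, if_pos hab, g1], fun i => ⟨?_, (g2 i).2⟩⟩
    have := (g2 i).1
    simp only [Config.tick, add_mul, one_mul] at *
    omega
  · obtain ⟨g, g1, g2⟩ := h₂ hab (s.tick _) rfl rfl (hb.of_mem_eq rfl)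
    refine ⟨g, by rw [run, if_neg hab, g1], fun i => ⟨?_, (g2 i).2⟩⟩
    have := (g2 i).1
    simp only [Config.tick, add_mul, one_mul] at *
    omega

/-- The loop rule: the branches of `T` rounds are indexed by the words of length `T`. -/
theorem Branches.loop {ι : Type} [Fintype ι] {m T : ℕ} (hb : Bdd X s) (i b : ℕ)
    (hT : s.mem b = T) (Inv : ∀ t : ℕ, (Fin t → ι) → Config → Prop)
    (h0 : ∀ s', s'.mem = s.mem → s'.amp = s.amp → Inv 0 (fun j => j.elim0) s')
    (hInv : ∀ t w s', t < T → Inv t w s' → Bdd X s')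
    (hstep : ∀ t (w : Fin t → ι) s' s'', t < T → Inv t w s' →
      s''.mem = Function.update s'.mem i t → s''.amp = s'.amp → Bdd X s'' →
      Branches E (stepCost X) c s'' ι m fun x => Inv (t + 1) (Fin.snoc (α := fun _ => ι) w x)) :
    Branches E (stepCost X) (.loop i b c) s (Fin T → ι) (1 + T * (m + 1)) (Inv T) := by
  have hTX := hb b
  rw [hT] at hTX
  have e3 := size_le_stepCost X
  have key : ∀ t, t ≤ T → ∃ g : (Fin t → ι) → Config,
      (↑((List.range t).foldl
        (fun L t => L.flatMap fun s' => run E c (s'.write i t (bits t)))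
        [s.tick (bits (s.mem b))]) : Multiset Config) = (Finset.univ : Finset _).val.map g ∧
      ∀ w, (g w).time ≤ s.time + (1 + t * (m + 1)) * stepCost X ∧ Inv t w (g w) := by
    intro t
    induction t with
    | zero =>
      intro _
      refine ⟨fun _ => s.tick (bits (s.mem b)), by simp, fun w => ⟨?_, ?_⟩⟩
      · have := bits_le (hb b)
        simp only [Config.tick]
        omega
      · rw [Subsingleton.elim w fun j => j.elim0]
        exact h0 _ rfl rfl
    | succ t ih =>
      intro ht
      obtain ⟨g, hg, hg'⟩ := ih (by omega)
      have htX : |(t : ℤ)| ≤ X := by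
        rw [abs_of_nonneg (by positivity)] at *
        omega
      -- A round starts after the loop variable has been written; that write accounts for the extra
      -- unit in `m + 1`.
      choose g₂ hg₂ hg₂' using fun w => hstep t w (g w) ((g w).write i t (bits t)) (by omega)
        (hg' w).2 rfl rfl ((hInv t w _ (by omega) (hg' w).2).write htX _)
      refine ⟨fun w => g₂ (Fin.init w) (w (Fin.last t)), ?_, fun w => ⟨?_, ?_⟩⟩
      · rw [List.range_succ, List.foldl_append, List.foldl_cons, List.foldl_nil,
          ← Multiset.coe_bind, hg, Multiset.bind_map]
        simp_rw [hg₂]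
        -- Words of length `t + 1` are pairs of a word of length `t` and a last letter, matching the
        -- order in which the fold appends rounds.
        have : (Finset.univ : Finset (Fin (t + 1) → ι)).val =
            (Finset.univ : Finset ((Fin t → ι) × ι)).val.map
              (fun p => (Fin.snocEquiv fun _ => ι) (p.2, p.1)) := by
          have h1 := Finset.map_univ_equiv ((Equiv.prodComm (Fin t → ι) ι).trans
            (Fin.snocEquiv fun _ => ι))
          rw [← h1]
          rfl
        rw [this, Multiset.map_map, ← Finset.univ_product_univ, Finset.product_val]
        simp [SProd.sprod, Multiset.product, Multiset.map_bind, Fin.snocEquiv]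
      · have h1 := (hg' (Fin.init w)).1
        have h2 := (hg₂' (Fin.init w) (w (Fin.last t))).1
        have h3 := bits_le htX
        simp only [Config.write] at h2
        beta_reduce
        have : (1 + (t + 1) * (m + 1)) * stepCost X
          = (1 + t * (m + 1)) * stepCost X + m * stepCost X + stepCost X := by ring
        omega
      · have := (hg₂' (Fin.init w) (w (Fin.last t))).2
        beta_reduce at this ⊢
        rwa [Fin.snoc_init_self] at this
  have := key T le_rfl
  rw [Branches, run, hT, Int.toNat_natCast]
  rwa [hT] at this

end QMachine

namespace QMachine

/-! ### Gates on tensor products of block states -/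

theorem shiftGate_smul (q : ℕ) (c : ℤ) (z : ℂ) (ψ : (ℕ →₀ ℤ) → ℂ) :
    shiftGate q c (z • ψ) = z • shiftGate q c ψ := rfl

theorem fourierGate_smul (q m : ℕ) (z : ℂ) (ψ : (ℕ →₀ ℤ) → ℂ) :
    fourierGate q m (z • ψ) = z • fourierGate q m ψ := by
  unfold fourierGate
  split_ifs
  · rfl
  · funext b
    simp only [Pi.smul_apply, smul_eq_mul, Finset.mul_sum]
    exact Finset.sum_congr rfl fun v _ => by ring

theorem project_smul (q m : ℕ) (v : ℤ) (z : ℂ) (ψ : (ℕ →₀ ℤ) → ℂ) :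
    project q m v (z • ψ) = z • project q m v ψ := by
  funext b
  simp [project]

/-- A Fourier transform, a measurement and a reset of a register that holds `0` yield a uniform
residue and do not change the state. -/
theorem reset_fresh {q m : ℕ} (hm : 0 < m) {v : ℤ} (h0 : 0 ≤ v) (hv : v < m)
    {ψ : (ℕ →₀ ℤ) → ℂ} (hψ : ∀ b, b q ≠ 0 → ψ b = 0) :
    shiftGate q (0 - v) (project q m v (fourierGate q m ψ)) = ((Real.sqrt m : ℝ) : ℂ)⁻¹ • ψ := by
  funext b
  have hm' : (0 : ℤ) < m := by exact_mod_cast hm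
  -- The state lives where the register is `0`. Reading the Fourier sum at a point of residue `v`,
  -- only the term with residue `0` can hit that support, and it forces the quotient to vanish as
  -- well.
  have key : ∀ u ∈ Finset.range m, ∀ y : ℤ, y % m = v → setResidue m y u = 0 → y = v ∧ u = 0 := by
    intro u hu y hy h
    have hu' := Finset.mem_range.1 hu
    unfold setResidue at h
    have h1 : (u : ℤ) % m = u := Int.emod_eq_of_lt (by positivity) (by exact_mod_cast hu')
    rw [h1] at h
    have h3 : y / m = 0 := by
      have hul : (u : ℤ) < m := by exact_mod_cast hu'
      have hun : (0 : ℤ) ≤ u := by positivity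
      by_contra hne
      rcases lt_or_gt_of_ne hne with h4 | h4 <;> nlinarith
    have := Int.emod_add_mul_ediv y m
    rw [h3] at h this
    simp at h this
    exact ⟨by omega, h⟩
  simp only [shiftGate, project, fourierGate, hm.ne', if_false, Finsupp.coe_update,
    Function.update_self, Finsupp.update_idem, Pi.smul_apply, smul_eq_mul]
  by_cases hb : b q = 0
  · have hv2 : v % m = v := Int.emod_eq_of_lt h0 hv
    have hself : b.update q 0 = b := by rw [← hb, Finsupp.update_self]
    simp only [hb, zero_sub, sub_neg_eq_add, zero_add, hv2, if_true]
    congr 1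
    rw [Finset.sum_eq_single 0]
    · simp [setResidue, Int.ediv_eq_zero_of_lt h0 hv, hself]
    · intro u hu hne
      rw [hψ, mul_zero]
      simp only [Finsupp.coe_update, Function.update_self]
      exact fun h => hne (key u hu v hv2 h).2
    · simp [hm]
  · rw [hψ b hb, mul_zero]
    split_ifs with h
    · rw [Finset.sum_eq_zero, mul_zero]
      intro u hu
      rw [hψ, mul_zero]
      simp only [Finsupp.coe_update, Function.update_self]
      exact fun h' => hb (by have := (key u hu _ h h').1; omega)
    · rfl

end QMachine

/-! ### Gates on one register act on one tensor factor. -/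

section loadStates
open QMachine

variable {n N l : ℕ}

/-- The content of the `k`-th block of registers. -/
def blockAt (n N : ℕ) (b : ℕ →₀ ℤ) (k : ℕ) : ℤ × (Fin n → ZMod N) :=
  (b (k * (n + 1)), fun i => (b (k * (n + 1) + 1 + i) : ZMod N))

/-- The basis states on which the states `loadStates φ` live. -/
def GoodIndex (n N l : ℕ) (b : ℕ →₀ ℤ) : Prop :=
  (∀ (k : Fin l) (i : Fin n), 0 ≤ b (k * (n + 1) + 1 + i) ∧ b (k * (n + 1) + 1 + i) < N) ∧
    ∀ q, l * (n + 1) ≤ q → b q = 0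

theorem loadStates_of_good {φ : Fin l → ℤ × (Fin n → ZMod N) → ℂ} {b : ℕ →₀ ℤ}
    (h : GoodIndex n N l b) : loadStates φ b = ∏ k : Fin l, φ k (blockAt n N b k) :=
  if_pos h

theorem loadStates_of_not_good {φ : Fin l → ℤ × (Fin n → ZMod N) → ℂ} {b : ℕ →₀ ℤ}
    (h : ¬ GoodIndex n N l b) : loadStates φ b = 0 :=
  if_neg h

/-- The register just after the last block holds `0` throughout; it is the source of all classical
randomness. -/
theorem loadStates_fresh (φ : Fin l → ℤ × (Fin n → ZMod N) → ℂ) (b : ℕ →₀ ℤ)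
    (h : b (l * (n + 1)) ≠ 0) : loadStates φ b = 0 :=
  loadStates_of_not_good fun hg => h (hg.2 _ le_rfl)

theorem blockPos_lt (k : Fin l) {i : ℕ} (hi : i < n + 1) : k * (n + 1) + i < l * (n + 1) := by
  have := k.2
  nlinarith

theorem blockPos_inj {k k' i i' : ℕ} (hi : i < n + 1) (hi' : i' < n + 1)
    (h : k * (n + 1) + i = k' * (n + 1) + i') : k = k' ∧ i = i' := by
  have h1 : k = k' := by
    by_contra hne
    rcases lt_or_gt_of_ne hne with h2 | h2 <;> nlinarith
  subst h1
  exact ⟨rfl, by omega⟩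

theorem blockAt_update_x (b : ℕ →₀ ℤ) (k k' : ℕ) (i : Fin n) (v : ℤ) :
    blockAt n N (b.update (k * (n + 1) + 1 + i) v) k' =
      if k' = k then ((blockAt n N b k).1, Function.update (blockAt n N b k).2 i (v : ZMod N))
      else blockAt n N b k' := by
  have hi := i.2
  have h0 : k' * (n + 1) ≠ k * (n + 1) + 1 + i := fun h => by
    have := (blockPos_inj (k := k') (k' := k) (i := 0) (i' := 1 + i) (n := n) (by omega) (by omega)
      (by omega)).2
    omega
  by_cases hk : k' = k
  · subst hk
    rw [if_pos rfl]
    ext j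
    · simp [blockAt, h0]
    · by_cases hj : j = i
      · subst hj; simp [blockAt]
      · have : k' * (n + 1) + 1 + (j : ℕ) ≠ k' * (n + 1) + 1 + i := by
          have := Fin.val_ne_of_ne hj; omega
        simp [blockAt, hj, Fin.val_ne_of_ne hj]
  · rw [if_neg hk]
    ext j
    · simp [blockAt, h0]
    · have hj := j.2
      have : k' * (n + 1) + 1 + (j : ℕ) ≠ k * (n + 1) + 1 + i := fun h =>
        hk (blockPos_inj (i := 1 + j) (i' := 1 + i) (n := n) (by omega) (by omega) (by omega)).1
      simp [blockAt, this]

theorem blockAt_update_j (b : ℕ →₀ ℤ) (k k' : ℕ) (v : ℤ) :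
    blockAt n N (b.update (k * (n + 1)) v) k' =
      if k' = k then (v, (blockAt n N b k).2) else blockAt n N b k' := by
  have h0 : ∀ j : Fin n, k' * (n + 1) + 1 + j ≠ k * (n + 1) := fun j h => by
    have hj := j.2
    have := (blockPos_inj (k := k') (k' := k) (i := 1 + j) (i' := 0) (n := n) (by omega) (by omega)
      (by omega)).2
    omega
  by_cases hk : k' = k
  · subst hk
    rw [if_pos rfl]
    ext j
    · simp [blockAt]
    · simp [blockAt, h0]
  · rw [if_neg hk]
    have : k' * (n + 1) ≠ k * (n + 1) := fun h => hk (Nat.eq_of_mul_eq_mul_right (by omega) h)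
    ext j
    · simp [blockAt, hk]
    · simp [blockAt, h0]

/-- The index is constrained at the updated register itself, so neither side alone implies the
other: each must carry the range condition on the value that it forgets. For the integer register
there is no such condition. -/
theorem goodIndex_update_x {b : ℕ →₀ ℤ} {k : Fin l} {i : Fin n} {v : ℤ} :
    GoodIndex n N l (b.update (k * (n + 1) + 1 + i) v) ∧
      (0 ≤ b (k * (n + 1) + 1 + i) ∧ b (k * (n + 1) + 1 + i) < N) ↔
    GoodIndex n N l b ∧ (0 ≤ v ∧ v < N) := by
  have hi := i.2
  have hlt := blockPos_lt (n := n) k (i := 1 + i) (by omega)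
  have hne : ∀ q, l * (n + 1) ≤ q → q ≠ k * (n + 1) + 1 + i := fun q hq => by omega
  constructor
  · rintro ⟨⟨h1, h2⟩, h3⟩
    refine ⟨⟨fun k' i' => ?_, fun q hq => ?_⟩, ?_⟩
    · by_cases he : (k' : ℕ) * (n + 1) + 1 + i' = k * (n + 1) + 1 + i
      · rw [he]; exact h3
      · simpa [Finsupp.coe_update, Function.update_of_ne he] using h1 k' i'
    · simpa [Finsupp.coe_update, Function.update_of_ne (hne q hq)] using h2 q hq
    · simpa using h1 k i
  · rintro ⟨⟨h1, h2⟩, h3⟩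
    refine ⟨⟨fun k' i' => ?_, fun q hq => ?_⟩, h1 k i⟩
    · by_cases he : (k' : ℕ) * (n + 1) + 1 + i' = k * (n + 1) + 1 + i
      · rw [he]; simpa using h3
      · simpa [Finsupp.coe_update, Function.update_of_ne he] using h1 k' i'
    · simpa [Finsupp.coe_update, Function.update_of_ne (hne q hq)] using h2 q hq

theorem goodIndex_update_j {b : ℕ →₀ ℤ} {k : Fin l} {v : ℤ} :
    GoodIndex n N l (b.update (k * (n + 1)) v) ↔ GoodIndex n N l b := by
  have h0 : ∀ (k' : ℕ) (j : Fin n), k' * (n + 1) + 1 + j ≠ k * (n + 1) := fun k' j h => by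
    have hj := j.2
    have := (blockPos_inj (k := k') (k' := k) (i := 1 + j) (i' := 0) (n := n) (by omega) (by omega)
      (by omega)).2
    omega
  have hlt := blockPos_lt (n := n) k (i := 0) (by omega)
  have hne : ∀ q, l * (n + 1) ≤ q → q ≠ k * (n + 1) := fun q hq => by omega
  unfold GoodIndex
  refine and_congr (forall_congr' fun k' => forall_congr' fun i => ?_)
    (forall_congr' fun q => forall_congr' fun hq => ?_)
  · rw [Finsupp.coe_update, Function.update_of_ne (h0 k' i)]
  · rw [Finsupp.coe_update, Function.update_of_ne (hne q hq)]

theorem prod_update_apply (φ : Fin l → ℤ × (Fin n → ZMod N) → ℂ) (k : Fin l)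
    (χ : ℤ × (Fin n → ZMod N) → ℂ) (y : ℕ → ℤ × (Fin n → ZMod N)) :
    ∏ k' : Fin l, Function.update φ k χ k' (y k') =
      χ (y k) * ∏ k' ∈ Finset.univ.erase k, φ k' (y k') := by
  rw [← Finset.mul_prod_erase _ _ (Finset.mem_univ k), Function.update_self]
  congr 1
  exact Finset.prod_congr rfl fun k' hk' => by
    rw [Function.update_of_ne (Finset.ne_of_mem_erase hk')]

theorem prod_ite_apply (φ : Fin l → ℤ × (Fin n → ZMod N) → ℂ) (k : Fin l)
    (y : ℕ → ℤ × (Fin n → ZMod N)) (z : ℤ × (Fin n → ZMod N)) :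
    ∏ k' : Fin l, φ k' (if (k' : ℕ) = k then z else y k') =
      φ k z * ∏ k' ∈ Finset.univ.erase k, φ k' (y k') := by
  rw [← Finset.mul_prod_erase _ _ (Finset.mem_univ k), if_pos rfl]
  congr 1
  exact Finset.prod_congr rfl fun k' hk' => by
    rw [if_neg (Fin.val_ne_of_ne (Finset.ne_of_mem_erase hk'))]

theorem emod_eq_iff_cast_eq {y v : ℤ} (h0 : 0 ≤ v) (hv : v < N) :
    y % N = v ↔ (y : ZMod N) = v := by
  rw [ZMod.intCast_eq_intCast_iff, Int.ModEq, Int.emod_eq_of_lt h0 hv]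

theorem shiftGate_loadStates_j (φ : Fin l → ℤ × (Fin n → ZMod N) → ℂ) (k : Fin l) (c : ℤ) :
    shiftGate (k * (n + 1)) c (loadStates φ) =
      loadStates (Function.update φ k fun y => φ k (y.1 - c, y.2)) := by
  funext b
  rw [shiftGate]
  by_cases hg : GoodIndex n N l b
  · rw [loadStates_of_good hg, loadStates_of_good (goodIndex_update_j.2 hg),
      prod_update_apply φ k _ (blockAt n N b)]
    simp_rw [blockAt_update_j]
    rw [prod_ite_apply φ k (blockAt n N b)]
    simp [blockAt]
  · rw [loadStates_of_not_good hg, loadStates_of_not_good (mt goodIndex_update_j.1 hg)]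

theorem project_loadStates_x (φ : Fin l → ℤ × (Fin n → ZMod N) → ℂ) (k : Fin l) (i : Fin n)
    {v : ℤ} (h0 : 0 ≤ v) (hv : v < N) :
    project (k * (n + 1) + 1 + i) N v (loadStates φ) =
      loadStates (Function.update φ k fun y => if y.2 i = v then φ k y else 0) := by
  funext b
  rw [project]
  by_cases hg : GoodIndex n N l b
  · rw [loadStates_of_good hg, loadStates_of_good hg, prod_update_apply φ k _ (blockAt n N b),
      ← Finset.mul_prod_erase _ _ (Finset.mem_univ k)]
    simp only [emod_eq_iff_cast_eq h0 hv, blockAt]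
    split_ifs with h <;> simp [h]
  · simp [loadStates_of_not_good hg]

theorem project_loadStates_j (φ : Fin l → ℤ × (Fin n → ZMod N) → ℂ) (k : Fin l)
    {v : ℤ} (h0 : 0 ≤ v) (hv : v < N) :
    project (k * (n + 1)) N v (loadStates φ) =
      loadStates (Function.update φ k fun y => if (y.1 : ZMod N) = v then φ k y else 0) := by
  funext b
  rw [project]
  by_cases hg : GoodIndex n N l b
  · rw [loadStates_of_good hg, loadStates_of_good hg, prod_update_apply φ k _ (blockAt n N b),
      ← Finset.mul_prod_erase _ _ (Finset.mem_univ k)]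
    simp only [emod_eq_iff_cast_eq h0 hv, blockAt]
    split_ifs with h <;> simp [h]
  · simp [loadStates_of_not_good hg]

/-- The residues of a word of length `t`, padded with zeros. -/
def extWord {t : ℕ} (w : Fin t → Fin N) (i : ℕ) : ZMod N :=
  if h : i < t then ((w ⟨i, h⟩ : ℕ) : ZMod N) else 0

theorem extWord_snoc {t : ℕ} (w : Fin t → Fin N) (v : Fin N) (i : Fin n) (hi : (i : ℕ) = t) :
    (fun j : Fin n => extWord (Fin.snoc (α := fun _ => Fin N) w v) j) =
      Function.update (fun j : Fin n => extWord w j) i ((v : ℕ) : ZMod N) := by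
  funext j
  by_cases hj : j = i
  · subst hj
    simp [extWord, Fin.snoc, hi]
  · have := Fin.val_ne_of_ne hj
    rw [Function.update_of_ne hj]
    by_cases h : (j : ℕ) < t
    · simp [extWord, Fin.snoc, h, Nat.lt_succ_of_lt h]
    · have : ¬ (j : ℕ) < t + 1 := by omega
      simp [extWord, h, this]

variable [NeZero N]

theorem exp_eq_stdAddChar (v : ℕ) (w : ℤ) :
    Complex.exp (2 * Real.pi * Complex.I * v * ((w % N : ℤ) : ℂ) / N) =
      ZMod.stdAddChar ((v : ZMod N) * (w : ZMod N)) := by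
  have h1 : ((v : ZMod N) * (w : ZMod N)) = ((v * (w % N : ℤ) : ℤ) : ZMod N) := by
    push_cast
    rfl
  rw [h1, ZMod.stdAddChar_coe]
  push_cast
  ring_nf

theorem sum_range_eq_sum_zmod {M : Type*} [AddCommMonoid M] (F : ℕ → M) :
    ∑ v ∈ Finset.range N, F v = ∑ v : ZMod N, F v.val := by
  refine Finset.sum_bij' (fun v _ => (v : ZMod N)) (fun v _ => v.val) ?_ ?_ ?_ ?_ ?_
  · simp
  · intro v _; simpa using ZMod.val_lt v
  · intro v hv; exact ZMod.val_cast_of_lt (Finset.mem_range.1 hv)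
  · intro v _; simp
  · intro v hv; rw [ZMod.val_cast_of_lt (Finset.mem_range.1 hv)]

/-- The Fourier transform of the `i`-th residue of a block. -/
noncomputable def blockFourier (i : Fin n) (φ : ℤ × (Fin n → ZMod N) → ℂ) :
    ℤ × (Fin n → ZMod N) → ℂ :=
  fun y => ((Real.sqrt N : ℝ) : ℂ)⁻¹ * ∑ v : ZMod N,
    ZMod.stdAddChar (v * y.2 i) * φ (y.1, Function.update y.2 i v)

/-- The Fourier transform of the residue of the integer of a block. -/
noncomputable def headFourier (φ : ℤ × (Fin n → ZMod N) → ℂ) : ℤ × (Fin n → ZMod N) → ℂ :=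
  fun y => ((Real.sqrt N : ℝ) : ℂ)⁻¹ * ∑ v : ZMod N,
    ZMod.stdAddChar (v * (y.1 : ZMod N)) * φ (N * (y.1 / N) + v.val, y.2)

/-- On good indices the register lies in `[0, N)`, so replacing its residue replaces its value, and
the gate becomes the transform of one tensor factor. -/
theorem fourierGate_loadStates_x (φ : Fin l → ℤ × (Fin n → ZMod N) → ℂ) (k : Fin l) (i : Fin n) :
    fourierGate (k * (n + 1) + 1 + i) N (loadStates φ) =
      loadStates (Function.update φ k (blockFourier i (φ k))) := by
  have hN : 0 < N := Nat.pos_of_ne_zero (NeZero.ne N)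
  funext b
  rw [fourierGate, if_neg (NeZero.ne N), sum_range_eq_sum_zmod]
  by_cases hg : GoodIndex n N l b
  · have hbq := hg.1 k i
    have hres : ∀ v : ZMod N, setResidue N (b (k * (n + 1) + 1 + i)) (v.val : ℕ) = (v.val : ℕ) := by
      intro v
      rw [setResidue, Int.ediv_eq_zero_of_lt hbq.1 hbq.2, mul_zero, zero_add]
      exact Int.emod_eq_of_lt (by positivity) (by exact_mod_cast ZMod.val_lt v)
    rw [loadStates_of_good hg, prod_update_apply φ k _ (blockAt n N b), blockFourier]
    refine Eq.trans ?_ (mul_assoc _ _ _).symm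
    rw [Finset.sum_mul]
    congr 1
    refine Finset.sum_congr rfl fun v _ => ?_
    have hv := ZMod.val_lt v
    rw [hres, loadStates_of_good (goodIndex_update_x.2 ⟨hg, by positivity, by exact_mod_cast hv⟩).1,
      exp_eq_stdAddChar, mul_assoc]
    congr 1
    · simp [blockAt]
    · simp_rw [blockAt_update_x]
      rw [prod_ite_apply φ k (blockAt n N b)]
      simp
  · rw [loadStates_of_not_good hg, Finset.sum_eq_zero, mul_zero]
    intro v _
    rw [loadStates_of_not_good, mul_zero]
    -- If any term of the Fourier sum sits at a good index, the quotient of the register by `N` is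
    -- `0`, and then the original index was good too.
    intro hg'
    apply hg
    have h1 := hg'.1 k i
    simp only [Finsupp.coe_update, Function.update_self] at h1
    have hv := ZMod.val_lt v
    have h2 : ((v.val : ℕ) : ℤ) % N = v.val :=
      Int.emod_eq_of_lt (by positivity) (by exact_mod_cast hv)
    rw [setResidue, h2] at h1
    have h3 : b (k * (n + 1) + 1 + i) / N = 0 := by
      have hul : (v.val : ℤ) < N := by exact_mod_cast hv
      have hun : (0 : ℤ) ≤ v.val := by positivity
      by_contra hne
      rcases lt_or_gt_of_ne hne with h4 | h4 <;> nlinarith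
    have h4 := Int.emod_add_mul_ediv (b (k * (n + 1) + 1 + i)) N
    have h5 := Int.emod_nonneg (b (k * (n + 1) + 1 + i)) (b := N) (by positivity)
    have h6 := Int.emod_lt_of_pos (b (k * (n + 1) + 1 + i)) (b := N) (by positivity)
    rw [h3] at h4
    exact (goodIndex_update_x.1 ⟨hg', by omega, by omega⟩).1

theorem fourierGate_loadStates_j (φ : Fin l → ℤ × (Fin n → ZMod N) → ℂ) (k : Fin l) :
    fourierGate (k * (n + 1)) N (loadStates φ) =
      loadStates (Function.update φ k (headFourier (φ k))) := by
  funext b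
  rw [fourierGate, if_neg (NeZero.ne N), sum_range_eq_sum_zmod]
  by_cases hg : GoodIndex n N l b
  · rw [loadStates_of_good hg, prod_update_apply φ k _ (blockAt n N b), headFourier]
    refine Eq.trans ?_ (mul_assoc _ _ _).symm
    rw [Finset.sum_mul]
    congr 1
    refine Finset.sum_congr rfl fun v _ => ?_
    have h2 : ((v.val : ℕ) : ℤ) % N = v.val :=
      Int.emod_eq_of_lt (by positivity) (by exact_mod_cast ZMod.val_lt v)
    rw [loadStates_of_good (goodIndex_update_j.2 hg), exp_eq_stdAddChar, mul_assoc]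
    congr 1
    · simp [blockAt]
    · simp_rw [blockAt_update_j]
      rw [prod_ite_apply φ k (blockAt n N b), setResidue, h2]
      rfl
  · rw [loadStates_of_not_good hg, Finset.sum_eq_zero, mul_zero]
    intro v _
    rw [loadStates_of_not_good (mt goodIndex_update_j.1 hg), mul_zero]

/-- The block state `∑_j f(j) |j⟩|x + j s⟩`. -/
def cosetBlock (f : ℤ → ℂ) (s x : Fin n → ZMod N) : ℤ × (Fin n → ZMod N) → ℂ :=
  fun y => if y.2 = x + y.1 • s then f y.1 else 0

/-- The block state after the first `t` residues have been Fourier transformed and measured,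
with outcomes `a`. -/
noncomputable def partBlock (t : ℕ) (a : Fin n → ZMod N) (f : ℤ → ℂ) (s x : Fin n → ZMod N) :
    ℤ × (Fin n → ZMod N) → ℂ :=
  fun y => if y.2 = (fun i : Fin n => if (i : ℕ) < t then a i else (x + y.1 • s) i) then
    ((Real.sqrt N : ℝ) : ℂ)⁻¹ ^ t *
      ZMod.stdAddChar (∑ i : Fin n, if (i : ℕ) < t then a i * (x + y.1 • s) i else 0) * f y.1
  else 0

theorem partBlock_zero (a : Fin n → ZMod N) (f : ℤ → ℂ) (s x : Fin n → ZMod N) :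
    partBlock 0 a f s x = cosetBlock f s x := by
  funext y
  simp [partBlock, cosetBlock, funext_iff]

/-- For fixed `j` the `i`-th residue has the definite value `(x + j s) i`, so its Fourier sum has a
single term. That term contributes one factor `1 / √N` and one more summand to the phase, and the
projection records the outcome in place of the residue. -/
theorem partBlock_step (i : Fin n) (a : Fin n → ZMod N) (v : ZMod N) (f : ℤ → ℂ)
    (s x : Fin n → ZMod N) :
    (fun y : ℤ × (Fin n → ZMod N) =>
      if y.2 i = v then blockFourier i (partBlock i a f s x) y else 0) =
      partBlock (i + 1) (Function.update a i v) f s x := by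
  funext ⟨j, y⟩
  have hsum : ∑ i' : Fin n, (if (i' : ℕ) < i + 1 then
      Function.update a i v i' * (x + j • s) i' else 0) =
      v * (x + j • s) i + ∑ i' : Fin n, if (i' : ℕ) < i then a i' * (x + j • s) i' else 0 := by
    rw [← Finset.add_sum_erase _ _ (Finset.mem_univ i),
      ← Finset.add_sum_erase _ (fun i' : Fin n => if (i' : ℕ) < i then _ else _)
        (Finset.mem_univ i)]
    simp only [Nat.lt_succ_self, if_true, Function.update_self, lt_irrefl, if_false, zero_add]
    congr 1
    refine Finset.sum_congr rfl fun i' hi' => ?_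
    have hne := Finset.ne_of_mem_erase hi'
    have := Fin.val_ne_of_ne hne
    rw [Function.update_of_ne hne]
    have : (i' : ℕ) < i + 1 ↔ (i' : ℕ) < i := by omega
    simp only [this]
  simp only [partBlock, blockFourier, hsum, AddChar.map_add_eq_mul]
  have hcond : ∀ u : ZMod N, Function.update y i u =
      (fun i' : Fin n => if (i' : ℕ) < i then a i' else (x + j • s) i') ↔
      u = (x + j • s) i ∧ ∀ i' : Fin n, i' ≠ i → y i' =
        if (i' : ℕ) < i then a i' else (x + j • s) i' := by
    intro u
    rw [Function.update_eq_iff]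
    simp
  have hcond2 : y = (fun i' : Fin n => if (i' : ℕ) < i + 1 then Function.update a i v i'
      else (x + j • s) i') ↔ y i = v ∧ ∀ i' : Fin n, i' ≠ i → y i' =
        if (i' : ℕ) < i then a i' else (x + j • s) i' := by
    rw [eq_comm, funext_iff]
    constructor
    · intro h
      refine ⟨by simpa using (h i).symm, fun i' hi' => ?_⟩
      have := h i'
      rw [Function.update_of_ne hi'] at this
      have h2 := Fin.val_ne_of_ne hi'
      have h3 : (i' : ℕ) < i + 1 ↔ (i' : ℕ) < i := by omega
      simp only [h3] at this
      exact this.symm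
    · rintro ⟨h1, h2⟩ i'
      by_cases hi' : i' = i
      · subst hi'; simp [h1]
      · rw [h2 i' hi', Function.update_of_ne hi']
        have h2 := Fin.val_ne_of_ne hi'
        have h3 : (i' : ℕ) < i + 1 ↔ (i' : ℕ) < i := by omega
        simp only [h3]
  simp only [hcond, hcond2]
  by_cases hv : y i = v
  · by_cases hr : ∀ i' : Fin n, i' ≠ i → y i' = if (i' : ℕ) < i then a i' else (x + j • s) i'
    · rw [if_pos hv, if_pos ⟨hv, hr⟩, Finset.sum_eq_single ((x + j • s) i)]
      · rw [if_pos ⟨rfl, hr⟩, hv, pow_succ, mul_comm v]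
        ring
      · intro u _ hu
        rw [if_neg fun h => hu h.1, mul_zero]
      · simp
    · rw [if_pos hv, if_neg fun h => hr h.2, Finset.sum_eq_zero, mul_zero]
      intro u _
      rw [if_neg fun h => hr h.2, mul_zero]
  · rw [if_neg hv, if_neg fun h => hv h.1]

/-- The block state after the residues have been measured with outcomes `a`, and the integer has
been shifted by `h`, Fourier transformed and measured with outcome `b`. -/
noncomputable def doneBlock (h : ℤ) (a : Fin n → ZMod N) (b : ZMod N) (f : ℤ → ℂ)
    (s x : Fin n → ZMod N) : ℤ × (Fin n → ZMod N) → ℂ :=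
  fun y => if (y.1 : ZMod N) = b then
    headFourier (fun y => partBlock n a f s x (y.1 - h, y.2)) y else 0

end loadStates

namespace QMachine

/-! ### The program -/

/-- Write a uniform residue modulo the content of cell `m` to cell `d`. -/
def sampleCmd (d m : ℕ) : Cmd :=
  .seq (.fourier 7 m) (.seq (.measure d 7 m) (.seq (.arith .sub 28 5 d) (.seq (.shift 7 28) .skip)))

/-- The acceptance threshold of the rejection sampler. -/
def thresholdExpr : RealExpr :=
  .mul (.reg 11) (.exp (.mul (.const (-2)) (.mul .pi
    (.mul (.div (.mul .param (.reg 25)) (.reg 2)) (.div (.mul .param (.reg 25)) (.reg 2))))))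

/-- One round of the rejection sampler. -/
def noiseRound : Cmd :=
  .seq (sampleCmd 25 10) (.seq (.arith .sub 25 25 9) (.seq (sampleCmd 26 11)
    (.seq (.floor 27 thresholdExpr) (.ifLt 26 27 (.seq (.arith .add 24 25 5) .skip) .skip))))

/-- A rejection sampler for the discrete Gaussian distribution. -/
def noiseCmd : Cmd := .seq (.const 24 0) (.loop 17 12 noiseRound)

/-- Sample a secret. -/
def secretCmd : Cmd :=
  .loop 15 1 (.seq (sampleCmd 20 2) (.seq (.arith .add 22 13 15) (.seq (.store 22 20) .skip)))

/-- Fourier transform and measure a residue of a block. -/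
def residueRound : Cmd :=
  .seq (.arith .add 20 18 4) (.seq (.fourier 20 2) (.seq (.measure 21 20 2)
    (.seq (.arith .add 22 14 18) (.seq (.store 22 21) (.seq (.arith .add 22 13 15)
      (.seq (.load 23 22) (.seq (.arith .mul 23 23 21) (.seq (.arith .add 19 19 23)
        (.seq (.arith .add 18 18 4) .skip)))))))))

/-- Process the integer of a block. -/
def headCmd : Cmd :=
  .seq (.arith .sub 20 18 1) (.seq (.shift 20 8) (.seq (.fourier 20 2) (.seq (.measure 21 20 2)
    (.seq (.arith .sub 19 19 21) (.seq (.arith .add 19 19 24) (.seq (.arith .add 22 14 18)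
      (.seq (.store 22 19) (.seq (.arith .add 18 18 4) .skip))))))))

/-- Turn a block into a sample. -/
def blockCmd : Cmd :=
  .seq (.const 19 0) (.seq (.loop 15 1 residueRound) (.seq noiseCmd headCmd))

/-- Compute the constants and call `c`. -/
def initCmd (c : Cmd) : Cmd :=
  .seq (.const 4 1) (.seq (.const 5 0) (.seq (.arith .add 6 1 4) (.seq (.arith .mul 7 3 6)
    (.seq (.const 8 2) (.seq (.arith .div 8 2 8)
      (.seq (.floor 9 (.div (.mul (.reg 0) (.reg 2)) .param))
        (.seq (.arith .add 10 9 9) (.seq (.arith .add 10 10 4) (.seq (.floor 11 (.exp (.reg 0)))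
          (.seq (.arith .mul 12 0 0) (.seq (.const 13 40) (.seq (.arith .add 14 13 1) c))))))))))))

/-- The reduction from the decisional EDCP to the decisional LWE. -/
def reduction : Cmd :=
  initCmd (.seq secretCmd (.seq (.loop 16 3 blockCmd) (.query 0 14)))

/-- The range of the rejection sampler. -/
noncomputable def noiseRange (p : EDCPParams) (κ : ℕ) : ℕ := ⌊κ * p.N / p.r⌋₊

/-- The precision of the rejection sampler. -/
noncomputable def noisePrec (κ : ℕ) : ℕ := ⌊Real.exp κ⌋₊

theorem noisePrec_pos (κ : ℕ) : 0 < noisePrec κ :=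
  Nat.floor_pos.2 (Real.one_le_exp (by positivity))

/-- The random choices of a round of the rejection sampler. -/
abbrev NoiseChoice (p : EDCPParams) (κ : ℕ) : Type :=
  Fin (2 * noiseRange p κ + 1) × Fin (noisePrec κ)

/-- The acceptance threshold for the proposal `t`. -/
noncomputable def threshold (p : EDCPParams) (κ : ℕ) (t : ℤ) : ℤ :=
  ⌊(noisePrec κ : ℝ) * Real.exp (-2 * (Real.pi * (p.r * t / p.N * (p.r * t / p.N))))⌋

/-- The result of the rejection sampler: the last accepted proposal, or `0`. -/
noncomputable def noiseVal (p : EDCPParams) (κ : ℕ) : (K : ℕ) → (Fin K → NoiseChoice p κ) → ℤ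
  | 0, _ => 0
  | K + 1, w =>
    if ((w (Fin.last K)).2 : ℤ) < threshold p κ ((w (Fin.last K)).1 - noiseRange p κ) then
      (w (Fin.last K)).1 - noiseRange p κ
    else noiseVal p κ K (Fin.init w)

theorem abs_noiseVal_le (p : EDCPParams) (κ : ℕ) : ∀ (K : ℕ) (w : Fin K → NoiseChoice p κ),
    |noiseVal p κ K w| ≤ noiseRange p κ
  | 0, _ => by simp [noiseVal]
  | K + 1, w => by
    rw [noiseVal]
    split_ifs
    · have := (w (Fin.last K)).1.2
      rw [abs_le]
      constructor <;> omega
    · exact abs_noiseVal_le p κ K _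

/-- The bound `X` is large enough for the numbers that occur in the program. -/
structure Fits (p : EDCPParams) (κ X : ℕ) : Prop where
  kappa : 8 * (κ * κ) + κ + 8 ≤ X
  index : (p.l + 1) * (p.n + 1) + 100 ≤ X
  value : p.n * (p.N * p.N) + 2 * p.N + 2 * noiseRange p κ + κ * p.N + 1 ≤ X
  prec : Real.exp κ ≤ X
  quot : κ * p.N / p.r ≤ X
  param : p.r ≤ X

/-- The constants of the program. -/
structure Consts (p : EDCPParams) (κ : ℕ) (mem : ℕ → ℤ) : Prop where
  c1 : mem 1 = p.n
  c2 : mem 2 = p.N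
  c3 : mem 3 = p.l
  c4 : mem 4 = 1
  c5 : mem 5 = 0
  c7 : mem 7 = (p.l * (p.n + 1) : ℕ)
  c8 : mem 8 = (p.N / 2 : ℕ)
  c9 : mem 9 = noiseRange p κ
  c10 : mem 10 = (2 * noiseRange p κ + 1 : ℕ)
  c11 : mem 11 = noisePrec κ
  c12 : mem 12 = (κ * κ : ℕ)
  c13 : mem 13 = 40
  c14 : mem 14 = (40 + p.n : ℕ)

theorem Consts.congr {p : EDCPParams} {κ : ℕ} {mem mem' : ℕ → ℤ} (h : Consts p κ mem)
    (e : ∀ j, 1 ≤ j → j ≤ 14 → mem' j = mem j) : Consts p κ mem' := by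
  constructor <;> rw [e _ (by norm_num) (by norm_num)]
  exacts [h.c1, h.c2, h.c3, h.c4, h.c5, h.c7, h.c8, h.c9, h.c10, h.c11, h.c12, h.c13, h.c14]

/-! ### Execution of the uniform sampler and of the rejection sampler. -/

variable {E : Env} {X : ℕ} {s : Config}

/-- Since the fresh register is returned to `0`, the state is only multiplied by `1 / √M` in each of
the `M` branches: a uniform classical choice that leaves the quantum data intact. Cell 28 holds the
negated outcome needed for the reset. -/
theorem branches_sampleCmd {L M : ℕ} (hb : Bdd X s) {d m : ℕ} (hd5 : d ≠ 5) (hd7 : d ≠ 7)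
    (h5 : s.mem 5 = 0) (h7 : s.mem 7 = L) (hm : s.mem m = M) (hM : 0 < M)
    (hsupp : ∀ b, b L ≠ 0 → s.amp b = 0) :
    Branches E (stepCost X) (sampleCmd d m) s (Fin M) 4 fun v s' =>
      s'.mem = Function.update (Function.update s.mem d (v : ℕ)) 28 (0 - (v : ℕ)) ∧
      s'.amp = ((Real.sqrt M : ℝ) : ℂ)⁻¹ • s.amp ∧ Bdd X s' := by
  refine Branches.reindex (ι := Fin M × Unit) (P := fun v s' =>
      s'.mem = Function.update (Function.update s.mem d (v.1 : ℕ)) 28 (0 - (v.1 : ℕ)) ∧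
      s'.amp = ((Real.sqrt M : ℝ) : ℂ)⁻¹ • s.amp ∧ Bdd X s') ?_ (Equiv.prodPUnit _).symm
      fun i s' h => h
  refine Branches.fourier hb _ _ fun s1 hm1 ha1 hb1 => ?_
  refine Branches.measure hb1 _ _ _ (by rw [hm1, hm]) hM fun v s2 hm2 ha2 hb2 => ?_
  have e5 : s2.mem 5 = 0 := by rw [hm2, Function.update_of_ne (Ne.symm hd5), hm1, h5]
  have ed : s2.mem d = (v : ℕ) := by rw [hm2, Function.update_self]
  refine Branches.arith hb2 _ _ _ _ ?_ fun s3 hm3 ha3 hb3 => ?_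
  · have := hb2 d
    rw [ed] at this ⊢
    simpa [ArithOp.apply, e5] using this
  refine Branches.shift hb3 _ _ fun s4 hm4 ha4 hb4 => Branches.skip ⟨?_, ?_, hb4⟩
  · rw [hm4, hm3, hm2, hm1]
    simp [ArithOp.apply, h5, Ne.symm hd5]
  · have hq : s3.mem 7 = L := by
      rw [hm3, Function.update_of_ne (by norm_num), hm2, Function.update_of_ne (Ne.symm hd7), hm1, h7]
    have hz : s3.mem 28 = 0 - (v : ℕ) := by
      rw [hm3, Function.update_self, ed, e5]; rfl
    rw [ha4, hq, hz, ha3, ha2, ha1, hm1, h7, hm, Int.toNat_natCast, Int.toNat_natCast]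
    exact reset_fresh hM (by positivity) (by exact_mod_cast v.2) hsupp

theorem threshold_nonneg (p : EDCPParams) (κ : ℕ) (t : ℤ) : 0 ≤ threshold p κ t :=
  Int.floor_nonneg.2 (by positivity)

theorem threshold_le (p : EDCPParams) (κ : ℕ) (t : ℤ) : threshold p κ t ≤ noisePrec κ := by
  refine Int.floor_le_iff.2 ?_
  have h : Real.exp (-2 * (Real.pi * (p.r * t / p.N * (p.r * t / p.N)))) ≤ 1 := by
    apply Real.exp_le_one_iff.2
    have := mul_nonneg Real.pi_pos.le (mul_self_nonneg (p.r * t / p.N))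
    linarith
  have := mul_le_mul_of_nonneg_left h (Nat.cast_nonneg (α := ℝ) (noisePrec κ))
  push_cast
  linarith

theorem noisePrec_le {p : EDCPParams} {κ X : ℕ} (hf : Fits p κ X) : noisePrec κ ≤ X := by
  have h1 : (noisePrec κ : ℝ) ≤ Real.exp κ := Nat.floor_le (Real.exp_nonneg _)
  exact_mod_cast h1.trans hf.prec

theorem mul_noiseRange_le (p : EDCPParams) (κ : ℕ) : p.r * noiseRange p κ ≤ κ * p.N := by
  have h1 : (noiseRange p κ : ℝ) ≤ κ * p.N / p.r :=
    Nat.floor_le (div_nonneg (by positivity) p.r_pos.le)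
  rw [le_div_iff₀ p.r_pos] at h1
  linarith

/-- Proposals in range satisfy `|r t / N| ≤ κ`, and this quotient is formed before squaring. Hence
the exponent is at most `2 · 4 · κ²` in absolute value, which is where the term `8 κ²` of `Fits`
comes from, and no intermediate value exceeds `X`. -/
theorem cost_thresholdExpr {p : EDCPParams} {κ X : ℕ} (hf : Fits p κ X) {mem : ℕ → ℤ}
    (h2 : mem 2 = p.N) (h11 : mem 11 = noisePrec κ) {t : ℤ} (h25 : mem 25 = t)
    (ht : |t| ≤ noiseRange p κ) : thresholdExpr.cost p.r mem ≤ 99 * (X.size + 1) := by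
  have hN : (0 : ℝ) < p.N := by exact_mod_cast Nat.lt_of_lt_of_le (by norm_num) p.two_le_N
  have hr := p.r_pos
  have hk : (8 * (κ * κ) + κ + 8 : ℝ) ≤ X := by exact_mod_cast hf.kappa
  have hval : (p.n * (p.N * p.N) + 2 * p.N + 2 * noiseRange p κ + κ * p.N + 1 : ℝ) ≤ X := by
    exact_mod_cast hf.value
  have ht' : |(t : ℝ)| ≤ noiseRange p κ := by exact_mod_cast ht
  have hrt : |p.r * (t : ℝ)| ≤ κ * p.N := by
    rw [abs_mul, abs_of_pos hr]
    exact (mul_le_mul_of_nonneg_left ht' hr.le).trans (mul_noiseRange_le p κ)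
  have he : |p.r * t / p.N| ≤ κ := by
    rw [abs_div, abs_of_pos hN, div_le_iff₀ hN]
    exact hrt
  set e := p.r * t / p.N with he_def
  have hee : e * e ≤ κ * κ := by
    rw [← abs_mul_abs_self]
    exact mul_le_mul he he (abs_nonneg _) (by positivity)
  have hee0 : 0 ≤ e * e := mul_self_nonneg e
  have hpi := Real.pi_lt_four
  have hpi0 := Real.pi_pos
  have hpe : Real.pi * (e * e) ≤ 4 * (κ * κ) :=
    mul_le_mul hpi.le hee hee0 (by norm_num)
  have hpe0 : 0 ≤ Real.pi * (e * e) := by positivity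
  have hkk : (0 : ℝ) ≤ κ * κ := by positivity
  have hκ0 : (0 : ℝ) ≤ κ := by positivity
  have hnN : (0 : ℝ) ≤ p.n * (p.N * p.N) := by positivity
  have hkN : (0 : ℝ) ≤ κ * p.N := by positivity
  have hR : (0 : ℝ) ≤ noiseRange p κ := by positivity
  have hexp : Real.exp (-2 * (Real.pi * (e * e))) ≤ 1 := Real.exp_le_one_iff.2 (by linarith)
  have hU : (noisePrec κ : ℝ) ≤ X := by exact_mod_cast noisePrec_le hf
  have b1 : bits (noisePrec κ) ≤ X.size + 1 := bits_le (by simpa using noisePrec_le hf)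
  have b2 : bits (-2) ≤ X.size + 1 := bits_le (by
    have := hf.kappa
    norm_num
    omega)
  have b3 : realBits Real.pi ≤ X.size + 1 := realBits_le (by rw [abs_of_pos hpi0]; linarith)
  have b4 : realBits p.r ≤ X.size + 1 := realBits_le (by rw [abs_of_pos hr]; exact hf.param)
  have b5 : bits t ≤ X.size + 1 := bits_le (by have := hf.value; omega)
  have b6 : bits p.N ≤ X.size + 1 := bits_le (by
    have := hf.value
    rw [abs_of_nonneg (by positivity)]
    have : p.N ≤ X := by omega
    exact_mod_cast this)
  have b7 : realBits (p.r * t) ≤ X.size + 1 := realBits_le (by linarith)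
  have b8 : realBits e ≤ X.size + 1 := realBits_le (by linarith)
  have b9 : realBits (e * e) ≤ X.size + 1 := realBits_le (by
    rw [abs_of_nonneg hee0]; linarith)
  have b10 : realBits (Real.pi * (e * e)) ≤ X.size + 1 := realBits_le (by
    rw [abs_of_nonneg hpe0]; linarith)
  have b11 : realBits (-2 * (Real.pi * (e * e))) ≤ X.size + 1 := realBits_le (by
    rw [abs_mul, abs_of_nonneg hpe0, abs_neg, abs_two]; linarith)
  have b12 : realBits (Real.exp (-2 * (Real.pi * (e * e)))) ≤ X.size + 1 := realBits_le (by
    rw [abs_of_nonneg (Real.exp_nonneg _)]; linarith)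
  have b13 : realBits (noisePrec κ * Real.exp (-2 * (Real.pi * (e * e)))) ≤ X.size + 1 :=
    realBits_le (by
      rw [abs_of_nonneg (by positivity)]
      have := mul_le_mul_of_nonneg_left hexp (Nat.cast_nonneg (α := ℝ) (noisePrec κ))
      linarith)
  simp only [thresholdExpr, RealExpr.cost, RealExpr.eval, h2, h11, h25]
  push_cast
  rw [← he_def]
  omega

/-- The cells that are used by the rejection sampler. -/
def noiseScratch (j : ℕ) : Prop := j = 17 ∨ (24 ≤ j ∧ j ≤ 28)

/-- The amplitude of the choices of a run of the rejection sampler. -/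
noncomputable def noiseAmp (p : EDCPParams) (κ : ℕ) : ℂ :=
  ((Real.sqrt (2 * noiseRange p κ + 1 : ℕ) : ℝ) : ℂ)⁻¹ * ((Real.sqrt (noisePrec κ) : ℝ) : ℂ)⁻¹

theorem branches_noiseRound {p : EDCPParams} {κ : ℕ} (hf : Fits p κ X) (hE : E.param = p.r)
    (hb : Bdd X s) (hc : Consts p κ s.mem)
    (hsupp : ∀ b, b (p.l * (p.n + 1)) ≠ 0 → s.amp b = 0) :
    Branches E (stepCost X) noiseRound s (NoiseChoice p κ) 12 fun w s' =>
      (∀ j, ¬ noiseScratch j → s'.mem j = s.mem j) ∧ Bdd X s' ∧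
      s'.amp = noiseAmp p κ • s.amp ∧
      s'.mem 24 = if (w.2 : ℤ) < threshold p κ (w.1 - noiseRange p κ) then
        w.1 - (noiseRange p κ : ℤ) else s.mem 24 := by
  have hX := hf.value
  refine Branches.reindex (ι := Fin (2 * noiseRange p κ + 1) × (Fin (noisePrec κ) × Unit))
    (P := fun w s' => (∀ j, ¬ noiseScratch j → s'.mem j = s.mem j) ∧ Bdd X s' ∧
      s'.amp = noiseAmp p κ • s.amp ∧
      s'.mem 24 = if (w.2.1 : ℤ) < threshold p κ (w.1 - noiseRange p κ) then
        w.1 - (noiseRange p κ : ℤ) else s.mem 24) ?_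
    ((Equiv.prodCongr (Equiv.refl _) (Equiv.prodPUnit _).symm)) fun i s' h => h
  refine (Branches.seq (m := 4) (m' := 8) (branches_sampleCmd hb (by norm_num) (by norm_num) hc.c5 hc.c7
    hc.c10 (by omega) hsupp) ?_)
  rintro v s1 ⟨hm1, ha1, hb1⟩
  have hv := v.2
  have e25 : s1.mem 25 = (v : ℕ) := by simp [hm1]
  have e9 : s1.mem 9 = noiseRange p κ := by simp [hm1, hc.c9]
  refine Branches.arith hb1 _ _ _ _ ?_ fun s2 hm2 ha2 hb2 => ?_
  · rw [e25, e9, abs_le]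
    simp only [ArithOp.apply]
    constructor <;> omega
  refine (Branches.seq (m := 4) (m' := 3) (branches_sampleCmd (L := p.l * (p.n + 1)) (M := noisePrec κ) hb2
    (by norm_num) (by norm_num) ?_ ?_ ?_ (noisePrec_pos κ) ?_) ?_)
  · simp [hm2, hm1, hc.c5]
  · simp [hm2, hm1, hc.c7]
  · simp [hm2, hm1, hc.c11]
  · intro b hb
    rw [ha2, ha1]
    simp [hsupp b hb]
  rintro u s3 ⟨hm3, ha3, hb3⟩
  have f25 : s3.mem 25 = (v : ℕ) - (noiseRange p κ : ℤ) := by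
    simp [hm3, hm2, e25, e9, ArithOp.apply]
  have f2 : s3.mem 2 = p.N := by simp [hm3, hm2, hm1, hc.c2]
  have f11 : s3.mem 11 = noisePrec κ := by simp [hm3, hm2, hm1, hc.c11]
  have fth : ⌊thresholdExpr.eval E.param s3.mem⌋ = threshold p κ ((v : ℕ) - (noiseRange p κ : ℤ)) := by
    simp only [thresholdExpr, RealExpr.eval, f25, f2, f11, hE, threshold]
    push_cast
    rfl
  refine Branches.floor hb3 _ _ ?_ ?_ fun s4 hm4 ha4 hb4 => ?_
  · rw [fth, abs_of_nonneg (threshold_nonneg _ _ _)]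
    have := threshold_le p κ ((v : ℕ) - (noiseRange p κ : ℤ))
    have := noisePrec_le hf
    omega
  · rw [hE]
    exact cost_thresholdExpr hf f2 f11 f25 (by rw [abs_le]; constructor <;> omega)
  rw [fth] at hm4
  have hamp : s4.amp = noiseAmp p κ • s.amp := by
    rw [ha4, ha3, ha2, ha1, smul_smul, noiseAmp, mul_comm]
  have e26 : s4.mem 26 = (u : ℕ) := by simp [hm4, hm3]
  have e27 : s4.mem 27 = threshold p κ ((v : ℕ) - (noiseRange p κ : ℤ)) := by simp [hm4]
  have g25 : s4.mem 25 = (v : ℕ) - (noiseRange p κ : ℤ) := by simp [hm4, f25]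
  have g5 : s4.mem 5 = 0 := by simp [hm4, hm3, hm2, hm1, hc.c5]
  have g24 : s4.mem 24 = s.mem 24 := by simp [hm4, hm3, hm2, hm1]
  have gfr : ∀ j, ¬ noiseScratch j → s4.mem j = s.mem j := by
    intro j hj
    unfold noiseScratch at hj
    have h1 : j ≠ 27 := by omega
    have h2 : j ≠ 28 := by omega
    have h3 : j ≠ 26 := by omega
    have h4 : j ≠ 25 := by omega
    simp [hm4, hm3, hm2, hm1, h1, h2, h3, h4]
  refine Branches.ifLt (m := 1) hb4 _ _ ?_ ?_
  · intro hlt s5 hm5 ha5 hb5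
    refine Branches.arith hb5 _ _ _ _ ?_ fun s6 hm6 ha6 hb6 => Branches.skip ⟨?_, hb6, ?_, ?_⟩
    · rw [hm5, g25, g5, abs_le]
      simp only [ArithOp.apply]
      constructor <;> omega
    · intro j hj
      have h1 : j ≠ 24 := by unfold noiseScratch at hj; omega
      rw [hm6, Function.update_of_ne h1, hm5, gfr j hj]
    · rw [ha6, ha5, hamp]
    · rw [e26, e27] at hlt
      rw [if_pos hlt, hm6, Function.update_self, hm5, g25, g5]
      simp [ArithOp.apply]
  · intro hlt s5 hm5 ha5 hb5
    -- The rejecting branch is shorter; its bound is padded because both alternatives must share one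
    -- count.
    refine (Branches.skip ?_).mono (by norm_num) fun _ _ h => h
    rw [e26, e27] at hlt
    refine ⟨fun j hj => ?_, hb5, ?_, ?_⟩
    · rw [hm5, gfr j hj]
    · rw [ha5, hamp]
    · rw [if_neg hlt, hm5, g24]

/-- Rounds keep running after an acceptance, and a later acceptance overwrites the value. Thus the
length of the loop is fixed in advance, all branches have the same amplitude, and the outcome is
uniform over the words of choices. -/
theorem branches_noiseCmd {p : EDCPParams} {κ : ℕ} (hf : Fits p κ X) (hE : E.param = p.r)
    (hb : Bdd X s) (hc : Consts p κ s.mem)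
    (hsupp : ∀ b, b (p.l * (p.n + 1)) ≠ 0 → s.amp b = 0) :
    Branches E (stepCost X) noiseCmd s (Fin (κ * κ) → NoiseChoice p κ) (1 + κ * κ * 13 + 1)
      fun w s' =>
      (∀ j, ¬ noiseScratch j → s'.mem j = s.mem j) ∧ Bdd X s' ∧
      s'.amp = noiseAmp p κ ^ (κ * κ) • s.amp ∧ s'.mem 24 = noiseVal p κ (κ * κ) w := by
  refine Branches.const hb 24 0 (by simp) fun s1 hm1 ha1 hb1 => ?_
  refine Branches.loop (m := 12) hb1 17 12 (T := κ * κ) (by simp [hm1, hc.c12]) (fun t w s' =>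
    (∀ j, ¬ noiseScratch j → s'.mem j = s.mem j) ∧ Bdd X s' ∧
      s'.amp = noiseAmp p κ ^ t • s.amp ∧ s'.mem 24 = noiseVal p κ t w) ?_ ?_ ?_
  · intro s' hm ha
    refine ⟨fun j hj => ?_, hb1.of_mem_eq hm, by simp [ha, ha1], by simp [hm, hm1, noiseVal]⟩
    have h1 : j ≠ 24 := by unfold noiseScratch at hj; omega
    simp [hm, hm1, h1]
  · intro t w s' _ h
    exact h.2.1
  · rintro t w s' s'' ht ⟨h1, h2, h3, h4⟩ hm ha hb''
    have hfr : ∀ j, ¬ noiseScratch j → s''.mem j = s.mem j := by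
      intro j hj
      have : j ≠ 17 := by unfold noiseScratch at hj; omega
      rw [hm, Function.update_of_ne this, h1 j hj]
    refine (branches_noiseRound hf hE hb'' (hc.congr fun j _ hj => hfr j (by
      unfold noiseScratch; omega)) ?_).mono le_rfl ?_
    · intro b hb
      rw [ha, h3]
      simp [hsupp b hb]
    · rintro x s3 ⟨g1, g2, g3, g4⟩
      refine ⟨fun j hj => (g1 j hj).trans (hfr j hj), g2, ?_, ?_⟩
      · rw [g3, ha, h3, smul_smul, pow_succ']
      · rw [g4, noiseVal, Fin.snoc_last, Fin.init_snoc, hm, Function.update_of_ne (by norm_num), h4]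

end QMachine

/-! ### Execution of the program on the secret and on a single block. -/

namespace QMachine

variable {E : Env} {X : ℕ} {s : Config}

/-- The secret occupies the cells from 40 on. The invariant excludes exactly the low cells that a
round writes: the counter 15 and the scratch cells 20, 22 and 28. -/
theorem branches_secretCmd {p : EDCPParams} {κ : ℕ} (hf : Fits p κ X)
    (hb : Bdd X s) (hc : Consts p κ s.mem)
    (hsupp : ∀ b, b (p.l * (p.n + 1)) ≠ 0 → s.amp b = 0) :
    Branches E (stepCost X) secretCmd s (Fin p.n → Fin p.N) (1 + p.n * 7) fun w s' =>
      Consts p κ s'.mem ∧ Bdd X s' ∧ s'.mem 18 = s.mem 18 ∧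
      s'.amp = ((Real.sqrt p.N : ℝ) : ℂ)⁻¹ ^ p.n • s.amp ∧
      ∀ i : Fin p.n, s'.mem (40 + i) = (w i : ℕ) := by
  have hX := hf.index
  have hnX : (p.n + 40 : ℕ) ≤ X := by nlinarith
  refine (Branches.loop (ι := Fin p.N) (T := p.n) (m := 6) hb 15 1 hc.c1 (fun t w s' =>
    (∀ j, j < 40 → j ≠ 15 → j ≠ 20 → j ≠ 22 → j ≠ 28 → s'.mem j = s.mem j) ∧ Bdd X s' ∧
      s'.amp = ((Real.sqrt p.N : ℝ) : ℂ)⁻¹ ^ t • s.amp ∧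
      ∀ i : Fin t, s'.mem (40 + i) = (w i : ℕ)) ?_ ?_ ?_).mono le_rfl ?_
  · intro s' hm ha
    exact ⟨fun j _ _ _ _ _ => by rw [hm], hb.of_mem_eq hm, by simp [ha], fun i => i.elim0⟩
  · intro t w s' _ h
    exact h.2.1
  · rintro t w s' s'' ht ⟨h1, h2, h3, h4⟩ hm ha hb''
    have hfr : ∀ j, j < 40 → j ≠ 15 → j ≠ 20 → j ≠ 22 → j ≠ 28 → s''.mem j = s.mem j := by
      intro j q1 q2 q3 q4 q5
      rw [hm, Function.update_of_ne q2, h1 j q1 q2 q3 q4 q5]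
    have hc'' : Consts p κ s''.mem := hc.congr fun j _ hj =>
      hfr j (by omega) (by omega) (by omega) (by omega) (by omega)
    refine Branches.reindex (ι := Fin p.N × Unit) (P := fun x s' =>
      (∀ j, j < 40 → j ≠ 15 → j ≠ 20 → j ≠ 22 → j ≠ 28 → s'.mem j = s.mem j) ∧ Bdd X s' ∧
      s'.amp = ((Real.sqrt p.N : ℝ) : ℂ)⁻¹ ^ (t + 1) • s.amp ∧
      ∀ i : Fin (t + 1), s'.mem (40 + i) =
        (Fin.snoc (α := fun _ => Fin p.N) w x.1 i : ℕ)) ?_ (Equiv.prodPUnit _).symm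
      fun i s' h => h
    refine Branches.seq (m := 4) (m' := 2) (branches_sampleCmd hb'' (by norm_num) (by norm_num)
      hc''.c5 hc''.c7 hc''.c2 (by have := p.two_le_N; omega) ?_) ?_
    · intro b hb
      rw [ha, h3]
      simp [hsupp b hb]
    rintro v s3 ⟨hm3, ha3, hb3⟩
    have e13 : s3.mem 13 = 40 := by simp [hm3, hc''.c13]
    have e15 : s3.mem 15 = t := by simp [hm3, hm]
    refine Branches.arith hb3 _ _ _ _ ?_ fun s4 hm4 ha4 hb4 => ?_
    · rw [e13, e15]
      simp only [ArithOp.apply]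
      rw [abs_of_nonneg (by positivity)]
      omega
    have e22 : s4.mem 22 = (40 + t : ℕ) := by
      rw [hm4, Function.update_self, e13, e15]
      simp [ArithOp.apply]
    have e20 : s4.mem 20 = (v : ℕ) := by simp [hm4, hm3]
    refine Branches.store hb4 _ _ fun s5 hm5 ha5 hb5 => Branches.skip ?_
    rw [e22, e20, Int.toNat_natCast] at hm5
    refine ⟨fun j q1 q2 q3 q4 q5 => ?_, hb5, ?_, fun i => ?_⟩
    · have q6 : j ≠ 40 + t := by omega
      rw [← hfr j q1 q2 q3 q4 q5]
      simp [hm5, hm4, hm3, q6, q3, q4, q5]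
    · rw [ha5, ha4, ha3, ha, h3, smul_smul, pow_succ']
    · rcases Fin.eq_castSucc_or_eq_last i with ⟨i, rfl⟩ | rfl
      · have hi := i.2
        have := h4 i
        simp only [Fin.snoc_castSucc, Fin.val_castSucc]
        rw [← this]
        have q1 : 40 + (i : ℕ) ≠ 40 + t := by omega
        have q2 : 40 + (i : ℕ) ≠ 22 := by omega
        have q3 : 40 + (i : ℕ) ≠ 28 := by omega
        have q4 : 40 + (i : ℕ) ≠ 20 := by omega
        have q5 : 40 + (i : ℕ) ≠ 15 := by omega
        rw [hm5, Function.update_of_ne q1, hm4, Function.update_of_ne q2, hm3,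
          Function.update_of_ne q3, Function.update_of_ne q4, hm, Function.update_of_ne q5]
      · simp [hm5]
  · rintro w s' ⟨h1, h2, h3, h4⟩
    exact ⟨hc.congr fun j _ hj => h1 j (by omega) (by omega) (by omega) (by omega) (by omega),
      h2, h1 18 (by omega) (by omega) (by omega) (by omega) (by omega), h3, h4⟩

/-- The scratch cells of the loop over the residues of a block. -/
def residueScratch (j : ℕ) : Prop := j = 15 ∨ (18 ≤ j ∧ j ≤ 23)

/-- Stated for prefixes, so that it bounds the accumulated inner product at every stage of the loop
over the residues. -/
theorem abs_sum_le {t n N : ℕ} (ht : t ≤ n) (w : Fin t → Fin N) (S : Fin n → Fin N) (S' : ℕ → ℤ)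
    (hS : ∀ i : Fin n, S' i = (S i : ℕ)) :
    |∑ i : Fin t, ((w i : ℕ) : ℤ) * S' i| ≤ n * (N * N) := by
  calc |∑ i : Fin t, ((w i : ℕ) : ℤ) * S' i| ≤ ∑ i : Fin t, |((w i : ℕ) : ℤ) * S' i| :=
        Finset.abs_sum_le_sum_abs _ _
    _ ≤ ∑ _i : Fin t, ((N : ℤ) * N) := by
        refine Finset.sum_le_sum fun i _ => ?_
        have h1 := hS ⟨i, i.2.trans_le ht⟩
        simp only at h1
        have h2 := (w i).2
        have h3 := (S ⟨i, i.2.trans_le ht⟩).2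
        rw [h1, abs_of_nonneg (by positivity)]
        exact_mod_cast Nat.mul_le_mul h2.le h3.le
    _ ≤ n * (N * N) := by
        simp only [Finset.sum_const, Finset.card_univ, Fintype.card_fin, nsmul_eq_mul]
        have : (t : ℤ) ≤ n := by exact_mod_cast ht
        exact mul_le_mul_of_nonneg_right this (by positivity)

/-- Cell 18 counts the sample entries written so far. A block begins with its integer while a sample
ends with its scalar entry; hence the residue belonging to entry `i` lies in the register one above
the counter, and for the integer the program later subtracts `n` from the counter instead. The
bounds `hA` and `hA'` control the new accumulator and the product added to it. -/
theorem branches_residueRound {p : EDCPParams} {κ : ℕ} (hf : Fits p κ X)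
    (hb : Bdd X s) (hc : Consts p κ s.mem) {k : Fin p.l} {i : Fin p.n} {A : ℤ}
    (h18 : s.mem 18 = (k * (p.n + 1) + i : ℕ)) (h15 : s.mem 15 = (i : ℕ)) (h19 : s.mem 19 = A)
    (hA : ∀ v : Fin p.N, |A + s.mem (40 + i) * (v : ℕ)| ≤ X)
    (hA' : ∀ v : Fin p.N, |s.mem (40 + i) * (v : ℕ)| ≤ X) {z : ℂ}
    {φ : Fin p.l → ℤ × (Fin p.n → ZMod p.N) → ℂ} (hamp : s.amp = z • loadStates φ) :
    Branches E (stepCost X) residueRound s (Fin p.N) 10 fun v s' =>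
      (∀ j, ¬ residueScratch j → j ≠ 40 + p.n + (k * (p.n + 1) + i) → s'.mem j = s.mem j) ∧
      Bdd X s' ∧
      s'.mem 18 = (k * (p.n + 1) + i + 1 : ℕ) ∧ s'.mem 19 = A + s.mem (40 + i) * (v : ℕ) ∧
      s'.mem (40 + p.n + (k * (p.n + 1) + i)) = (v : ℕ) ∧
      s'.amp = z • loadStates (Function.update φ k fun y =>
        if y.2 i = (v : ℕ) then blockFourier i (φ k) y else 0) := by
  have hX := hf.index
  have hi := i.2
  have hlt := blockPos_lt (n := p.n) k (i := i + 1) (by omega)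
  set B := (k : ℕ) * (p.n + 1) with hB
  have hXB : B + i + 1 + p.n + 40 ≤ X := by nlinarith
  refine Branches.reindex (ι := Fin p.N × Unit) (P := fun v s' =>
      (∀ j, ¬ residueScratch j → j ≠ 40 + p.n + (B + i) → s'.mem j = s.mem j) ∧ Bdd X s' ∧
      s'.mem 18 = (B + i + 1 : ℕ) ∧ s'.mem 19 = A + s.mem (40 + i) * (v.1 : ℕ) ∧
      s'.mem (40 + p.n + (B + i)) = (v.1 : ℕ) ∧
      s'.amp = z • loadStates (Function.update φ k fun y =>
        if y.2 i = (v.1 : ℕ) then blockFourier i (φ k) y else 0))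
    ?_ (Equiv.prodPUnit _).symm fun i s' h => h
  refine Branches.arith hb _ _ _ _ ?_ fun s1 hm1 ha1 hb1 => ?_
  · rw [h18, hc.c4]
    simp only [ArithOp.apply]
    rw [abs_of_nonneg (by positivity)]
    omega
  have e20 : s1.mem 20 = (B + 1 + i : ℕ) := by
    rw [hm1, Function.update_self, h18, hc.c4]
    simp only [ArithOp.apply]
    push_cast
    ring
  have e2 : s1.mem 2 = p.N := by simp [hm1, hc.c2]
  refine Branches.fourier hb1 _ _ fun s2 hm2 ha2 hb2 => ?_
  refine Branches.measure hb2 _ _ _ (by rw [hm2, e2]) (by have := p.two_le_N; omega)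
    fun v s3 hm3 ha3 hb3 => ?_
  have hamp3 : s3.amp = z • loadStates (Function.update φ k fun y =>
        if y.2 i = (v : ℕ) then blockFourier i (φ k) y else 0) := by
    rw [ha3, hm2, ha2, e20, e2, ha1, hamp, Int.toNat_natCast, Int.toNat_natCast,
      fourierGate_smul, project_smul, fourierGate_loadStates_x,
      project_loadStates_x _ k i (by positivity) (by exact_mod_cast v.2)]
    simp
  have e14 : s3.mem 14 = (40 + p.n : ℕ) := by simp [hm3, hm2, hm1, hc.c14]
  have e18 : s3.mem 18 = (B + i : ℕ) := by simp [hm3, hm2, hm1, h18]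
  refine Branches.arith hb3 _ _ _ _ ?_ fun s4 hm4 ha4 hb4 => ?_
  · rw [e14, e18]
    simp only [ArithOp.apply]
    rw [abs_of_nonneg (by positivity)]
    omega
  have e22 : s4.mem 22 = (40 + p.n + (B + i) : ℕ) := by
    rw [hm4, Function.update_self, e14, e18]
    simp [ArithOp.apply]
  have e21 : s4.mem 21 = (v : ℕ) := by simp [hm4, hm3]
  refine Branches.store hb4 _ _ fun s5 hm5 ha5 hb5 => ?_
  rw [e22, e21, Int.toNat_natCast] at hm5
  have hne : ∀ j, j < 40 → j ≠ 40 + p.n + (B + i) := fun j hj => by omega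
  have e13 : s5.mem 13 = 40 := by simp [hm5, hm4, hm3, hm2, hm1, hne, hc.c13]
  have e15 : s5.mem 15 = (i : ℕ) := by simp [hm5, hm4, hm3, hm2, hm1, hne, h15]
  refine Branches.arith hb5 _ _ _ _ ?_ fun s6 hm6 ha6 hb6 => ?_
  · rw [e13, e15]
    simp only [ArithOp.apply]
    rw [abs_of_nonneg (by positivity)]
    omega
  have e22' : s6.mem 22 = (40 + i : ℕ) := by
    rw [hm6, Function.update_self, e13, e15]
    simp [ArithOp.apply]
  refine Branches.load hb6 _ _ fun s7 hm7 ha7 hb7 => ?_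
  rw [e22', Int.toNat_natCast] at hm7
  -- The samples are stored from cell `40 + n` on, hence never over the secret.
  have eS : s6.mem (40 + i) = s.mem (40 + i) := by
    have q1 : 40 + (i : ℕ) ≠ 40 + p.n + (B + i) := by omega
    have q2 : 40 + (i : ℕ) ≠ 22 := by omega
    have q3 : 40 + (i : ℕ) ≠ 21 := by omega
    have q4 : 40 + (i : ℕ) ≠ 20 := by omega
    rw [hm6, Function.update_of_ne q2, hm5, Function.update_of_ne q1, hm4,
      Function.update_of_ne q2, hm3, Function.update_of_ne q3, hm2, hm1, Function.update_of_ne q4]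
  rw [eS] at hm7
  have e23 : s7.mem 23 = s.mem (40 + i) := by rw [hm7, Function.update_self]
  have e21' : s7.mem 21 = (v : ℕ) := by simp [hm7, hm6, hm5, hm4, hm3, hne]
  refine Branches.arith hb7 _ _ _ _ ?_ fun s8 hm8 ha8 hb8 => ?_
  · rw [e23, e21']
    exact hA' v
  have e23' : s8.mem 23 = s.mem (40 + i) * (v : ℕ) := by
    rw [hm8, Function.update_self, e23, e21']; rfl
  have e19 : s8.mem 19 = A := by simp [hm8, hm7, hm6, hm5, hm4, hm3, hm2, hm1, hne, h19]
  refine Branches.arith hb8 _ _ _ _ ?_ fun s9 hm9 ha9 hb9 => ?_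
  · rw [e23', e19]
    exact hA v
  have e18' : s9.mem 18 = (B + i : ℕ) := by
    simp [hm9, hm8, hm7, hm6, hm5, hm4, hm3, hm2, hm1, hne, h18]
  have e4 : s9.mem 4 = 1 := by
    simp [hm9, hm8, hm7, hm6, hm5, hm4, hm3, hm2, hm1, hne, hc.c4]
  refine Branches.arith hb9 _ _ _ _ ?_ fun s10 hm10 ha10 hb10 => Branches.skip ?_
  · rw [e18', e4]
    simp only [ArithOp.apply]
    rw [abs_of_nonneg (by positivity)]
    omega
  refine ⟨fun j hj hj2 => ?_, hb10, ?_, ?_, ?_, ?_⟩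
  · have h1 : j ≠ 18 := by unfold residueScratch at hj; omega
    have h2 : j ≠ 19 := by unfold residueScratch at hj; omega
    have h3 : j ≠ 20 := by unfold residueScratch at hj; omega
    have h4 : j ≠ 21 := by unfold residueScratch at hj; omega
    have h5 : j ≠ 22 := by unfold residueScratch at hj; omega
    have h6 : j ≠ 23 := by unfold residueScratch at hj; omega
    rw [hm10, Function.update_of_ne h1, hm9, Function.update_of_ne h2, hm8,
      Function.update_of_ne h6, hm7, Function.update_of_ne h6, hm6, Function.update_of_ne h5, hm5,
      Function.update_of_ne hj2, hm4, Function.update_of_ne h5, hm3, Function.update_of_ne h4, hm2,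
      hm1, Function.update_of_ne h3]
  · rw [hm10, Function.update_self, e18', e4]
    simp [ArithOp.apply]
  · rw [hm10, Function.update_of_ne (by norm_num), hm9, Function.update_self, e19, e23']
    rfl
  · have q (j : ℕ) (hj : j < 40) : 40 + p.n + (B + (i : ℕ)) ≠ j := by omega
    rw [hm10, Function.update_of_ne (q 18 (by norm_num)), hm9,
      Function.update_of_ne (q 19 (by norm_num)), hm8, Function.update_of_ne (q 23 (by norm_num)),
      hm7, Function.update_of_ne (q 23 (by norm_num)), hm6,
      Function.update_of_ne (q 22 (by norm_num)), hm5, Function.update_self]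
  · rw [ha10, ha9, ha8, ha7, ha6, ha5, ha4, hamp3]

/-- The loop invariant is the partially measured block of `partBlock` together with the partial
inner product of the outcomes with `S`; outcomes not yet obtained are padded by zeros, which
`partBlock` ignores. -/
theorem branches_residueLoop {p : EDCPParams} {κ : ℕ} (hf : Fits p κ X)
    (hb : Bdd X s) (hc : Consts p κ s.mem) {k : Fin p.l}
    (h18 : s.mem 18 = (k * (p.n + 1) : ℕ)) (h19 : s.mem 19 = 0)
    {S : Fin p.n → Fin p.N} (hS : ∀ i : Fin p.n, s.mem (40 + i) = (S i : ℕ)) {z : ℂ}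
    {φ : Fin p.l → ℤ × (Fin p.n → ZMod p.N) → ℂ} (hamp : s.amp = z • loadStates φ)
    {f : ℤ → ℂ} {σ x : Fin p.n → ZMod p.N} (hφ : φ k = cosetBlock f σ x) :
    Branches E (stepCost X) (.loop 15 1 residueRound) s (Fin p.n → Fin p.N) (1 + p.n * 11)
      fun a s' =>
      (∀ j, ¬ residueScratch j → j < 40 + p.n + k * (p.n + 1) → s'.mem j = s.mem j) ∧ Bdd X s' ∧
      s'.mem 18 = (k * (p.n + 1) + p.n : ℕ) ∧
      s'.mem 19 = ∑ i : Fin p.n, ((a i : ℕ) : ℤ) * s.mem (40 + i) ∧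
      (∀ i : Fin p.n, s'.mem (40 + p.n + (k * (p.n + 1) + i)) = (a i : ℕ)) ∧
      s'.amp = z • loadStates (Function.update φ k
        (partBlock p.n (fun i : Fin p.n => extWord a i) f σ x)) := by
  have hval := hf.value
  set B := (k : ℕ) * (p.n + 1) with hB
  refine (Branches.loop (m := 10) hb 15 1 hc.c1 (fun t (w : Fin t → Fin p.N) s' =>
    (∀ j, ¬ residueScratch j → j < 40 + p.n + B → s'.mem j = s.mem j) ∧ Bdd X s' ∧
      s'.mem 18 = (B + t : ℕ) ∧
      s'.mem 19 = ∑ i : Fin t, ((w i : ℕ) : ℤ) * s.mem (40 + i) ∧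
      (∀ i : Fin t, s'.mem (40 + p.n + (B + i)) = (w i : ℕ)) ∧
      s'.amp = z • loadStates (Function.update φ k
        (partBlock t (fun i : Fin p.n => extWord w i) f σ x))) ?_ ?_ ?_)
  · intro s' hm ha
    refine ⟨fun j _ _ => by rw [hm], hb.of_mem_eq hm, by rw [hm, h18]; simp, by rw [hm, h19]; simp,
      fun i => i.elim0, ?_⟩
    rw [ha, hamp, partBlock_zero, ← hφ, Function.update_eq_self]
  · intro t w s' _ h
    exact h.2.1
  · rintro t w s' s'' ht ⟨h1, h2, h3, h4, h5, h6⟩ hm ha hb''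
    have hfr : ∀ j, ¬ residueScratch j → j < 40 + p.n + B → s''.mem j = s.mem j := by
      intro j hj hj2
      have : j ≠ 15 := by unfold residueScratch at hj; omega
      rw [hm, Function.update_of_ne this, h1 j hj hj2]
    have hc'' : Consts p κ s''.mem := hc.congr fun j _ hj =>
      hfr j (by unfold residueScratch; omega) (by omega)
    have hSt : s''.mem (40 + t) = s.mem (40 + t) := hfr _ (by unfold residueScratch; omega) (by omega)
    have hSt' : s.mem (40 + t) = (S ⟨t, ht⟩ : ℕ) := hS ⟨t, ht⟩
    have hsumv : ∀ v : Fin p.N, ∑ i : Fin t, ((w i : ℕ) : ℤ) * s.mem (40 + i) +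
        s.mem (40 + t) * (v : ℕ) =
        ∑ i : Fin (t + 1), ((Fin.snoc (α := fun _ => Fin p.N) w v i : ℕ) : ℤ) * s.mem (40 + i) := by
      intro v
      rw [Fin.sum_univ_castSucc]
      simp [mul_comm]
    refine (branches_residueRound (k := k) (i := ⟨t, ht⟩) (z := z) (A := ∑ i : Fin t, ((w i : ℕ) : ℤ) * s.mem (40 + i)) hf hb'' hc''
      ?_ ?_ ?_ ?_ ?_ (ha.trans h6)).mono le_rfl ?_
    · rw [hm, Function.update_of_ne (by norm_num), h3]
    · rw [hm, Function.update_self]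
    · rw [hm, Function.update_of_ne (by norm_num), h4]
    · intro v
      simp only
      rw [hSt, hsumv]
      have := abs_sum_le (n := p.n) (by omega) (Fin.snoc (α := fun _ => Fin p.N) w v) S
        (fun i => s.mem (40 + i)) hS
      refine this.trans ?_
      exact_mod_cast (by omega : p.n * (p.N * p.N) ≤ X)
    · intro v
      simp only
      rw [hSt, hSt', abs_of_nonneg (by positivity)]
      have h7 := Nat.mul_le_mul (S ⟨t, ht⟩).2.le v.2.le
      have h8 := Nat.mul_le_mul_right (p.N * p.N) p.one_le_n
      exact_mod_cast (by omega : (S ⟨t, ht⟩ : ℕ) * (v : ℕ) ≤ X)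
    · rintro v s3 ⟨g1, g2, g3, g4, g5, g6⟩
      simp only at g1 g3 g4 g5 g6
      refine ⟨fun j hj hj2 => ?_, g2, ?_, ?_, fun i => ?_, ?_⟩
      · rw [g1 j hj (by omega), hfr j hj hj2]
      · rw [g3]; rfl
      · rw [g4, hSt, hsumv]
      · rcases Fin.eq_castSucc_or_eq_last i with ⟨i, rfl⟩ | rfl
        · have hi := i.2
          simp only [Fin.snoc_castSucc, Fin.val_castSucc]
          rw [g1 _ (by unfold residueScratch; omega) (by omega), hm,
            Function.update_of_ne (by omega), h5 i]
        · simp only [Fin.snoc_last, Fin.val_last]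
          exact g5
      · rw [g6, Function.update_self, Function.update_idem]
        have := partBlock_step (⟨t, ht⟩ : Fin p.n) (fun i : Fin p.n => extWord w i) ((v : ℕ) : ZMod p.N)
          f σ x
        simp only at this
        rw [this, extWord_snoc w v ⟨t, ht⟩ rfl]

/-- The final state of a block with outcomes `a` and `b`. -/
noncomputable abbrev outBlock (p : EDCPParams) (a : Fin p.n → Fin p.N) (b : Fin p.N) (f : ℤ → ℂ)
    (σ x : Fin p.n → ZMod p.N) : ℤ × (Fin p.n → ZMod p.N) → ℂ :=
  doneBlock ((p.N / 2 : ℕ) : ℤ) (fun i : Fin p.n => extWord a i) ((b : ℕ) : ZMod p.N) f σ x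

/-- The scratch cells of the loop over the blocks. -/
def blockScratch (j : ℕ) : Prop := 15 ≤ j ∧ j ≤ 28

/-- The shift by `N / 2` moves the centre of the amplitude to the middle of the window of residues,
and the Fourier transform and measurement then read off the frequency. The stored entry is the
accumulated `⟨a, S⟩` minus the outcome plus the noise. -/
theorem branches_headCmd {p : EDCPParams} {κ : ℕ} (hf : Fits p κ X)
    (hb : Bdd X s) (hc : Consts p κ s.mem) {k : Fin p.l} {A e : ℤ}
    (h18 : s.mem 18 = (k * (p.n + 1) + p.n : ℕ)) (h19 : s.mem 19 = A) (h24 : s.mem 24 = e)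
    (hA : |A| ≤ p.n * (p.N * p.N)) (he : |e| ≤ noiseRange p κ) {z : ℂ}
    {φ : Fin p.l → ℤ × (Fin p.n → ZMod p.N) → ℂ} (hamp : s.amp = z • loadStates φ)
    {f : ℤ → ℂ} {σ x : Fin p.n → ZMod p.N} {a : Fin p.n → Fin p.N}
    (hφ : φ k = partBlock p.n (fun i : Fin p.n => extWord a i) f σ x) :
    Branches E (stepCost X) headCmd s (Fin p.N) 9 fun v s' =>
      (∀ j, ¬ blockScratch j → j ≠ 40 + p.n + (k * (p.n + 1) + p.n) → s'.mem j = s.mem j) ∧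
      Bdd X s' ∧ s'.mem 18 = ((k + 1) * (p.n + 1) : ℕ) ∧
      s'.mem (40 + p.n + (k * (p.n + 1) + p.n)) = A - (v : ℕ) + e ∧
      s'.amp = z • loadStates (Function.update φ k (outBlock p a v f σ x)) := by
  have hX := hf.index
  have hval := hf.value
  have hlt := blockPos_lt (n := p.n) k (i := p.n) (by omega)
  set B := (k : ℕ) * (p.n + 1) with hB
  have hXB : B + 1 + 2 * p.n + 40 ≤ X := by nlinarith
  have hX' : ((p.n * (p.N * p.N) + 2 * p.N + 2 * noiseRange p κ + κ * p.N + 1 : ℕ) : ℤ) ≤ X := by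
    exact_mod_cast hval
  have hκN : (0 : ℤ) ≤ κ * p.N := by positivity
  push_cast at hX'
  rw [abs_le] at hA he
  refine Branches.reindex (ι := Fin p.N × Unit) (P := fun v s' =>
      (∀ j, ¬ blockScratch j → j ≠ 40 + p.n + (B + p.n) → s'.mem j = s.mem j) ∧
      Bdd X s' ∧ s'.mem 18 = ((k + 1) * (p.n + 1) : ℕ) ∧
      s'.mem (40 + p.n + (B + p.n)) = A - (v.1 : ℕ) + e ∧
      s'.amp = z • loadStates (Function.update φ k (outBlock p a v.1 f σ x)))
    ?_ (Equiv.prodPUnit _).symm fun i s' h => h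
  refine Branches.arith hb _ _ _ _ ?_ fun s1 hm1 ha1 hb1 => ?_
  · rw [h18, hc.c1, abs_le]
    simp only [ArithOp.apply]
    constructor <;> omega
  have e20 : s1.mem 20 = (B : ℕ) := by
    rw [hm1, Function.update_self, h18, hc.c1]
    simp [ArithOp.apply]
  have e8 : s1.mem 8 = (p.N / 2 : ℕ) := by simp [hm1, hc.c8]
  have e2 : s1.mem 2 = p.N := by simp [hm1, hc.c2]
  refine Branches.shift hb1 _ _ fun s2 hm2 ha2 hb2 => ?_
  refine Branches.fourier hb2 _ _ fun s3 hm3 ha3 hb3 => ?_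
  refine Branches.measure hb3 _ _ _ (by rw [hm3, hm2, e2]) (by have := p.two_le_N; omega)
    fun v s4 hm4 ha4 hb4 => ?_
  have hv := v.2
  have hamp4 : s4.amp = z • loadStates (Function.update φ k (outBlock p a v f σ x)) := by
    rw [ha4, hm3, ha3, hm2, ha2, e20, e2, e8, ha1, hamp, Int.toNat_natCast, Int.toNat_natCast,
      shiftGate_smul, fourierGate_smul, project_smul, shiftGate_loadStates_j,
      fourierGate_loadStates_j,
      project_loadStates_j _ k (by positivity) (by exact_mod_cast hv)]
    simp only [Function.update_idem, Function.update_self, hφ, Int.cast_natCast]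
    rfl
  have e19 : s4.mem 19 = A := by simp [hm4, hm3, hm2, hm1, h19]
  have e21 : s4.mem 21 = (v : ℕ) := by simp [hm4]
  refine Branches.arith hb4 _ _ _ _ ?_ fun s5 hm5 ha5 hb5 => ?_
  · rw [e19, e21, abs_le]
    simp only [ArithOp.apply]
    constructor <;> linarith
  have e19' : s5.mem 19 = A - (v : ℕ) := by
    rw [hm5, Function.update_self, e19, e21]; rfl
  have e24 : s5.mem 24 = e := by simp [hm5, hm4, hm3, hm2, hm1, h24]
  refine Branches.arith hb5 _ _ _ _ ?_ fun s6 hm6 ha6 hb6 => ?_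
  · rw [e19', e24, abs_le]
    simp only [ArithOp.apply]
    constructor <;> linarith
  have e19'' : s6.mem 19 = A - (v : ℕ) + e := by
    rw [hm6, Function.update_self, e19', e24]; rfl
  have e14 : s6.mem 14 = (40 + p.n : ℕ) := by simp [hm6, hm5, hm4, hm3, hm2, hm1, hc.c14]
  have e18 : s6.mem 18 = (B + p.n : ℕ) := by simp [hm6, hm5, hm4, hm3, hm2, hm1, h18]
  refine Branches.arith hb6 _ _ _ _ ?_ fun s7 hm7 ha7 hb7 => ?_
  · rw [e14, e18]
    simp only [ArithOp.apply]
    rw [abs_of_nonneg (by positivity)]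
    omega
  have e22 : s7.mem 22 = (40 + p.n + (B + p.n) : ℕ) := by
    rw [hm7, Function.update_self, e14, e18]
    simp [ArithOp.apply]
  have f19 : s7.mem 19 = A - (v : ℕ) + e := by simp [hm7, e19'']
  refine Branches.store hb7 _ _ fun s8 hm8 ha8 hb8 => ?_
  rw [e22, f19, Int.toNat_natCast] at hm8
  have hne : ∀ j, j < 40 → j ≠ 40 + p.n + (B + p.n) := fun j hj => by omega
  have f18 : s8.mem 18 = (B + p.n : ℕ) := by simp [hm8, hm7, e18, hne]
  have f4 : s8.mem 4 = 1 := by simp [hm8, hm7, hm6, hm5, hm4, hm3, hm2, hm1, hne, hc.c4]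
  refine Branches.arith hb8 _ _ _ _ ?_ fun s9 hm9 ha9 hb9 => Branches.skip ?_
  · rw [f18, f4]
    simp only [ArithOp.apply]
    rw [abs_of_nonneg (by positivity)]
    omega
  refine ⟨fun j hj hj2 => ?_, hb9, ?_, ?_, ?_⟩
  · unfold blockScratch at hj
    have h1 : j ≠ 18 := by omega
    have h2 : j ≠ 19 := by omega
    have h3 : j ≠ 20 := by omega
    have h4 : j ≠ 21 := by omega
    have h5 : j ≠ 22 := by omega
    rw [hm9, Function.update_of_ne h1, hm8, Function.update_of_ne hj2, hm7,
      Function.update_of_ne h5, hm6, Function.update_of_ne h2, hm5, Function.update_of_ne h2, hm4,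
      Function.update_of_ne h4, hm3, hm2, hm1, Function.update_of_ne h3]
  · rw [hm9, Function.update_self, f18, f4, hB]
    simp only [ArithOp.apply]
    push_cast
    ring
  · have q : 40 + p.n + (B + p.n) ≠ 18 := by omega
    rw [hm9, Function.update_of_ne q, hm8, Function.update_self]
  · rw [ha9, ha8, ha7, ha6, ha5, hamp4]

/-- The random outcomes for a block: the measured residues, the choices of the rejection sampler,
and the measured integer. -/
abbrev BlockOutcome (p : EDCPParams) (κ : ℕ) : Type :=
  (Fin p.n → Fin p.N) × (Fin (κ * κ) → NoiseChoice p κ) × Fin p.N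

/-- The last entry of the sample that is computed from a block. -/
noncomputable def sampleVal (p : EDCPParams) (κ : ℕ) (S : Fin p.n → Fin p.N)
    (w : BlockOutcome p κ) : ℤ :=
  ∑ i, ((w.1 i : ℕ) : ℤ) * (S i : ℕ) - (w.2.2 : ℕ) + noiseVal p κ (κ * κ) w.2.1

/-- The sampler may run between the two measurements of a block because it affects the state only by
a scalar. The amplitude `f` is left arbitrary, so Gaussian and basis states are treated at once. -/
theorem branches_blockCmd {p : EDCPParams} {κ : ℕ} (hf : Fits p κ X) (hE : E.param = p.r)
    (hb : Bdd X s) (hc : Consts p κ s.mem) {k : Fin p.l} (h18 : s.mem 18 = (k * (p.n + 1) : ℕ))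
    {S : Fin p.n → Fin p.N} (hS : ∀ i : Fin p.n, s.mem (40 + i) = (S i : ℕ)) {z : ℂ}
    {φ : Fin p.l → ℤ × (Fin p.n → ZMod p.N) → ℂ} (hamp : s.amp = z • loadStates φ)
    {f : ℤ → ℂ} {σ x : Fin p.n → ZMod p.N} (hφ : φ k = cosetBlock f σ x) :
    Branches E (stepCost X) blockCmd s (BlockOutcome p κ)
      (1 + p.n * 11 + ((1 + κ * κ * 13 + 1) + 9) + 1) fun w s' =>
      (∀ j, ¬ blockScratch j → j < 40 + p.n + k * (p.n + 1) → s'.mem j = s.mem j) ∧ Bdd X s' ∧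
      s'.mem 18 = ((k + 1) * (p.n + 1) : ℕ) ∧
      (∀ i : Fin p.n, s'.mem (40 + p.n + (k * (p.n + 1) + i)) = (w.1 i : ℕ)) ∧
      s'.mem (40 + p.n + (k * (p.n + 1) + p.n)) = sampleVal p κ S w ∧
      s'.amp = (noiseAmp p κ ^ (κ * κ) * z) •
        loadStates (Function.update φ k (outBlock p w.1 w.2.2 f σ x)) := by
  refine Branches.const hb 19 0 (by simp) fun s1 hm1 ha1 hb1 => ?_
  have hc1 : Consts p κ s1.mem := hc.congr fun j _ hj => by
    rw [hm1, Function.update_of_ne (by omega)]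
  have hS1 : ∀ i : Fin p.n, s1.mem (40 + i) = (S i : ℕ) := fun i => by
    rw [hm1, Function.update_of_ne (by omega), hS]
  refine Branches.seq (branches_residueLoop (k := k) (x := x) hf hb1 hc1 (by simp [hm1, h18])
    (by simp [hm1]) hS1 (ha1.trans hamp) hφ) ?_
  rintro a s2 ⟨h1, h2, h3, h4, h5, h6⟩
  have hc2 : Consts p κ s2.mem := hc1.congr fun j _ hj =>
    h1 j (by unfold residueScratch; omega) (by omega)
  have hsupp2 : ∀ b, b (p.l * (p.n + 1)) ≠ 0 → s2.amp b = 0 := by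
    intro b hb
    rw [h6]
    simp [loadStates_fresh _ b hb]
  refine Branches.seq (branches_noiseCmd hf hE h2 hc2 hsupp2) ?_
  rintro ω s3 ⟨g1, g2, g3, g4⟩
  have hns : ∀ j, 29 ≤ j → s3.mem j = s2.mem j := fun j hj => g1 j (by unfold noiseScratch; omega)
  have hsum : s2.mem 19 = ∑ i, ((a i : ℕ) : ℤ) * (S i : ℕ) := by
    rw [h4]
    exact Finset.sum_congr rfl fun i _ => by rw [hS1]
  refine (branches_headCmd (k := k) (a := a) (x := x) (f := f) (σ := σ)
    (A := s2.mem 19) (e := noiseVal p κ (κ * κ) ω) hf g2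
    (hc2.congr fun j _ hj => g1 j (by unfold noiseScratch; omega)) ?_ ?_ g4 ?_
    (abs_noiseVal_le _ _ _ _) (z := noiseAmp p κ ^ (κ * κ) * z)
    (φ := Function.update φ k (partBlock p.n (fun i : Fin p.n => extWord a i) f σ x)) ?_ ?_).mono le_rfl ?_
  · rw [g1 _ (by unfold noiseScratch; omega), h3]
  · rw [g1 _ (by unfold noiseScratch; omega)]
  · rw [h4]
    exact abs_sum_le le_rfl a S (fun i => s1.mem (40 + i)) hS1
  · rw [g3, h6, smul_smul]
  · rw [Function.update_self]
  · rintro v s4 ⟨q1, q2, q3, q4, q5⟩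
    refine ⟨fun j hj hj2 => ?_, q2, q3, fun i => ?_, ?_, ?_⟩
    · have hj3 : ¬ noiseScratch j := by unfold noiseScratch; unfold blockScratch at hj; omega
      have hj4 : ¬ residueScratch j := by unfold residueScratch; unfold blockScratch at hj; omega
      have hj5 : j ≠ 19 := by unfold blockScratch at hj; omega
      rw [q1 j hj (by omega), g1 j hj3, h1 j hj4 hj2, hm1, Function.update_of_ne hj5]
    · have hi := i.2
      rw [q1 _ (by unfold blockScratch; omega) (by omega), hns _ (by omega), h5]
    · rw [q4, hsum, sampleVal]
    · rw [q5, Function.update_idem]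

end QMachine

/-! ### Execution of the whole program. -/

namespace QMachine

variable {E : Env} {X : ℕ} {s : Config}

/-- The block states after the first `t` blocks have been processed. -/
noncomputable def outStates (p : EDCPParams) (κ : ℕ) (f : Fin p.l → ℤ → ℂ) (σ : Fin p.n → ZMod p.N)
    (x : Fin p.l → Fin p.n → ZMod p.N) {t : ℕ} (w : Fin t → BlockOutcome p κ) (k : Fin p.l) :
    ℤ × (Fin p.n → ZMod p.N) → ℂ :=
  if h : (k : ℕ) < t then outBlock p (w ⟨k, h⟩).1 (w ⟨k, h⟩).2.2 (f k) σ (x k)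
  else cosetBlock (f k) σ (x k)

theorem outStates_snoc (p : EDCPParams) (κ : ℕ) (f : Fin p.l → ℤ → ℂ) (σ : Fin p.n → ZMod p.N)
    (x : Fin p.l → Fin p.n → ZMod p.N) {t : ℕ} (ht : t < p.l) (w : Fin t → BlockOutcome p κ)
    (v : BlockOutcome p κ) :
    Function.update (outStates p κ f σ x w) ⟨t, ht⟩
      (outBlock p v.1 v.2.2 (f ⟨t, ht⟩) σ (x ⟨t, ht⟩)) =
      outStates p κ f σ x (Fin.snoc (α := fun _ => BlockOutcome p κ) w v) := by
  funext k
  by_cases hk : k = ⟨t, ht⟩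
  · subst hk
    simp [outStates, Fin.snoc]
  · have h1 : (k : ℕ) ≠ t := fun h => hk (Fin.ext h)
    rw [Function.update_of_ne hk]
    by_cases h : (k : ℕ) < t
    · simp [outStates, Fin.snoc, h, Nat.lt_succ_of_lt h]
    · have h2 : ¬ (k : ℕ) < t + 1 := by omega
      simp [outStates, h, h2]

/-- At each stage the state is a scalar multiple of a product state in which the finished factors
are replaced by their measured form, so a round only touches its own factor. -/
theorem branches_blockLoop {p : EDCPParams} {κ : ℕ} (hf : Fits p κ X) (hE : E.param = p.r)
    (hb : Bdd X s) (hc : Consts p κ s.mem) (h18 : s.mem 18 = 0)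
    {S : Fin p.n → Fin p.N} (hS : ∀ i : Fin p.n, s.mem (40 + i) = (S i : ℕ)) {z : ℂ}
    {f : Fin p.l → ℤ → ℂ} {σ : Fin p.n → ZMod p.N} {x : Fin p.l → Fin p.n → ZMod p.N}
    (hamp : s.amp = z • loadStates fun k => cosetBlock (f k) σ (x k)) :
    Branches E (stepCost X) (.loop 16 3 blockCmd) s (Fin p.l → BlockOutcome p κ)
      (1 + p.l * (1 + p.n * 11 + ((1 + κ * κ * 13 + 1) + 9) + 1 + 1)) fun w s' =>
      Bdd X s' ∧ Consts p κ s'.mem ∧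
      (∀ k : Fin p.l, (∀ i : Fin p.n,
        s'.mem (40 + p.n + (k * (p.n + 1) + i)) = ((w k).1 i : ℕ)) ∧
        s'.mem (40 + p.n + (k * (p.n + 1) + p.n)) = sampleVal p κ S (w k)) ∧
      s'.amp = ((noiseAmp p κ ^ (κ * κ)) ^ p.l * z) • loadStates (outStates p κ f σ x w) := by
  refine (Branches.loop (ι := BlockOutcome p κ) (T := p.l)
    (m := 1 + p.n * 11 + ((1 + κ * κ * 13 + 1) + 9) + 1) hb 16 3 hc.c3 (fun t w s' =>
      (∀ j, ¬ blockScratch j → j < 40 + p.n → s'.mem j = s.mem j) ∧ Bdd X s' ∧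
      s'.mem 18 = (t * (p.n + 1) : ℕ) ∧
      (∀ k : Fin t, (∀ i : Fin p.n,
        s'.mem (40 + p.n + (k * (p.n + 1) + i)) = ((w k).1 i : ℕ)) ∧
        s'.mem (40 + p.n + (k * (p.n + 1) + p.n)) = sampleVal p κ S (w k)) ∧
      s'.amp = ((noiseAmp p κ ^ (κ * κ)) ^ t * z) • loadStates (outStates p κ f σ x w))
    ?_ ?_ ?_).mono le_rfl ?_
  · intro s' hm ha
    refine ⟨fun j _ _ => by rw [hm], hb.of_mem_eq hm, by rw [hm, h18]; simp, fun k => k.elim0, ?_⟩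
    rw [ha, hamp, pow_zero, one_mul]
    congr 2
  · intro t w s' _ h
    exact h.2.1
  · rintro t w s' s'' ht ⟨h1, h2, h3, h4, h5⟩ hm ha hb''
    have hm' : ∀ j, j ≠ 16 → s''.mem j = s'.mem j := fun j hj => by
      rw [hm, Function.update_of_ne hj]
    have hfr : ∀ j, ¬ blockScratch j → j < 40 + p.n → s''.mem j = s.mem j := by
      intro j hj hj2
      rw [hm' j (by unfold blockScratch at hj; omega), h1 j hj hj2]
    have hc'' : Consts p κ s''.mem := hc.congr fun j _ hj =>
      hfr j (by unfold blockScratch; omega) (by omega)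
    refine (branches_blockCmd (k := ⟨t, ht⟩) (S := S)
      (z := (noiseAmp p κ ^ (κ * κ)) ^ t * z) (f := f ⟨t, ht⟩) (σ := σ) (x := x ⟨t, ht⟩)
      (φ := outStates p κ f σ x w) hf hE hb'' hc'' ?_ ?_ (ha.trans h5) ?_).mono le_rfl ?_
    · rw [hm' _ (by norm_num), h3]
    · intro i
      rw [hfr _ (by unfold blockScratch; omega) (by omega), hS]
    · simp [outStates]
    · rintro v s3 ⟨g1, g2, g3, g4, g5, g6⟩
      simp only at g1 g3 g4 g5 g6
      -- A round writes no sample entry below its own block, so the samples already stored survive.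
      have hlow : ∀ (k : Fin t) (i : ℕ), i < p.n + 1 → s3.mem (40 + p.n + (k * (p.n + 1) + i)) =
          s'.mem (40 + p.n + (k * (p.n + 1) + i)) := by
        intro k i hi
        have := blockPos_lt (n := p.n) k hi
        rw [g1 _ (by unfold blockScratch; omega) (by omega), hm' _ (by omega)]
      refine ⟨fun j hj hj2 => ?_, g2, g3, fun k => ?_, ?_⟩
      · rw [g1 j hj (by omega), hfr j hj hj2]
      · rcases Fin.eq_castSucc_or_eq_last k with ⟨k, rfl⟩ | rfl
        · simp only [Fin.snoc_castSucc, Fin.val_castSucc]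
          refine ⟨fun i => ?_, ?_⟩
          · rw [hlow k i (by omega), (h4 k).1]
          · rw [hlow k p.n (by omega), (h4 k).2]
        · simp only [Fin.snoc_last, Fin.val_last]
          exact ⟨g4, g5⟩
      · rw [g6, outStates_snoc, pow_succ', mul_assoc]
  · rintro w s' ⟨h1, h2, h3, h4, h5⟩
    exact ⟨h2, hc.congr fun j _ hj => h1 j (by unfold blockScratch; omega) (by omega), h4, h5⟩

/-- The answer is indexed by `Bool`, with amplitudes `√q` and `√(1 - q)`. The query counts as `ℓ (n
+ 1) + 1` steps: one for each entry read and one for the address. -/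
theorem branches_query {p : EDCPParams} {κ : ℕ} {A : LWESamples p.n p.N p.l → unitInterval}
    (hb : Bdd X s) (hc : Consts p κ s.mem) {S : Fin p.n → Fin p.N}
    {w : Fin p.l → BlockOutcome p κ}
    (hw : ∀ k : Fin p.l, (∀ i : Fin p.n,
        s.mem (40 + p.n + (k * (p.n + 1) + i)) = ((w k).1 i : ℕ)) ∧
        s.mem (40 + p.n + (k * (p.n + 1) + p.n)) = sampleVal p κ S (w k)) :
    Branches (p.env A) (stepCost X) (.query 0 14) s Bool (p.l * (p.n + 1) + 1) fun b s' =>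
      s'.mem 0 = (if b then 1 else 0) ∧
      s'.amp = ((Real.sqrt (if b then
          (A fun k => (fun i => ((w k).1 i : ℕ), (sampleVal p κ S (w k) : ZMod p.N)) : ℝ)
        else 1 - (A fun k => (fun i => ((w k).1 i : ℕ), (sampleVal p κ S (w k) : ZMod p.N)) : ℝ)) :
          ℝ) : ℂ) • s.amp := by
  have horacle : (p.env A).oracle (fun t => s.mem ((s.mem 14).toNat + t)) =
      A fun k => (fun i => ((w k).1 i : ℕ), (sampleVal p κ S (w k) : ZMod p.N)) := by
    simp only [EDCPParams.env, hc.c14, Int.toNat_natCast]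
    congr 1
    funext k
    rw [(hw k).2]
    congr 1
    funext i
    rw [(hw k).1 i]
    simp
  set q : ℝ := (A fun k => (fun i => ((w k).1 i : ℕ), (sampleVal p κ S (w k) : ZMod p.N)) : ℝ)
  set cost := bits (s.mem 14) +
    ∑ t ∈ Finset.range (p.env A).queryLen, bits (s.mem ((s.mem 14).toNat + t)) with hcost
  have hle : cost ≤ (p.l * (p.n + 1) + 1) * stepCost X := by
    have h1 : ∀ j, bits (s.mem j) ≤ stepCost X := fun j => by
      have := bits_le (hb j)
      have := size_le_stepCost X
      omega
    have h2 := Finset.sum_le_card_nsmul (Finset.range (p.env A).queryLen)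
      (fun t => bits (s.mem ((s.mem 14).toNat + t))) (stepCost X) fun t _ => h1 _
    have h3 := h1 14
    simp only [Finset.card_range, smul_eq_mul, EDCPParams.env] at h2
    rw [hcost, add_mul, one_mul]
    simp only [EDCPParams.env]
    omega
  refine ⟨fun b => (s.gate (fun ψ y => ((Real.sqrt (if b then q else 1 - q) : ℝ) : ℂ) * ψ y) 0).write 0
    (if b then 1 else 0) cost, ?_, fun b => ⟨?_, ?_, ?_⟩⟩
  · rw [run, horacle]
    rfl
  · simp only [Config.write, Config.gate]
    omega
  · simp [Config.write]
  · rfl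

theorem branches_initCmd {ι : Type} [Fintype ι] {m : ℕ} {P : ι → Config → Prop} {c : Cmd}
    {p : EDCPParams} {κ : ℕ} (hf : Fits p κ X) (hE : E.param = p.r) {ψ : (ℕ →₀ ℤ) → ℂ}
    (h : ∀ s, Bdd X s → Consts p κ s.mem → s.mem 18 = 0 → s.amp = ψ →
      Branches E (stepCost X) c s ι m P) :
    Branches E (stepCost X) (initCmd c) (p.start κ ψ) ι (m + 13) P := by
  have hX := hf.index
  have hval := hf.value
  have hkap := hf.kappa
  have hr := p.r_pos
  have hN2 := p.two_le_N
  have hnl : p.l * (p.n + 1) + (p.n + 1) + 100 ≤ X := by linarith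
  have hlX : p.l ≤ p.l * (p.n + 1) := Nat.le_mul_of_pos_right _ (by omega)
  have hb : Bdd X (p.start κ ψ) := by
    intro i
    have e : ∀ a : ℕ, a ≤ X → |(a : ℤ)| ≤ X := fun a ha => by simpa using ha
    match i with
    | 0 => exact e κ (by omega)
    | 1 => exact e p.n (by omega)
    | 2 => exact e p.N (by omega)
    | 3 => exact e p.l (by omega)
    | (j + 4) => simp [EDCPParams.start]
  have m0 : (p.start κ ψ).mem 0 = κ := rfl
  have m1 : (p.start κ ψ).mem 1 = p.n := rfl
  have m2 : (p.start κ ψ).mem 2 = p.N := rfl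
  have m3 : (p.start κ ψ).mem 3 = p.l := rfl
  have m18 : (p.start κ ψ).mem 18 = 0 := rfl
  have m_amp : (p.start κ ψ).amp = ψ := rfl
  generalize p.start κ ψ = s0 at *
  -- Layout of the constants: cells 4 and 5 hold `1` and `0`, 6 holds `n + 1`, 7 the number of the
  -- fresh register, 8 half the modulus, 9 and 10 the range and the number of proposals, 11 the
  -- precision, 12 the number of rounds, 13 and 14 the addresses of the secret and of the samples.
  refine Branches.const hb _ _ (by norm_num; omega) fun s1 hm1 ha1 hb1 => ?_
  refine Branches.const hb1 _ _ (by norm_num) fun s2 hm2 ha2 hb2 => ?_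
  have e1 : s2.mem 1 = p.n := by simp [hm2, hm1, m1]
  have e4 : s2.mem 4 = 1 := by simp [hm2, hm1]
  refine Branches.arith hb2 _ _ _ _ ?_ fun s3 hm3 ha3 hb3 => ?_
  · rw [e1, e4]
    simp only [ArithOp.apply]
    rw [abs_of_nonneg (by positivity)]
    omega
  have e6 : s3.mem 6 = (p.n + 1 : ℕ) := by
    rw [hm3, Function.update_self, e1, e4]; simp [ArithOp.apply]
  have e3 : s3.mem 3 = p.l := by simp [hm3, hm2, hm1, m3]
  refine Branches.arith hb3 _ _ _ _ ?_ fun s4 hm4 ha4 hb4 => ?_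
  · rw [e3, e6]
    simp only [ArithOp.apply]
    rw [abs_of_nonneg (by positivity)]
    have : p.l * (p.n + 1) ≤ X := by omega
    exact_mod_cast this
  have e7 : s4.mem 7 = (p.l * (p.n + 1) : ℕ) := by
    rw [hm4, Function.update_self, e3, e6]; simp [ArithOp.apply]
  refine Branches.const hb4 _ _ (by norm_num; omega) fun s5 hm5 ha5 hb5 => ?_
  have e2 : s5.mem 2 = p.N := by simp [hm5, hm4, hm3, hm2, hm1, m2]
  have e8 : s5.mem 8 = 2 := by simp [hm5]
  refine Branches.arith hb5 _ _ _ _ ?_ fun s6 hm6 ha6 hb6 => ?_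
  · rw [e2, e8]
    simp only [ArithOp.apply]
    rw [abs_of_nonneg (by omega)]
    omega
  have e8' : s6.mem 8 = (p.N / 2 : ℕ) := by
    rw [hm6, Function.update_self, e2, e8]; simp [ArithOp.apply]
  have e0 : s6.mem 0 = κ := by simp [hm6, hm5, hm4, hm3, hm2, hm1, m0]
  have e2' : s6.mem 2 = p.N := by simp [hm6, e2]
  have hq0 : (0 : ℝ) ≤ κ * p.N / p.r := by positivity
  have hfl : ⌊RealExpr.eval E.param s6.mem (.div (.mul (.reg 0) (.reg 2)) .param)⌋ =
      (noiseRange p κ : ℤ) := by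
    simp only [RealExpr.eval, e0, e2', hE, Int.cast_natCast]
    rw [noiseRange, Int.natCast_floor_eq_floor hq0]
  have hκX : (κ : ℝ) ≤ X := by exact_mod_cast (by omega : κ ≤ X)
  have hNX : (p.N : ℝ) ≤ X := by exact_mod_cast (by omega : p.N ≤ X)
  have hκNX : (κ * p.N : ℝ) ≤ X := by exact_mod_cast (by omega : κ * p.N ≤ X)
  have bκ : bits κ ≤ X.size + 1 := bits_le (by
    rw [abs_of_nonneg (by positivity)]; exact_mod_cast hκX)
  refine Branches.floor hb6 _ _ ?_ ?_ fun s7 hm7 ha7 hb7 => ?_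
  · rw [hfl, abs_of_nonneg (by positivity)]
    omega
  · simp only [RealExpr.cost, RealExpr.eval, e0, e2', hE, Int.cast_natCast]
    have b2 : bits p.N ≤ X.size + 1 := bits_le (by
      rw [abs_of_nonneg (by positivity)]; exact_mod_cast hNX)
    have b3 : realBits p.r ≤ X.size + 1 := realBits_le (by rw [abs_of_pos hr]; exact hf.param)
    have b4 : realBits (κ * p.N) ≤ X.size + 1 := realBits_le (by
      rw [abs_of_nonneg (by positivity)]; exact hκNX)
    have b5 : realBits (κ * p.N / p.r) ≤ X.size + 1 := realBits_le (by
      rw [abs_of_nonneg hq0]; exact hf.quot)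
    omega
  rw [hfl] at hm7
  have e9 : s7.mem 9 = noiseRange p κ := by simp [hm7]
  refine Branches.arith hb7 _ _ _ _ ?_ fun s8 hm8 ha8 hb8 => ?_
  · rw [e9]
    simp only [ArithOp.apply]
    rw [abs_of_nonneg (by positivity)]
    omega
  have e10 : s8.mem 10 = noiseRange p κ + noiseRange p κ := by
    rw [hm8, Function.update_self, e9]; simp [ArithOp.apply]
  have e4' : s8.mem 4 = 1 := by simp [hm8, hm7, hm6, hm5, hm4, hm3, e4]
  refine Branches.arith hb8 _ _ _ _ ?_ fun s9 hm9 ha9 hb9 => ?_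
  · rw [e10, e4']
    simp only [ArithOp.apply]
    rw [abs_of_nonneg (by positivity)]
    omega
  have e10' : s9.mem 10 = (2 * noiseRange p κ + 1 : ℕ) := by
    rw [hm9, Function.update_self, e10, e4']
    simp only [ArithOp.apply]
    push_cast
    ring
  have e0' : s9.mem 0 = κ := by simp [hm9, hm8, hm7, e0]
  have hfl2 : ⌊RealExpr.eval E.param s9.mem (.exp (.reg 0))⌋ = (noisePrec κ : ℤ) := by
    simp only [RealExpr.eval, e0', Int.cast_natCast]
    rw [noisePrec, Int.natCast_floor_eq_floor (Real.exp_nonneg _)]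
  refine Branches.floor hb9 _ _ ?_ ?_ fun s10 hm10 ha10 hb10 => ?_
  · rw [hfl2, abs_of_nonneg (by positivity)]
    exact_mod_cast noisePrec_le hf
  · simp only [RealExpr.cost, RealExpr.eval, e0', Int.cast_natCast]
    have b3 : realBits (Real.exp κ) ≤ X.size + 1 := realBits_le (by
      rw [abs_of_nonneg (Real.exp_nonneg _)]; exact hf.prec)
    omega
  rw [hfl2] at hm10
  have e0'' : s10.mem 0 = κ := by simp [hm10, e0']
  refine Branches.arith hb10 _ _ _ _ ?_ fun s11 hm11 ha11 hb11 => ?_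
  · rw [e0'']
    simp only [ArithOp.apply]
    rw [abs_of_nonneg (by positivity)]
    exact_mod_cast (by omega : κ * κ ≤ X)
  have e12 : s11.mem 12 = (κ * κ : ℕ) := by
    rw [hm11, Function.update_self, e0'']; simp [ArithOp.apply]
  refine Branches.const hb11 _ _ (by norm_num; omega) fun s12 hm12 ha12 hb12 => ?_
  have e13 : s12.mem 13 = 40 := by simp [hm12]
  have e1' : s12.mem 1 = p.n := by simp [hm12, hm11, hm10, hm9, hm8, hm7, hm6, hm5, hm4, hm3, e1]
  refine Branches.arith hb12 _ _ _ _ ?_ fun s13 hm13 ha13 hb13 => ?_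
  · rw [e13, e1']
    simp only [ArithOp.apply]
    rw [abs_of_nonneg (by positivity)]
    omega
  refine h s13 hb13 ?_ ?_ ?_
  · constructor
    · simp [hm13, e1']
    · simp [hm13, hm12, hm11, hm10, hm9, hm8, hm7, e2']
    · simp [hm13, hm12, hm11, hm10, hm9, hm8, hm7, hm6, hm5, hm4, e3]
    · simp [hm13, hm12, hm11, hm10, hm9, e4']
    · simp [hm13, hm12, hm11, hm10, hm9, hm8, hm7, hm6, hm5, hm4, hm3, hm2]
    · simp [hm13, hm12, hm11, hm10, hm9, hm8, hm7, hm6, hm5, e7]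
    · simp [hm13, hm12, hm11, hm10, hm9, hm8, hm7, e8']
    · simp [hm13, hm12, hm11, hm10, hm9, hm8, e9]
    · simp [hm13, hm12, hm11, hm10, e10']
    · simp [hm13, hm12, hm11, hm10]
    · simp [hm13, hm12, e12]
    · simp [hm13, e13]
    · simp [hm13, e13, e1', ArithOp.apply]
  · simp [hm13, hm12, hm11, hm10, hm9, hm8, hm7, hm6, hm5, hm4, hm3, hm2, hm1, m18]
  · rw [ha13, ha12, ha11, ha10, ha9, ha8, ha7, ha6, ha5, ha4, ha3, ha2, ha1, m_amp]

/-- A bound for the number of steps of the program. -/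
def reductionSteps (p : EDCPParams) (κ : ℕ) : ℕ :=
  (1 + p.n * 7) + ((1 + p.l * (1 + p.n * 11 + ((1 + κ * κ * 13 + 1) + 9) + 1 + 1)) +
    (p.l * (p.n + 1) + 1)) + 13

/-- Here the machine model is left behind: what remains is an explicit finite family of scaled
product states, indexed by secret, block outcomes and oracle answer. -/
theorem branches_reduction {p : EDCPParams} {κ : ℕ} (hf : Fits p κ X)
    (A : LWESamples p.n p.N p.l → unitInterval)
    (f : Fin p.l → ℤ → ℂ) (σ : Fin p.n → ZMod p.N) (x : Fin p.l → Fin p.n → ZMod p.N) :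
    Branches (p.env A) (stepCost X) reduction
      (p.start κ (loadStates fun k => cosetBlock (f k) σ (x k)))
      ((Fin p.n → Fin p.N) × (Fin p.l → BlockOutcome p κ) × Bool) (reductionSteps p κ)
      fun i s' =>
      s'.mem 0 = (if i.2.2 then 1 else 0) ∧
      s'.amp = (((Real.sqrt (if i.2.2 then
          (A fun k => (fun j => ((i.2.1 k).1 j : ℕ), (sampleVal p κ i.1 (i.2.1 k) : ZMod p.N)) : ℝ)
        else 1 -
          (A fun k => (fun j => ((i.2.1 k).1 j : ℕ), (sampleVal p κ i.1 (i.2.1 k) : ZMod p.N)) : ℝ)) :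
          ℝ) : ℂ) * ((noiseAmp p κ ^ (κ * κ)) ^ p.l * ((Real.sqrt p.N : ℝ) : ℂ)⁻¹ ^ p.n)) •
        loadStates (outStates p κ f σ x i.2.1) := by
  refine branches_initCmd hf rfl fun s1 hb1 hc1 h18 ha1 => ?_
  refine Branches.seq (branches_secretCmd hf hb1 hc1 ?_) ?_
  · intro b hb
    rw [ha1]
    exact loadStates_fresh _ b hb
  rintro S s2 ⟨h1, h2, h3, h4, h5⟩
  refine Branches.seq (branches_blockLoop hf rfl h2 h1 (by rw [h3, h18]) h5
    (h4.trans (by rw [ha1]))) ?_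
  rintro w s3 ⟨g1, g2, g3, g4⟩
  refine (branches_query g1 g2 g3).mono le_rfl ?_
  rintro b s4 ⟨q1, q2⟩
  refine ⟨q1, ?_⟩
  rw [q2, g4, smul_smul]

end QMachine

/-! ### Sums of products -/

/-- Nonnegativity makes the product of two summable families summable, so Fubini applies in an
induction that splits off the first coordinate. -/
theorem hasSum_pi_prod {Y : Type*} (l : ℕ) (g : Fin l → Y → ℝ) (h0 : ∀ k y, 0 ≤ g k y)
    (hs : ∀ k, Summable (g k)) :
    HasSum (fun y : Fin l → Y => ∏ k, g k (y k)) (∏ k, ∑' y, g k y) := by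
  induction l with
  | zero => simp
  | succ l ih =>
    have ih := ih (fun k => g k.succ) (fun k => h0 _) (fun k => hs _)
    have h2 := (hs 0).mul_of_nonneg ih.summable (h0 0)
      fun y => Finset.prod_nonneg fun k _ => h0 _ _
    have h1 := (hs 0).hasSum.mul ih h2
    rw [← Fin.prod_univ_succ (fun k => ∑' y, g k y)] at h1
    rw [← (Fin.consEquiv fun _ => Y).hasSum_iff]
    refine h1.congr_fun ?_
    intro y
    simp [Fin.consEquiv, Fin.prod_univ_succ]

theorem sum_pi_prod {Y : Type*} [Fintype Y] {l : ℕ} (g : Fin l → Y → ℝ) :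
    ∑ y : Fin l → Y, ∏ k, g k (y k) = ∏ k, ∑ y, g k y := by
  classical
  rw [Finset.prod_univ_sum, Fintype.piFinset_univ]

theorem prod_ite_zero_fun {l : ℕ} (P : Fin l → Prop) [DecidablePred P] [Decidable (∀ k, P k)]
    (g : Fin l → ℝ) :
    ∏ k, (if P k then g k else 0) = if ∀ k, P k then ∏ k, g k else 0 := by
  split_ifs with h
  · exact Finset.prod_congr rfl fun k _ => if_pos (h k)
  · push Not at h
    obtain ⟨k, hk⟩ := h
    exact Finset.prod_eq_zero (Finset.mem_univ k) (if_neg hk)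

/-- Independent choices mapped coordinatewise remain independent; the fibres of the map on words are
products of fibres. -/
theorem sum_prod_pushforward {W Y : Type*} [Fintype W] [Fintype Y] [DecidableEq Y] {l : ℕ}
    (g : Fin l → W → ℝ) (π : W → Y) (F : (Fin l → Y) → ℝ) :
    ∑ w : Fin l → W, (∏ k, g k (w k)) * F (fun k => π (w k)) =
      ∑ y : Fin l → Y, (∏ k, ∑ w, if π w = y k then g k w else 0) * F y := by
  have h : ∀ y : Fin l → Y, (∏ k, ∑ w, if π w = y k then g k w else 0) =
      ∑ w : Fin l → W, if (fun k => π (w k)) = y then ∏ k, g k (w k) else 0 := by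
    intro y
    rw [← sum_pi_prod fun k w => if π w = y k then g k w else 0]
    refine Finset.sum_congr rfl fun w _ => ?_
    rw [prod_ite_zero_fun]
    simp only [funext_iff]
  simp_rw [h, Finset.sum_mul]
  rw [Finset.sum_comm]
  refine Finset.sum_congr rfl fun w _ => ?_
  simp

/-- The finite target turns the infinite sum over error vectors into a finite sum over residues. -/
theorem tsum_prod_pushforward {Y : Type*} [Fintype Y] [DecidableEq Y] {l : ℕ}
    (g : Fin l → ℤ → ℝ) (h0 : ∀ k j, 0 ≤ g k j) (hs : ∀ k, Summable (g k)) (π : Fin l → ℤ → Y)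
    (F : (Fin l → Y) → ℝ) :
    ∑' e : Fin l → ℤ, (∏ k, g k (e k)) * F (fun k => π k (e k)) =
      ∑ y : Fin l → Y, (∏ k, ∑' e, if π k e = y k then g k e else 0) * F y := by
  have hs' : ∀ (y : Fin l → Y) k, Summable fun e => if π k e = y k then g k e else 0 := by
    intro y k
    refine (hs k).of_nonneg_of_le (fun e => ?_) (fun e => ?_)
    · split_ifs
      exacts [h0 _ _, le_rfl]
    · split_ifs
      exacts [le_rfl, h0 _ _]
  have h : ∀ y : Fin l → Y, HasSum
      (fun e : Fin l → ℤ => (if (fun k => π k (e k)) = y then ∏ k, g k (e k) else 0) * F y)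
      ((∏ k, ∑' e, if π k e = y k then g k e else 0) * F y) := by
    intro y
    have := hasSum_pi_prod l (fun k e => if π k e = y k then g k e else 0) (fun k e => by
      split_ifs
      exacts [h0 _ _, le_rfl]) (hs' y)
    simp only [prod_ite_zero_fun] at this
    simp only [funext_iff]
    exact this.mul_right _
  have h2 := hasSum_sum (s := Finset.univ) fun y _ => h y
  rw [← h2.tsum_eq]
  refine tsum_congr fun e => ?_
  simp

/-- The `ℓ¹` distance of two product weights is at most the sum of the distances of the factors. -/
theorem sum_abs_prod_sub_prod_le {Y : Type*} [Fintype Y] : ∀ {l : ℕ} (g g' : Fin l → Y → ℝ),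
    (∀ k y, 0 ≤ g k y) → (∀ k y, 0 ≤ g' k y) → (∀ k, ∑ y, g k y ≤ 1) → (∀ k, ∑ y, g' k y ≤ 1) →
    ∑ y : Fin l → Y, |∏ k, g k (y k) - ∏ k, g' k (y k)| ≤ ∑ k, ∑ y, |g k y - g' k y|
  | 0, g, g', _, _, _, _ => by simp
  | l + 1, g, g', h0, h0', h1, h1' => by
    have ih := sum_abs_prod_sub_prod_le (fun k : Fin l => g k.succ) (fun k => g' k.succ)
      (fun k => h0 _) (fun k => h0' _) (fun k => h1 _) (fun k => h1' _)
    rw [Fin.sum_univ_succ, ← (Fin.consEquiv fun _ => Y).sum_comp, Fintype.sum_prod_type]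
    simp only [Fin.consEquiv_apply, Fin.prod_univ_succ, Fin.cons_zero, Fin.cons_succ]
    calc ∑ a, ∑ y : Fin l → Y, |g 0 a * ∏ k, g k.succ (y k) - g' 0 a * ∏ k, g' k.succ (y k)|
        ≤ ∑ a, ∑ y : Fin l → Y, (|g 0 a - g' 0 a| * ∏ k, g k.succ (y k) +
            g' 0 a * |∏ k, g k.succ (y k) - ∏ k, g' k.succ (y k)|) := by
          refine Finset.sum_le_sum fun a _ => Finset.sum_le_sum fun y _ => ?_
          have hp : 0 ≤ ∏ k, g k.succ (y k) := Finset.prod_nonneg fun k _ => h0 _ _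
          have h3 := h0' 0 a
          generalize (∏ k, g k.succ (y k)) = G at *
          generalize (∏ k, g' k.succ (y k)) = G' at *
          -- The hybrid argument: exchange the first factor while the others are unprimed, then the
          -- others while the first is primed.
          have e : g 0 a * G - g' 0 a * G' = (g 0 a - g' 0 a) * G + g' 0 a * (G - G') := by ring
          rw [e]
          refine (abs_add_le _ _).trans (le_of_eq ?_)
          rw [abs_mul, abs_mul, abs_of_nonneg hp, abs_of_nonneg h3]
      _ = (∑ a, |g 0 a - g' 0 a|) * (∑ y : Fin l → Y, ∏ k, g k.succ (y k)) +
          (∑ a, g' 0 a) * ∑ y : Fin l → Y, |∏ k, g k.succ (y k) - ∏ k, g' k.succ (y k)| := by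
          simp only [Finset.sum_add_distrib, Finset.sum_mul_sum]
      _ ≤ (∑ a, |g 0 a - g' 0 a|) * 1 + 1 * ∑ k : Fin l, ∑ y, |g k.succ y - g' k.succ y| := by
          refine add_le_add (mul_le_mul_of_nonneg_left ?_ (Finset.sum_nonneg fun _ _ => abs_nonneg _))
            (mul_le_mul (h1' 0) ih (Finset.sum_nonneg fun _ _ => abs_nonneg _) zero_le_one)
          rw [sum_pi_prod]
          exact Finset.prod_le_one (fun k _ => Finset.sum_nonneg fun _ _ => h0 _ _) fun k _ => h1 _
      _ = _ := by rw [mul_one, one_mul]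

/-! ### Fourier transforms of the sectors of a block state -/

section sector
variable {N : ℕ} [NeZero N]

/-- Parseval's identity: expand the square and use orthogonality of the characters `z ↦ z (v - v')`.
-/
theorem sum_norm_sq_dft (g : ZMod N → ℂ) :
    ∑ z : ZMod N, ‖∑ v : ZMod N, ZMod.stdAddChar (v * z) * g v‖ ^ 2 = N * ∑ v, ‖g v‖ ^ 2 := by
  have key : ∀ z : ZMod N, ((‖∑ v : ZMod N, ZMod.stdAddChar (v * z) * g v‖ ^ 2 : ℝ) : ℂ) =
      ∑ v, ∑ v', ZMod.stdAddChar (z * (v - v')) * (g v * starRingEnd ℂ (g v')) := by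
    intro z
    push_cast
    rw [← Complex.mul_conj', map_sum, Finset.sum_mul_sum]
    refine Finset.sum_congr rfl fun v _ => Finset.sum_congr rfl fun v' _ => ?_
    rw [map_mul (starRingEnd ℂ), ← AddChar.map_neg_eq_conj, mul_sub, sub_eq_add_neg, AddChar.map_add_eq_mul,
      mul_comm z v, mul_comm z v']
    ring
  have : ((∑ z : ZMod N, ‖∑ v : ZMod N, ZMod.stdAddChar (v * z) * g v‖ ^ 2 : ℝ) : ℂ) =
      ((N * ∑ v, ‖g v‖ ^ 2 : ℝ) : ℂ) := by
    push_cast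
    have h2 := fun z => key z
    push_cast at h2
    simp_rw [h2]
    rw [Finset.sum_comm, Finset.mul_sum]
    refine Finset.sum_congr rfl fun v _ => ?_
    rw [Finset.sum_comm]
    simp_rw [← Finset.sum_mul, AddChar.sum_mulShift _ (ZMod.isPrimitive_stdAddChar N), sub_eq_zero]
    rw [Finset.sum_eq_single v]
    · rw [if_pos rfl, ZMod.card, Complex.mul_conj']
    · intro v' _ hne
      simp [Ne.symm hne]
    · simp
  exact_mod_cast this

/-- The Fourier transform of the `u`-th sector of an amplitude on the integers, the window of which
begins at `-N / 2`. -/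
noncomputable def sectorAmp (f : ℤ → ℂ) (u : ℤ) (z : ZMod N) : ℂ :=
  ∑ v : ZMod N, ZMod.stdAddChar (v * z) * f (N * u + v.val - (N / 2 : ℕ))

/-- The probability of the outcome `z` of a measurement after a Fourier transform over `ℤ / N ℤ`. -/
noncomputable def outcomeProb (f : ℤ → ℂ) (z : ZMod N) : ℝ :=
  (N : ℝ)⁻¹ * ∑' u : ℤ, ‖sectorAmp f u z‖ ^ 2

theorem outcomeProb_nonneg (f : ℤ → ℂ) (z : ZMod N) : 0 ≤ outcomeProb f z :=
  mul_nonneg (by positivity) (tsum_nonneg fun _ => by positivity)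

/-- The integers as pairs of a sector and a residue. -/
noncomputable def sectorEquiv (N : ℕ) [NeZero N] : ℤ × ZMod N ≃ ℤ where
  toFun y := N * y.1 + y.2.val - (N / 2 : ℕ)
  invFun j := ((j + (N / 2 : ℕ)) / N, ((j + (N / 2 : ℕ) : ℤ) : ZMod N))
  left_inv := by
    rintro ⟨u, v⟩
    have hv := ZMod.val_lt v
    have hN : (0 : ℤ) < N := by exact_mod_cast Nat.pos_of_ne_zero (NeZero.ne N)
    ext
    · simp only [sub_add_cancel]
      rw [Int.add_comm, Int.add_mul_ediv_left _ _ hN.ne', Int.ediv_eq_zero_of_lt (by positivity)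
        (by exact_mod_cast hv), zero_add]
    · simp
  right_inv := by
    intro j
    have h : ((((j + (N / 2 : ℕ) : ℤ) : ZMod N).val : ℕ) : ℤ) = (j + (N / 2 : ℕ)) % N :=
      ZMod.val_intCast _
    simp only
    rw [h, Int.mul_ediv_add_emod]
    ring

theorem sectorEquiv_apply (y : ℤ × ZMod N) :
    sectorEquiv N y = N * y.1 + y.2.val - (N / 2 : ℕ) := rfl

theorem summable_sector {f : ℤ → ℝ} (hf : Summable f) :
    Summable fun y : ℤ × ZMod N => f (N * y.1 + y.2.val - (N / 2 : ℕ)) := by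
  have := (sectorEquiv N).summable_iff.2 hf
  simpa only [Function.comp_def, sectorEquiv_apply] using this

/-- By Parseval a single frequency of a sector is at most `N` times the mass of that sector, and the
masses are summable. -/
theorem summable_sectorAmp {f : ℤ → ℂ} (hf : Summable fun j => ‖f j‖ ^ 2) (z : ZMod N) :
    Summable fun u => ‖sectorAmp f u z‖ ^ 2 := by
  have h1 : Summable fun y : ℤ × ZMod N => ‖f (N * y.1 + y.2.val - (N / 2 : ℕ))‖ ^ 2 :=
    summable_sector (f := fun j => ‖f j‖ ^ 2) hf
  refine (h1.prod.mul_left (N : ℝ)).of_nonneg_of_le (fun u => by positivity) fun u => ?_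
  rw [tsum_fintype, ← sum_norm_sq_dft]
  exact Finset.single_le_sum (f := fun z => ‖sectorAmp f u z‖ ^ 2) (fun _ _ => by positivity)
    (Finset.mem_univ z)

/-- Parseval in each sector, followed by the regrouping of `ℤ` into sectors. -/
theorem sum_outcomeProb {f : ℤ → ℂ} (hf : Summable fun j => ‖f j‖ ^ 2) :
    ∑ z : ZMod N, outcomeProb f z = ∑' j, ‖f j‖ ^ 2 := by
  have hN : (N : ℝ) ≠ 0 := by exact_mod_cast NeZero.ne N
  have h1 : Summable fun y : ℤ × ZMod N => ‖f (N * y.1 + y.2.val - (N / 2 : ℕ))‖ ^ 2 :=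
    summable_sector (f := fun j => ‖f j‖ ^ 2) hf
  have h2 : ∀ u, ∑ z : ZMod N, ‖sectorAmp f u z‖ ^ 2 =
      N * ∑' v : ZMod N, ‖f (N * u + v.val - (N / 2 : ℕ))‖ ^ 2 := by
    intro u
    rw [tsum_fintype, ← sum_norm_sq_dft]
    simp only [sectorAmp]
  have h3 : ∑' j, ‖f j‖ ^ 2 = ∑' u : ℤ, ∑' v : ZMod N, ‖f (N * u + v.val - (N / 2 : ℕ))‖ ^ 2 := by
    rw [← (sectorEquiv N).tsum_eq fun j => ‖f j‖ ^ 2]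
    simp only [sectorEquiv_apply]
    exact h1.tsum_prod
  simp only [outcomeProb]
  rw [h3, ← Finset.mul_sum, ← Summable.tsum_finsetSum fun z _ => summable_sectorAmp hf z]
  simp_rw [h2]
  rw [tsum_mul_left, inv_mul_cancel_left₀ hN]

/-- The distribution of the outcome for a basis state is uniform. -/
theorem outcomeProb_single (j : ℤ) (z : ZMod N) :
    outcomeProb (fun i => if i = j then 1 else 0) z = (N : ℝ)⁻¹ := by
  obtain ⟨⟨u, v⟩, rfl⟩ := (sectorEquiv N).surjective j
  have h : ∀ u' : ℤ, ‖sectorAmp (fun i => if i = sectorEquiv N (u, v) then 1 else 0) u' z‖ ^ 2 =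
      if u' = u then 1 else 0 := by
    intro u'
    have h2 : ∀ v' : ZMod N, ((N * u' + v'.val - (N / 2 : ℕ) : ℤ) = sectorEquiv N (u, v)) ↔
        u' = u ∧ v' = v := by
      intro v'
      rw [← Prod.mk.injEq, ← (sectorEquiv N).apply_eq_iff_eq, sectorEquiv_apply (u', v')]
    simp only [sectorAmp, h2]
    by_cases hu : u' = u
    · simp [hu]
    · simp [hu]
  rw [outcomeProb]
  simp [h]

end sector

open QMachine

/-! ### Norms of product states and of the measured blocks. -/

section norms
variable {n N l : ℕ}

/-- Residues are stored reduced and all further registers are `0`, so the blocks determine the whole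
array. -/
theorem goodIndex_ext {b b' : ℕ →₀ ℤ} (hb : GoodIndex n N l b) (hb' : GoodIndex n N l b')
    (h : ∀ k : Fin l, blockAt n N b k = blockAt n N b' k) : b = b' := by
  ext q
  by_cases hq : l * (n + 1) ≤ q
  · rw [hb.2 q hq, hb'.2 q hq]
  · have hk : q / (n + 1) < l := (Nat.div_lt_iff_lt_mul (by omega : 0 < n + 1)).2 (by omega)
    have hqe := Nat.div_add_mod q (n + 1)
    have hlt := Nat.mod_lt q (by omega : n + 1 > 0)
    rw [Nat.mul_comm] at hqe
    have h1 := h ⟨_, hk⟩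
    by_cases h0 : q % (n + 1) = 0
    · have := congrArg Prod.fst h1
      simp only [blockAt] at this
      rw [h0, add_zero] at hqe
      rwa [hqe] at this
    · have h2 := congrFun (congrArg Prod.snd h1) ⟨q % (n + 1) - 1, by omega⟩
      have e : q / (n + 1) * (n + 1) + 1 + (q % (n + 1) - 1) = q := by omega
      have g1 := hb.1 ⟨_, hk⟩ ⟨q % (n + 1) - 1, by omega⟩
      have g2 := hb'.1 ⟨_, hk⟩ ⟨q % (n + 1) - 1, by omega⟩
      simp only [blockAt] at h2
      simp only [e] at g1 g2 h2
      rw [ZMod.intCast_eq_intCast_iff, Int.ModEq, Int.emod_eq_of_lt g1.1 g1.2,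
        Int.emod_eq_of_lt g2.1 g2.2] at h2
      exact h2

variable [NeZero N]

/-- The basis state with given blocks. -/
noncomputable def indexOfBlocks (y : Fin l → ℤ × (Fin n → ZMod N)) : ℕ →₀ ℤ :=
  Finsupp.onFinset (Finset.range (l * (n + 1)))
    (fun q => if h : q / (n + 1) < l then
      if h' : q % (n + 1) = 0 then (y ⟨q / (n + 1), h⟩).1
      else (((y ⟨q / (n + 1), h⟩).2 ⟨q % (n + 1) - 1, by
        have := Nat.mod_lt q (by omega : n + 1 > 0)
        omega⟩).val : ℤ)
      else 0) (by
    intro q hq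
    rw [Finset.mem_range]
    by_contra hlt
    apply hq
    rw [dif_neg]
    rw [not_lt, Nat.le_div_iff_mul_le (by omega : 0 < n + 1)]
    omega)

theorem blockAt_indexOfBlocks (y : Fin l → ℤ × (Fin n → ZMod N)) (k : Fin l) :
    blockAt n N (indexOfBlocks y) k = y k := by
  have hk := k.2
  have h1 : (k : ℕ) * (n + 1) / (n + 1) = k := Nat.mul_div_cancel _ (by omega : 0 < n + 1)
  ext i
  · simp [blockAt, indexOfBlocks, h1, hk]
  · have hi := i.2
    have h2 : ((k : ℕ) * (n + 1) + 1 + i) / (n + 1) = k := by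
      rw [add_assoc, Nat.mul_comm, Nat.mul_add_div (by omega : 0 < n + 1), Nat.div_eq_of_lt (by omega),
        add_zero]
    have h3 : ((k : ℕ) * (n + 1) + 1 + i) % (n + 1) = 1 + i := by
      rw [add_assoc, Nat.mul_comm, Nat.mul_add_mod, Nat.mod_eq_of_lt (by omega)]
    simp [blockAt, indexOfBlocks, h2, h3, hk]

theorem goodIndex_indexOfBlocks (y : Fin l → ℤ × (Fin n → ZMod N)) :
    GoodIndex n N l (indexOfBlocks y) := by
  refine ⟨fun k i => ?_, fun q hq => ?_⟩
  · have hk := k.2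
    have hi := i.2
    have h2 : ((k : ℕ) * (n + 1) + 1 + i) / (n + 1) = k := by
      rw [add_assoc, Nat.mul_comm, Nat.mul_add_div (by omega : 0 < n + 1), Nat.div_eq_of_lt (by omega),
        add_zero]
    have h3 : ((k : ℕ) * (n + 1) + 1 + i) % (n + 1) = 1 + i := by
      rw [add_assoc, Nat.mul_comm, Nat.mul_add_mod, Nat.mod_eq_of_lt (by omega)]
    have h4 := ZMod.val_lt ((y k).2 i)
    have h5 : indexOfBlocks y (k * (n + 1) + 1 + i) = (((y k).2 i).val : ℤ) := by
      simp [indexOfBlocks, h2, h3, hk]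
    rw [h5]
    exact ⟨by positivity, by exact_mod_cast h4⟩
  · have : ¬ q / (n + 1) < l := by
      rw [not_lt, Nat.le_div_iff_mul_le (by omega : 0 < n + 1)]
      exact hq
    simp [indexOfBlocks, this]

/-- The good indices are in bijection with the tuples of block contents, and on them the squared
amplitude is a product over independent coordinates. -/
theorem tsum_norm_sq_loadStates (φ : Fin l → ℤ × (Fin n → ZMod N) → ℂ)
    (hφ : ∀ k, Summable fun y => ‖φ k y‖ ^ 2) :
    ∑' b, ‖loadStates φ b‖ ^ 2 = ∏ k, ∑' y, ‖φ k y‖ ^ 2 := by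
  have hinj : Function.Injective (indexOfBlocks (n := n) (N := N) (l := l)) := by
    intro y y' h
    funext k
    rw [← blockAt_indexOfBlocks y, h, blockAt_indexOfBlocks]
  have h := hasSum_pi_prod l (fun k y => ‖φ k y‖ ^ 2) (fun _ _ => by positivity) hφ
  refine HasSum.tsum_eq ((hinj.hasSum_iff ?_).1 (h.congr_fun fun y => ?_))
  · intro b hb
    rw [loadStates_of_not_good, norm_zero, zero_pow two_ne_zero]
    intro hg
    exact hb ⟨fun k => blockAt n N b k, goodIndex_ext (goodIndex_indexOfBlocks _) hg fun k => by
      rw [blockAt_indexOfBlocks]⟩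
  · rw [Function.comp_apply, loadStates_of_good (goodIndex_indexOfBlocks y), norm_prod,
      Finset.prod_pow]
    simp only [blockAt_indexOfBlocks]

theorem norm_stdAddChar (z : ZMod N) : ‖ZMod.stdAddChar z‖ = 1 := by
  rw [ZMod.stdAddChar_apply, Circle.norm_coe]

/-- With `j = N u + v - N / 2` the phase `⟨a, x + j σ⟩` splits into a part free of `v`, which the
norm discards, and `v ⟨a, σ⟩`. The latter merges with the phase `v b` of the second transform: the
block has been transformed at frequency `⟨a, σ⟩ + b`, and the shift `x` has disappeared. -/
theorem norm_doneBlock (a : Fin n → ZMod N) (b : ZMod N) (f : ℤ → ℂ) (σ x : Fin n → ZMod N)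
    (u : ℤ) :
    ‖doneBlock ((N / 2 : ℕ) : ℤ) a b f σ x (N * u + b.val, a)‖ ^ 2 =
      ((N : ℝ) ^ n)⁻¹ * ((N : ℝ)⁻¹ * ‖sectorAmp f u (a ⬝ᵥ σ + b)‖ ^ 2) := by
  have hN : (0 : ℤ) < N := by exact_mod_cast Nat.pos_of_ne_zero (NeZero.ne N)
  have hb := ZMod.val_lt b
  have hcast : ((N * u + b.val : ℤ) : ZMod N) = b := by simp
  have hdiv : (N * u + b.val : ℤ) / N = u := by
    rw [Int.add_comm, Int.add_mul_ediv_left _ _ hN.ne', Int.ediv_eq_zero_of_lt (by positivity)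
        (by exact_mod_cast hb), zero_add]
  have hterm : ∀ v : ZMod N, ZMod.stdAddChar (v * b) *
      partBlock n a f σ x (N * u + v.val - ((N / 2 : ℕ) : ℤ), a) =
      (((Real.sqrt N : ℝ) : ℂ)⁻¹ ^ n * ZMod.stdAddChar (a ⬝ᵥ x - ((N / 2 : ℕ) : ZMod N) * (a ⬝ᵥ σ))) *
        (ZMod.stdAddChar (v * (a ⬝ᵥ σ + b)) * f (N * u + v.val - ((N / 2 : ℕ) : ℤ))) := by
    intro v
    have hcond : a = fun i : Fin n => if (i : ℕ) < n then a i else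
        (x + (N * u + v.val - ((N / 2 : ℕ) : ℤ) : ℤ) • σ) i := by
      funext i
      simp
    have hsum : (∑ i : Fin n, if (i : ℕ) < n then
        a i * (x + (N * u + v.val - ((N / 2 : ℕ) : ℤ) : ℤ) • σ) i else 0) =
        (a ⬝ᵥ x - ((N / 2 : ℕ) : ZMod N) * (a ⬝ᵥ σ)) + v * (a ⬝ᵥ σ) := by
      simp only [Fin.is_lt, if_true, Pi.add_apply, Pi.smul_apply, dotProduct, Finset.mul_sum]
      simp only [zsmul_eq_mul]
      rw [← Finset.sum_sub_distrib, ← Finset.sum_add_distrib]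
      refine Finset.sum_congr rfl fun i _ => ?_
      simp only [Int.cast_sub, Int.cast_add, Int.cast_mul, Int.cast_natCast, CharP.cast_eq_zero,
        ZMod.natCast_zmod_val]
      ring
    rw [partBlock, if_pos hcond, hsum, AddChar.map_add_eq_mul, mul_add, AddChar.map_add_eq_mul]
    ring
  rw [doneBlock, if_pos hcast, headFourier]
  simp only [hdiv, hcast, hterm]
  rw [← Finset.mul_sum, norm_mul, norm_mul, norm_mul, norm_stdAddChar, norm_inv, norm_pow, norm_inv,
    Complex.norm_real, Real.norm_of_nonneg (Real.sqrt_nonneg _), mul_one, mul_pow, mul_pow, inv_pow,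
    Real.sq_sqrt (Nat.cast_nonneg N), inv_pow, inv_pow, ← pow_mul, mul_comm n 2, pow_mul,
    Real.sq_sqrt (Nat.cast_nonneg N), sectorAmp]
  ring

/-- After the measurements the block lives on the points `(N u + b, a)`, so only the quotient `u` is
left to sum over. -/
theorem hasSum_norm_sq_doneBlock (a : Fin n → ZMod N) (b : ZMod N) {f : ℤ → ℂ}
    (hf : Summable fun j => ‖f j‖ ^ 2) (σ x : Fin n → ZMod N) :
    HasSum (fun y => ‖doneBlock ((N / 2 : ℕ) : ℤ) a b f σ x y‖ ^ 2)
      (((N : ℝ) ^ n)⁻¹ * outcomeProb f (a ⬝ᵥ σ + b)) := by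
  have hN : (0 : ℤ) < N := by exact_mod_cast Nat.pos_of_ne_zero (NeZero.ne N)
  have hinj : Function.Injective fun u : ℤ => ((N * u + b.val : ℤ), a) := by
    intro u u' h
    have h1 := congrArg Prod.fst h
    simp only at h1
    exact mul_left_cancel₀ hN.ne' (by linarith)
  rw [← hinj.hasSum_iff]
  · simp only [Function.comp_def, norm_doneBlock]
    exact ((summable_sectorAmp hf _).hasSum.mul_left _).mul_left _
  · rintro ⟨j, c⟩ hy
    have : doneBlock ((N / 2 : ℕ) : ℤ) a b f σ x (j, c) = 0 := by
      rw [doneBlock]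
      split_ifs with hj
      · have hca : c ≠ a := by
          rintro rfl
          refine hy ⟨j / N, ?_⟩
          simp only at hj
          ext
          · simp only
            rw [← hj, ZMod.val_intCast, Int.mul_ediv_add_emod]
          · rfl
        rw [headFourier, Finset.sum_eq_zero, mul_zero]
        intro v _
        rw [partBlock, if_neg, mul_zero]
        intro h
        apply hca
        simp only at h
        rw [h]
        funext i
        simp
      · rfl
    rw [this, norm_zero, zero_pow two_ne_zero]

end norms

namespace QMachine

theorem Branches.acceptProb_eq {E : Env} {D m : ℕ} {c : Cmd} {s : Config} {ι : Type} [Fintype ι]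
    {P : ι → Config → Prop} (h : Branches E D c s ι m P) {F : ι → ℝ}
    (hF : ∀ i s', P i s' → (if s'.mem 0 = 1 then s'.weight else 0) = F i) :
    acceptProb E c s = ∑ i, F i := by
  obtain ⟨g, h1, h2⟩ := h
  rw [acceptProb, ← Multiset.sum_coe, ← Multiset.map_coe, h1, Multiset.map_map]
  exact Finset.sum_congr rfl fun i _ => hF i _ (h2 i).2

theorem Branches.time_le {E : Env} {D m : ℕ} {c : Cmd} {s : Config} {ι : Type} [Fintype ι]
    {P : ι → Config → Prop} (h : Branches E D c s ι m P) {s' : Config} (hs : s' ∈ run E c s) :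
    s'.time ≤ s.time + m * D := by
  obtain ⟨g, h1, h2⟩ := h
  have : s' ∈ (↑(run E c s) : Multiset Config) := hs
  rw [h1, Multiset.mem_map] at this
  obtain ⟨i, -, rfl⟩ := this
  exact (h2 i).1

end QMachine

/-! ### The acceptance probability as a sum over laws of samples. -/

section accept
variable (p : EDCPParams) (κ : ℕ)

/-- `Fin N` is `ZMod N`. -/
noncomputable def finEquivZMod (N : ℕ) [NeZero N] : Fin N ≃ ZMod N where
  toFun v := ((v : ℕ) : ZMod N)
  invFun z := ⟨z.val, ZMod.val_lt z⟩
  left_inv v := by ext; simp [ZMod.val_cast_of_lt v.2]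
  right_inv z := by simp

theorem finEquivZMod_apply (N : ℕ) [NeZero N] (v : Fin N) :
    finEquivZMod N v = ((v : ℕ) : ZMod N) := rfl

/-- The distribution of the residue of the result of the rejection sampler. -/
noncomputable def noiseLaw (y : ZMod p.N) : ℝ :=
  (Fintype.card (Fin (κ * κ) → NoiseChoice p κ) : ℝ)⁻¹ *
    ∑ ω : Fin (κ * κ) → NoiseChoice p κ,
      if ((noiseVal p κ (κ * κ) ω : ℤ) : ZMod p.N) = y then 1 else 0

/-- The distribution of the sample that is computed from a block. -/
noncomputable def blockLaw (f : ℤ → ℂ) (σ S : Fin p.n → ZMod p.N)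
    (y : (Fin p.n → ZMod p.N) × ZMod p.N) : ℝ :=
  ((p.N : ℝ) ^ p.n)⁻¹ * ∑ b : ZMod p.N,
    outcomeProb f (y.1 ⬝ᵥ σ + b) * noiseLaw p κ (y.2 + b - y.1 ⬝ᵥ S)

/-- The amplitudes of the sampler encode the uniform distribution on its choices. -/
theorem norm_sq_noiseAmp : ‖noiseAmp p κ‖ ^ 2 = (Fintype.card (NoiseChoice p κ) : ℝ)⁻¹ := by
  rw [noiseAmp, norm_mul, norm_inv, norm_inv, Complex.norm_real, Complex.norm_real,
    Real.norm_of_nonneg (Real.sqrt_nonneg _), Real.norm_of_nonneg (Real.sqrt_nonneg _), mul_pow,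
    inv_pow, inv_pow, Real.sq_sqrt (Nat.cast_nonneg _), Real.sq_sqrt (Nat.cast_nonneg _),
    Fintype.card_prod, Fintype.card_fin, Fintype.card_fin, Nat.cast_mul, mul_inv]

/-- The vector part of a sample determines the measured residues. Given these and `b`, the scalar
part `c` fixes the noise residue as `c + b - ⟨a, S⟩`, which leaves a sum over `b` weighted by the
law of the noise. -/
theorem sum_blockOutcome (f : ℤ → ℂ) (σ : Fin p.n → ZMod p.N) (S : Fin p.n → Fin p.N)
    (y : (Fin p.n → ZMod p.N) × ZMod p.N) :
    ∑ w : BlockOutcome p κ, (if ((fun j => ((w.1 j : ℕ) : ZMod p.N)),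
        (sampleVal p κ S w : ZMod p.N)) = y then
      (Fintype.card (Fin (κ * κ) → NoiseChoice p κ) : ℝ)⁻¹ * (((p.N : ℝ) ^ p.n)⁻¹ *
        outcomeProb f ((fun i : Fin p.n => extWord w.1 i) ⬝ᵥ σ + ((w.2.2 : ℕ) : ZMod p.N))) else 0) =
      blockLaw p κ f σ (fun i => ((S i : ℕ) : ZMod p.N)) y := by
  obtain ⟨a, c⟩ := y
  have hext : ∀ w : Fin p.n → Fin p.N, (fun i : Fin p.n => extWord w i) =
      fun j => ((w j : ℕ) : ZMod p.N) := by
    intro w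
    funext i
    simp [extWord]
  rw [Fintype.sum_prod_type, ← (Equiv.piCongrRight fun _ : Fin p.n => finEquivZMod p.N).symm.sum_comp,
    Finset.sum_eq_single a]
  · have ha : ∀ j, ((((Equiv.piCongrRight fun _ : Fin p.n => finEquivZMod p.N).symm a) j : ℕ) :
        ZMod p.N) = a j := by
      intro j
      rw [← finEquivZMod_apply]
      simp
    rw [Fintype.sum_prod_type, Finset.sum_comm, ← (finEquivZMod p.N).symm.sum_comp, blockLaw,
      Finset.mul_sum]
    refine Finset.sum_congr rfl fun b _ => ?_
    have hb : ((((finEquivZMod p.N).symm b : Fin p.N) : ℕ) : ZMod p.N) = b := by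
      rw [← finEquivZMod_apply]
      simp
    simp only [hext, ha, hb, sampleVal, noiseLaw]
    simp only [Finset.mul_sum]
    refine Finset.sum_congr rfl fun ω _ => ?_
    have hiff : ((a, ((∑ i, ((((Equiv.piCongrRight fun _ : Fin p.n => finEquivZMod p.N).symm a) i : ℕ) : ℤ) *
        ((S i : ℕ) : ℤ) - (((finEquivZMod p.N).symm b : ℕ) : ℤ) + noiseVal p κ (κ * κ) ω : ℤ) :
        ZMod p.N)) = (a, c)) ↔
        ((noiseVal p κ (κ * κ) ω : ℤ) : ZMod p.N) = c + b - a ⬝ᵥ fun i => ((S i : ℕ) : ZMod p.N) := by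
      rw [Prod.mk.injEq]
      push_cast
      simp only [ha, hb, true_and, dotProduct]
      constructor
      · intro h
        rw [← h]
        ring
      · intro h
        rw [h]
        ring
    simp only [hiff]
    split_ifs
    · ring
    · simp
  · intro a' _ hne
    refine Finset.sum_eq_zero fun w _ => if_neg fun h => hne ?_
    have := congrArg Prod.fst h
    simp only at this
    rw [← this]
    funext j
    rw [← finEquivZMod_apply]
    simp
  · simp

/-- Branch weights factor over the blocks and depend on the outcomes only through independent
blockwise terms, so pushing them forward to samples yields a product law for each secret `S`. -/
theorem acceptProb_reduction {X : ℕ} (hX : Fits p κ X)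
    (A : LWESamples p.n p.N p.l → unitInterval) (f : Fin p.l → ℤ → ℂ)
    (hf : ∀ k, Summable fun j => ‖f k j‖ ^ 2) (σ : Fin p.n → ZMod p.N)
    (x : Fin p.l → Fin p.n → ZMod p.N) :
    acceptProb (p.env A) reduction (p.start κ (loadStates fun k => cosetBlock (f k) σ (x k))) =
      ((p.N : ℝ) ^ p.n)⁻¹ * ∑ S : Fin p.n → ZMod p.N, ∑ y : LWESamples p.n p.N p.l,
        (∏ k, blockLaw p κ (f k) σ S (y k)) * (A y : ℝ) := by
  rw [(branches_reduction hX A f σ x).acceptProb_eq (F := fun i => if i.2.2 then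
    (A fun k => (fun j => ((i.2.1 k).1 j : ℕ), (sampleVal p κ i.1 (i.2.1 k) : ZMod p.N)) : ℝ) *
      (((p.N : ℝ) ^ p.n)⁻¹ * ∏ k, ((Fintype.card (Fin (κ * κ) → NoiseChoice p κ) : ℝ)⁻¹ *
        (((p.N : ℝ) ^ p.n)⁻¹ * outcomeProb (f k) ((fun j : Fin p.n => extWord (i.2.1 k).1 j) ⬝ᵥ σ +
          (((i.2.1 k).2.2 : ℕ) : ZMod p.N))))) else 0)]
  · rw [Fintype.sum_prod_type, Finset.mul_sum,
      ← (Equiv.piCongrRight fun _ : Fin p.n => finEquivZMod p.N).sum_comp]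
    refine Finset.sum_congr rfl fun S _ => ?_
    rw [Fintype.sum_prod_type]
    simp only [Fintype.sum_bool, if_true, Bool.false_eq_true, if_false, add_zero]
    have h := sum_prod_pushforward (fun k (w : BlockOutcome p κ) =>
      (Fintype.card (Fin (κ * κ) → NoiseChoice p κ) : ℝ)⁻¹ * (((p.N : ℝ) ^ p.n)⁻¹ *
        outcomeProb (f k) ((fun i : Fin p.n => extWord w.1 i) ⬝ᵥ σ + ((w.2.2 : ℕ) : ZMod p.N))))
      (fun w : BlockOutcome p κ => ((fun j => ((w.1 j : ℕ) : ZMod p.N)),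
        (sampleVal p κ S w : ZMod p.N))) (fun y => (A y : ℝ))
    simp only [sum_blockOutcome] at h
    refine Eq.trans ?_ (congrArg (((p.N : ℝ) ^ p.n)⁻¹ * ·) h)
    rw [Finset.mul_sum]
    exact Finset.sum_congr rfl fun w _ => by ring
  · rintro ⟨S, w, b⟩ s' ⟨h0, h1⟩
    cases b
    · simp [h0]
    · simp only [if_true] at h0 h1 ⊢
      rw [if_pos h0, Config.weight, h1]
      simp only [Pi.smul_apply, smul_eq_mul, norm_mul, mul_pow]
      have hblock : ∀ k, HasSum (fun y => ‖outStates p κ f σ x w k y‖ ^ 2) (((p.N : ℝ) ^ p.n)⁻¹ *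
          outcomeProb (f k) ((fun j : Fin p.n => extWord (w k).1 j) ⬝ᵥ σ +
            (((w k).2.2 : ℕ) : ZMod p.N))) := by
        intro k
        simp only [outStates, k.2, dif_pos]
        exact hasSum_norm_sq_doneBlock _ _ (hf k) σ (x k)
      have hΩ : ‖(noiseAmp p κ ^ (κ * κ)) ^ p.l‖ ^ 2 =
          ((Fintype.card (Fin (κ * κ) → NoiseChoice p κ) : ℝ)⁻¹) ^ p.l := by
        rw [norm_pow, norm_pow, Fintype.card_fun, Fintype.card_fin, Nat.cast_pow, ← inv_pow,
          ← norm_sq_noiseAmp]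
        ring
      have hN : ‖((Real.sqrt p.N : ℝ) : ℂ)⁻¹ ^ p.n‖ ^ 2 = ((p.N : ℝ) ^ p.n)⁻¹ := by
        rw [norm_pow, norm_inv, Complex.norm_real, Real.norm_of_nonneg (Real.sqrt_nonneg _),
          ← pow_mul, mul_comm, pow_mul, inv_pow, Real.sq_sqrt (Nat.cast_nonneg _), inv_pow]
      rw [tsum_mul_left, tsum_norm_sq_loadStates _ fun k => (hblock k).summable, Complex.norm_real,
        Real.norm_of_nonneg (Real.sqrt_nonneg _), Real.sq_sqrt (A _).2.1, hΩ, hN,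
        Finset.prod_mul_distrib, Finset.prod_const, Finset.card_univ, Fintype.card_fin]
      simp only [fun k => (hblock k).tsum_eq]
      ring

end accept

open QMachine

/-! ### Laws of LWE samples on residues. -/

section laws
variable {N : ℕ}

/-- The weight on `ℤ / N ℤ` that is induced by a weight on `ℤ`. -/
noncomputable def wrap (μ : ℤ → ℝ) (y : ZMod N) : ℝ := ∑' e : ℤ, if (e : ZMod N) = y then μ e else 0

theorem wrap_nonneg {μ : ℤ → ℝ} (h0 : ∀ e, 0 ≤ μ e) (y : ZMod N) : 0 ≤ wrap μ y :=
  tsum_nonneg fun e => by split_ifs; exacts [h0 e, le_rfl]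

theorem summable_ite {ι : Type*} {μ : ι → ℝ} (h : Summable μ) (P : ι → Prop) [DecidablePred P] :
    Summable fun e => if P e then μ e else 0 := by
  refine (h.indicator {e | P e}).congr fun e => ?_
  simp [Set.indicator_apply]

variable [NeZero N]

theorem sum_wrap {μ : ℤ → ℝ} (h : Summable μ) : ∑ y : ZMod N, wrap μ y = ∑' e, μ e := by
  simp only [wrap]
  rw [← Summable.tsum_finsetSum fun y _ => summable_ite h _]
  exact tsum_congr fun e => by simp

/-- The law of the difference of two residues. -/
noncomputable def diffLaw (P ν : ZMod N → ℝ) (y : ZMod N) : ℝ := ∑ z, P z * ν (y + z)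

theorem sum_diffLaw (P ν : ZMod N → ℝ) : ∑ y, diffLaw P ν y = (∑ z, P z) * ∑ y, ν y := by
  simp only [diffLaw]
  rw [Finset.sum_comm, Finset.sum_mul]
  refine Finset.sum_congr rfl fun z _ => ?_
  rw [← Finset.mul_sum, ← Equiv.sum_comp (Equiv.addRight z) ν]
  rfl

theorem diffLaw_nonneg {P ν : ZMod N → ℝ} (hP : ∀ z, 0 ≤ P z) (hν : ∀ z, 0 ≤ ν z) (y : ZMod N) :
    0 ≤ diffLaw P ν y := Finset.sum_nonneg fun z _ => mul_nonneg (hP z) (hν _)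

/-- A law of samples `(a, ⟨a, s⟩ + e)`. -/
noncomputable def sampleLaw {n : ℕ} (χ : ZMod N → ℝ) (s : Fin n → ZMod N)
    (y : (Fin n → ZMod N) × ZMod N) : ℝ :=
  ((N : ℝ) ^ n)⁻¹ * χ (y.2 - y.1 ⬝ᵥ s)

theorem sum_sampleLaw {n : ℕ} (χ : ZMod N → ℝ) (s : Fin n → ZMod N) :
    ∑ y, sampleLaw χ s y = ∑ z, χ z := by
  have hN : (N : ℝ) ≠ 0 := by exact_mod_cast NeZero.ne N
  simp only [sampleLaw]
  rw [← Finset.mul_sum, Fintype.sum_prod_type]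
  have : ∀ a : Fin n → ZMod N, ∑ c, χ (c - a ⬝ᵥ s) = ∑ z, χ z := fun a =>
    (Equiv.subRight (a ⬝ᵥ s)).sum_comp χ
  simp only [this, Finset.sum_const, Finset.card_univ, Fintype.card_fun, ZMod.card, Fintype.card_fin,
    nsmul_eq_mul, Nat.cast_pow]
  rw [inv_mul_cancel_left₀ (pow_ne_zero _ hN)]

/-- Only the residues of the errors reach the algorithm, so the error law may be wrapped modulo `N`;
for a given secret the samples are then independent with one common law. -/
theorem lweAccept_eq {n l : ℕ} {χ : ℤ → ℝ} (h0 : ∀ e, 0 ≤ χ e) (hs : Summable χ)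
    (A : LWESamples n N l → unitInterval) :
    lweAccept χ A = ((N : ℝ) ^ n)⁻¹ * ∑ s : Fin n → ZMod N, ∑ y : LWESamples n N l,
      (∏ k, sampleLaw (wrap χ) s (y k)) * (A y : ℝ) := by
  rw [lweAccept]
  congr 1
  refine Finset.sum_congr rfl fun s _ => ?_
  rw [← (Equiv.arrowProdEquivProdArrow (Fin l) (fun _ => Fin n → ZMod N) (fun _ => ZMod N)).symm.sum_comp,
    Fintype.sum_prod_type, Finset.mul_sum]
  refine Finset.sum_congr rfl fun a _ => ?_
  rw [tsum_prod_pushforward (fun _ => χ) (fun _ => h0) (fun _ => hs)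
    (fun k e => a k ⬝ᵥ s + (e : ZMod N)) (fun c => (A fun k => (a k, c k) : ℝ)), Finset.mul_sum]
  refine Finset.sum_congr rfl fun c _ => ?_
  rw [← mul_assoc]
  congr 1
  simp only [sampleLaw, Equiv.arrowProdEquivProdArrow, Equiv.coe_fn_symm_mk]
  rw [Finset.prod_mul_distrib, Finset.prod_const, Finset.card_univ, Fintype.card_fin, inv_pow,
    ← pow_mul]
  congr 1
  refine Finset.prod_congr rfl fun k _ => tsum_congr fun e => ?_
  simp only [eq_sub_iff_add_eq']

theorem uniformAccept_eq {n l : ℕ} (A : LWESamples n N l → unitInterval) :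
    uniformAccept A = ∑ y : LWESamples n N l, (∏ _k : Fin l, ((N : ℝ) ^ (n + 1))⁻¹) * (A y : ℝ) := by
  rw [uniformAccept, Finset.prod_const, Finset.card_univ, Fintype.card_fin, inv_pow, ← pow_mul,
    Finset.mul_sum]

end laws

/-! ### Comparison of the acceptance probabilities with those of the oracle. -/

section compare
variable (p : EDCPParams) (κ : ℕ)

theorem noiseLaw_nonneg (y : ZMod p.N) : 0 ≤ noiseLaw p κ y :=
  mul_nonneg (by positivity) (Finset.sum_nonneg fun _ _ => by split_ifs <;> norm_num)

theorem sum_noiseLaw : ∑ y, noiseLaw p κ y = 1 := by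
  have : Nonempty (NoiseChoice p κ) := ⟨0, ⟨0, noisePrec_pos κ⟩⟩
  simp only [noiseLaw]
  rw [← Finset.mul_sum, Finset.sum_comm]
  simp only [Finset.sum_ite_eq, Finset.mem_univ, if_true, Finset.sum_const, Finset.card_univ,
    nsmul_eq_mul, mul_one]
  exact inv_mul_cancel₀ (by exact_mod_cast Fintype.card_ne_zero)

/-- Substituting `z = ⟨a, σ⟩ + b` makes the noise residue equal to `c - ⟨a, σ + S⟩ + z`: the sample
has secret `σ + S` and error noise minus `z`. -/
theorem blockLaw_eq (f : ℤ → ℂ) (σ S : Fin p.n → ZMod p.N) :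
    blockLaw p κ f σ S = sampleLaw (diffLaw (outcomeProb f) (noiseLaw p κ)) (σ + S) := by
  funext ⟨a, c⟩
  simp only [blockLaw, sampleLaw, diffLaw]
  congr 1
  rw [← Equiv.sum_comp (Equiv.addLeft (a ⬝ᵥ σ)) fun z =>
    outcomeProb f z * noiseLaw p κ (c - a ⬝ᵥ (σ + S) + z)]
  refine Finset.sum_congr rfl fun b _ => ?_
  rw [Equiv.coe_addLeft, dotProduct_add]
  congr 2
  ring

theorem blockLaw_single (j : ℤ) (σ S : Fin p.n → ZMod p.N)
    (y : (Fin p.n → ZMod p.N) × ZMod p.N) :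
    blockLaw p κ (fun i => if i = j then 1 else 0) σ S y = ((p.N : ℝ) ^ (p.n + 1))⁻¹ := by
  simp only [blockLaw, outcomeProb_single]
  rw [← Finset.mul_sum]
  have : ∑ b, noiseLaw p κ (y.2 + b - y.1 ⬝ᵥ S) = 1 := by
    rw [← sum_noiseLaw p κ, ← Equiv.sum_comp (Equiv.addLeft (y.2 - y.1 ⬝ᵥ S)) (noiseLaw p κ)]
    exact Finset.sum_congr rfl fun b _ => by rw [Equiv.coe_addLeft]; congr 1; ring
  rw [this, mul_one, pow_succ, mul_inv]

theorem basisState_eq {n N : ℕ} (j : ℤ) (x : Fin n → ZMod N) :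
    basisState j x = cosetBlock (fun i => if i = j then 1 else 0) 0 x := by
  funext ⟨i, y⟩
  simp only [basisState, cosetBlock, smul_zero, add_zero, Prod.mk.injEq]
  by_cases h1 : i = j <;> by_cases h2 : y = x <;> simp [h1, h2]

theorem edcpState_eq {n N : ℕ} (D : ℤ → ℝ) (s x : Fin n → ZMod N) :
    edcpState D s x = cosetBlock (fun j => ((D j / Real.sqrt (∑' i : ℤ, D i ^ 2) : ℝ) : ℂ)) s x := rfl

/-- The outcome of the final transform of a point mass is uniform whatever `j`, `x` and `S` are, so
the simulation of uniform samples is exact for each basis state separately. -/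
theorem acceptProb_basisInput {X : ℕ} (hX : Fits p κ X)
    (A : LWESamples p.n p.N p.l → unitInterval) (j : Fin p.l → ℤ)
    (x : Fin p.l → Fin p.n → ZMod p.N) :
    acceptProb (p.env A) reduction (p.start κ (p.basisInput j x)) = uniformAccept A := by
  have hN : (p.N : ℝ) ≠ 0 := by exact_mod_cast NeZero.ne p.N
  have hb : p.basisInput j x =
      loadStates fun k => cosetBlock (fun i => if i = j k then (1 : ℂ) else 0) 0 (x k) := by
    simp only [EDCPParams.basisInput, basisState_eq]
  rw [hb, acceptProb_reduction p κ hX A _ (fun k => ?_), uniformAccept_eq]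
  · simp only [blockLaw_single, Finset.sum_const, Finset.card_univ, Fintype.card_fun, ZMod.card,
      Fintype.card_fin, nsmul_eq_mul, Nat.cast_pow]
    rw [inv_mul_cancel_left₀ (pow_ne_zero _ hN)]
  · refine summable_of_ne_finset_zero (s := {j k}) fun i hi => ?_
    simp at hi
    simp [hi]

theorem randomAccept_eq {X : ℕ} (hX : Fits p κ X) (A : LWESamples p.n p.N p.l → unitInterval)
    (h1 : HasSum (squareDist (discreteGaussian p.r)) 1) :
    p.randomAccept κ reduction A = uniformAccept A := by
  have hN : (p.N : ℝ) ≠ 0 := by exact_mod_cast NeZero.ne p.N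
  have h0 : ∀ j, 0 ≤ squareDist (discreteGaussian p.r) j := fun j =>
    div_nonneg (sq_nonneg _) (tsum_nonneg fun _ => sq_nonneg _)
  have h2 := hasSum_pi_prod p.l (fun _ => squareDist (discreteGaussian p.r)) (fun _ => h0)
    fun _ => h1.summable
  rw [EDCPParams.randomAccept]
  simp only [acceptProb_basisInput p κ hX, tsum_mul_right, h2.tsum_eq, h1.tsum_eq,
    Finset.prod_const_one, one_mul, Finset.sum_const, Finset.card_univ, Fintype.card_fun, ZMod.card,
    Fintype.card_fin, nsmul_eq_mul, Nat.cast_pow]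
  rw [← pow_mul, inv_mul_cancel_left₀ (pow_ne_zero _ hN)]

/-- Translation by `σ` permutes the uniform secrets `S`, and `x` has already dropped out; this gives
the conclusion for every secret and all shifts rather than on average. -/
theorem edcpAccept_eq {X : ℕ} (hX : Fits p κ X) (A : LWESamples p.n p.N p.l → unitInterval)
    {f : ℤ → ℂ} (hf : f = fun j => ((discreteGaussian p.r j /
      Real.sqrt (∑' i : ℤ, discreteGaussian p.r i ^ 2) : ℝ) : ℂ))
    (hs : Summable fun j => ‖f j‖ ^ 2) (σ : Fin p.n → ZMod p.N)
    (x : Fin p.l → Fin p.n → ZMod p.N) :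
    p.edcpAccept κ reduction A σ x =
      ((p.N : ℝ) ^ p.n)⁻¹ * ∑ s : Fin p.n → ZMod p.N, ∑ y : LWESamples p.n p.N p.l,
        (∏ k, sampleLaw (diffLaw (outcomeProb f) (noiseLaw p κ)) s (y k)) * (A y : ℝ) := by
  rw [EDCPParams.edcpAccept, EDCPParams.edcpInput]
  simp only [edcpState_eq, ← hf]
  rw [acceptProb_reduction p κ hX A (fun _ => f) (fun _ => hs), ← Equiv.sum_comp (Equiv.addLeft σ) (fun s => ∑ y : LWESamples p.n p.N p.l,
    (∏ k, sampleLaw (diffLaw (outcomeProb f) (noiseLaw p κ)) s (y k)) * (A y : ℝ))]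
  simp only [blockLaw_eq, Equiv.coe_addLeft]

/-- The acceptance function lies in `[0, 1]`, so the `ℓ¹` distance of the product laws is a bound,
and the hybrid argument reduces it to `ℓ` times the distance of the error laws. -/
theorem abs_edcpAccept_sub_lweAccept_le {X : ℕ} (hX : Fits p κ X)
    (A : LWESamples p.n p.N p.l → unitInterval)
    {f : ℤ → ℂ} (hf : f = fun j => ((discreteGaussian p.r j /
      Real.sqrt (∑' i : ℤ, discreteGaussian p.r i ^ 2) : ℝ) : ℂ))
    (hs : HasSum (fun j => ‖f j‖ ^ 2) 1) {χ : ℤ → ℝ} (h0 : ∀ e, 0 ≤ χ e) (hχ : HasSum χ 1) {δ : ℝ}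
    (hδ : ∑ y : ZMod p.N, |diffLaw (outcomeProb f) (noiseLaw p κ) y - wrap χ y| ≤ δ)
    (σ : Fin p.n → ZMod p.N) (x : Fin p.l → Fin p.n → ZMod p.N) :
    |p.edcpAccept κ reduction A σ x - lweAccept χ A| ≤ p.l * δ := by
  have hN : (p.N : ℝ) ≠ 0 := by exact_mod_cast NeZero.ne p.N
  have hN0 : (0 : ℝ) < (p.N : ℝ) ^ p.n := by
    have := p.two_le_N
    positivity
  rw [edcpAccept_eq p κ hX A hf hs.summable, lweAccept_eq h0 hχ.summable, ← mul_sub,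
    ← Finset.sum_sub_distrib, abs_mul, abs_of_pos (inv_pos.2 hN0), inv_mul_le_iff₀ hN0]
  refine (Finset.abs_sum_le_sum_abs _ _).trans ?_
  have key : ∀ s : Fin p.n → ZMod p.N,
      |∑ y : LWESamples p.n p.N p.l,
        (∏ k, sampleLaw (diffLaw (outcomeProb f) (noiseLaw p κ)) s (y k)) * (A y : ℝ) -
      ∑ y : LWESamples p.n p.N p.l, (∏ k, sampleLaw (wrap χ) s (y k)) * (A y : ℝ)| ≤ p.l * δ := by
    intro s
    rw [← Finset.sum_sub_distrib]
    refine (Finset.abs_sum_le_sum_abs _ _).trans ?_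
    calc ∑ y : LWESamples p.n p.N p.l,
          |(∏ k, sampleLaw (diffLaw (outcomeProb f) (noiseLaw p κ)) s (y k)) * (A y : ℝ) -
            (∏ k, sampleLaw (wrap χ) s (y k)) * (A y : ℝ)|
        ≤ ∑ y : LWESamples p.n p.N p.l,
          |∏ k, sampleLaw (diffLaw (outcomeProb f) (noiseLaw p κ)) s (y k) -
            ∏ k, sampleLaw (wrap χ) s (y k)| := by
          refine Finset.sum_le_sum fun y _ => ?_
          rw [← sub_mul, abs_mul, abs_of_nonneg (A y).2.1]
          exact mul_le_of_le_one_right (abs_nonneg _) (A y).2.2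
      _ ≤ ∑ _k : Fin p.l, ∑ y, |sampleLaw (diffLaw (outcomeProb f) (noiseLaw p κ)) s y -
            sampleLaw (wrap χ) s y| := by
          refine sum_abs_prod_sub_prod_le
            (fun _ => sampleLaw (diffLaw (outcomeProb f) (noiseLaw p κ)) s)
            (fun _ => sampleLaw (wrap χ) s) (fun _ y => ?_) (fun _ y => ?_) (fun _ => ?_)
            (fun _ => ?_)
          · exact mul_nonneg (inv_pos.2 hN0).le
              (diffLaw_nonneg (outcomeProb_nonneg f) (noiseLaw_nonneg p κ) _)
          · exact mul_nonneg (inv_pos.2 hN0).le (wrap_nonneg h0 _)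
          · rw [sum_sampleLaw, sum_diffLaw, sum_outcomeProb hs.summable, hs.tsum_eq, sum_noiseLaw,
              one_mul]
          · rw [sum_sampleLaw, sum_wrap hχ.summable, hχ.tsum_eq]
      _ ≤ ∑ _k : Fin p.l, δ := by
          refine Finset.sum_le_sum fun _ _ => le_trans (le_of_eq ?_) hδ
          rw [← sum_sampleLaw _ s]
          refine Finset.sum_congr rfl fun y _ => ?_
          simp only [sampleLaw]
          rw [← mul_sub, abs_mul, abs_of_pos (inv_pos.2 hN0)]
      _ = p.l * δ := by simp
  refine (Finset.sum_le_sum fun s _ => key s).trans (le_of_eq ?_)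
  simp only [Finset.sum_const, Finset.card_univ, Fintype.card_fun, ZMod.card, Fintype.card_fin,
    nsmul_eq_mul, Nat.cast_pow]

end compare

/-! ### Sums of Gaussians -/

section gauss

/-- The Gaussian `exp (-π a x²)`. -/
noncomputable def gauss (a x : ℝ) : ℝ := Real.exp (-(Real.pi * (a * x ^ 2)))

theorem gauss_pos (a x : ℝ) : 0 < gauss a x := Real.exp_pos _

theorem gauss_le_gauss {a b x y : ℝ} (h : a * x ^ 2 ≤ b * y ^ 2) : gauss b y ≤ gauss a x :=
  Real.exp_le_exp.2 (neg_le_neg (mul_le_mul_of_nonneg_left h Real.pi_pos.le))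

theorem gauss_mul_gauss (a b x y : ℝ) :
    gauss a x * gauss b y = Real.exp (-(Real.pi * (a * x ^ 2 + b * y ^ 2))) := by
  rw [gauss, gauss, ← Real.exp_add]
  ring_nf

theorem gauss_le_mul {a b c x y z : ℝ} (h : a * x ^ 2 + b * y ^ 2 ≤ c * z ^ 2) :
    gauss c z ≤ gauss a x * gauss b y := by
  rw [gauss_mul_gauss]
  exact Real.exp_le_exp.2 (neg_le_neg (mul_le_mul_of_nonneg_left h Real.pi_pos.le))

theorem gauss_sq (a x : ℝ) : gauss a x ^ 2 = gauss (2 * a) x := by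
  rw [sq, gauss_mul_gauss, gauss]
  ring_nf

theorem gauss_zero_right (a : ℝ) : gauss a 0 = 1 := by simp [gauss]

theorem gauss_le_one {a : ℝ} (ha : 0 ≤ a) (x : ℝ) : gauss a x ≤ 1 := by
  rw [← gauss_zero_right a]
  exact gauss_le_gauss (by nlinarith [sq_nonneg x, mul_nonneg ha (sq_nonneg x)])

theorem summable_gauss_add {a : ℝ} (ha : 0 < a) (t : ℝ) : Summable fun n : ℤ => gauss a (n + t) := by
  refine (HurwitzKernelBounds.summable_f_int 0 t ha).congr fun n => ?_
  rw [HurwitzKernelBounds.f_int, gauss, pow_zero, one_mul]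
  ring_nf

theorem summable_gauss {a : ℝ} (ha : 0 < a) : Summable fun n : ℤ => gauss a n := by
  simpa using summable_gauss_add ha 0

/-- The theta series `∑_n exp (-π a n²)`. -/
noncomputable def theta (a : ℝ) : ℝ := ∑' n : ℤ, gauss a n

/-- Poisson summation in the form of the Jacobi transformation; the change of sign of `n` turns the
shift `-t` into `+t`. -/
theorem tsum_exp_mul_gauss {a : ℝ} (ha : 0 < a) (t : ℝ) :
    ∑' n : ℤ, Complex.exp (2 * Real.pi * Complex.I * n * t) * (gauss a n : ℂ) =
      (((Real.sqrt a)⁻¹ * ∑' n : ℤ, gauss a⁻¹ (n + t) : ℝ) : ℂ) := by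
  have h := Complex.tsum_exp_neg_quadratic (a := a) (by simpa using ha) (Complex.I * t)
  have hs : ((a : ℂ)) ^ (1 / 2 : ℂ) = ((Real.sqrt a : ℝ) : ℂ) := by
    rw [Real.sqrt_eq_rpow, Complex.ofReal_cpow ha.le]
    norm_num
  rw [hs, ← (Equiv.neg ℤ).tsum_eq fun n : ℤ => Complex.exp (-Real.pi / a * (n + _) ^ 2)] at h
  refine Eq.trans (tsum_congr fun n => ?_) (h.trans ?_)
  · rw [gauss, Complex.ofReal_exp, ← Complex.exp_add]
    congr 1
    push_cast
    ring
  · rw [Complex.ofReal_mul, Complex.ofReal_inv, one_div, Complex.ofReal_tsum]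
    congr 1
    refine tsum_congr fun n => ?_
    rw [gauss, Complex.ofReal_exp]
    congr 1
    rw [← mul_assoc Complex.I, Complex.I_mul_I, Equiv.neg_apply]
    push_cast
    ring

theorem theta_eq {a : ℝ} (ha : 0 < a) : theta a = (Real.sqrt a)⁻¹ * theta a⁻¹ := by
  have h := tsum_exp_mul_gauss ha 0
  simp only [Complex.ofReal_zero, mul_zero, Complex.exp_zero, one_mul, add_zero] at h
  exact_mod_cast h

theorem one_le_theta {a : ℝ} (ha : 0 < a) : 1 ≤ theta a := by
  have := (summable_gauss ha).le_tsum 0 fun _ _ => (gauss_pos _ _).le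
  rw [Int.cast_zero, gauss_zero_right] at this
  exact this

theorem inv_sqrt_le_theta {a : ℝ} (ha : 0 < a) : (Real.sqrt a)⁻¹ ≤ theta a := by
  rw [theta_eq ha]
  exact le_mul_of_one_le_right (by positivity) (one_le_theta (inv_pos.2 ha))

theorem theta_le_theta {a b : ℝ} (ha : 0 < a) (h : a ≤ b) : theta b ≤ theta a :=
  (summable_gauss (ha.trans_le h)).tsum_le_tsum
    (fun _ => gauss_le_gauss (mul_le_mul_of_nonneg_right h (sq_nonneg _))) (summable_gauss ha)

/-- By the functional equation `√a · theta a = theta a⁻¹`, which increases with `a`. -/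
theorem theta_le_sqrt_two_mul {a : ℝ} (ha : 0 < a) : theta a ≤ Real.sqrt 2 * theta (2 * a) := by
  rw [theta_eq ha, theta_eq (mul_pos two_pos ha), Real.sqrt_mul two_pos.le, mul_inv, ← mul_assoc,
    mul_inv_cancel_left₀ (by positivity)]
  exact mul_le_mul_of_nonneg_left (theta_le_theta (by positivity) (by
    gcongr
    linarith)) (by positivity)

theorem tsum_gauss_ne_zero {a : ℝ} (ha : 0 < a) :
    ∑' n : ℤ, (if n = 0 then 0 else gauss a n) = theta a - 1 := by
  rw [theta, (summable_gauss ha).tsum_eq_add_tsum_ite 0]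
  simp [gauss_zero_right]

theorem summable_gauss_ne_zero {a : ℝ} (ha : 0 < a) :
    Summable fun n : ℤ => if n = 0 then 0 else gauss a n := by
  refine (summable_gauss ha).of_nonneg_of_le (fun u => ?_) fun u => ?_ <;> split_ifs
  exacts [le_rfl, (gauss_pos _ _).le, (gauss_pos _ _).le, le_rfl]

/-- For `n ≠ 0` one has `π n² (a - 1) ≥ a - 1`, so each nonzero term gains the factor `exp (1 - a)`
over the series at `1`. -/
theorem theta_sub_one_le {a : ℝ} (ha : 1 ≤ a) : theta a - 1 ≤ Real.exp (1 - a) * theta 1 := by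
  have ha0 : 0 < a := by linarith
  rw [← tsum_gauss_ne_zero ha0, theta, ← tsum_mul_left]
  refine (summable_gauss_ne_zero ha0).tsum_le_tsum (fun n => ?_)
    ((summable_gauss one_pos).mul_left _)
  split_ifs with hn
  · exact mul_nonneg (Real.exp_nonneg _) (gauss_pos _ _).le
  · rw [gauss, gauss, ← Real.exp_add, Real.exp_le_exp]
    have h1 : (1 : ℝ) ≤ (n : ℝ) ^ 2 := by
      have := Int.one_le_abs hn
      have h2 : (1 : ℝ) ≤ |(n : ℝ)| := by exact_mod_cast this
      rw [← sq_abs]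
      exact one_le_pow₀ h2
    have h3 := Real.pi_gt_three
    have h4 : 1 * (a - 1) ≤ Real.pi * (n : ℝ) ^ 2 * (a - 1) :=
      mul_le_mul_of_nonneg_right (by nlinarith) (by linarith)
    nlinarith

/-- The mass of a Gaussian outside of a window of length `N`. -/
theorem tsum_gauss_sectors_le {N a x : ℝ} (hN : 0 < N) (ha : 0 < a) (hx : |x| ≤ N / 2) :
    (Summable fun u : ℤ => if u = 0 then 0 else gauss a (N * u + x)) ∧
    ∑' u : ℤ, (if u = 0 then 0 else gauss a (N * u + x)) ≤
      (theta (N ^ 2 * a / 8) - 1) * gauss (a / 2) x := by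
  have hb : 0 < N ^ 2 * a / 8 := by positivity
  have h : ∀ u : ℤ, (if u = 0 then 0 else gauss a (N * u + x)) ≤
      (if u = 0 then 0 else gauss (N ^ 2 * a / 8) u) * gauss (a / 2) x := by
    intro u
    split_ifs with hu
    · simp
    refine gauss_le_mul ?_
    have hu1 : (1 : ℝ) ≤ |(u : ℝ)| := by exact_mod_cast Int.one_le_abs hu
    -- As `|x| ≤ N / 2`, the distance `|N u + x|` is at least both `N |u| / 2` and `|x|`. Half of
    -- the exponent is spent on each bound, which explains `N² a / 8` and `a / 2`.
    have h1 : N * |(u : ℝ)| - |x| ≤ |N * u + x| := by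
      have := abs_sub_abs_le_abs_sub (N * (u : ℝ)) (-x)
      rwa [abs_mul, abs_of_pos hN, abs_neg, sub_neg_eq_add] at this
    have h2 : N ≤ N * |(u : ℝ)| := le_mul_of_one_le_right hN.le hu1
    have h3 : (N * |(u : ℝ)| / 2) ^ 2 ≤ |N * u + x| ^ 2 :=
      pow_le_pow_left₀ (by positivity) (by linarith) 2
    have h4 : |x| ^ 2 ≤ |N * u + x| ^ 2 := pow_le_pow_left₀ (abs_nonneg _) (by linarith) 2
    rw [sq_abs] at h3 h4
    rw [div_pow, mul_pow, sq_abs] at h3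
    rw [sq_abs] at h4
    nlinarith
  have hs : Summable fun u : ℤ => (if u = 0 then 0 else gauss (N ^ 2 * a / 8) u) * gauss (a / 2) x :=
    (summable_gauss_ne_zero hb).mul_right _
  have hs' : Summable fun u : ℤ => if u = 0 then 0 else gauss a (N * u + x) :=
    hs.of_nonneg_of_le (fun u => by split_ifs; exacts [le_rfl, (gauss_pos _ _).le]) h
  refine ⟨hs', (hs'.tsum_le_tsum h hs).trans (le_of_eq ?_)⟩
  rw [tsum_mul_right, tsum_gauss_ne_zero hb]

end gauss

open QMachine

/-! ### Distances of normalized weights -/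

section normalized
variable {Y : Type*} [Fintype Y]

/-- The distribution proportional to a weight. -/
noncomputable def normalized (g : Y → ℝ) (y : Y) : ℝ := g y / ∑ z, g z

theorem normalized_nonneg {g : Y → ℝ} (h0 : ∀ y, 0 ≤ g y) (y : Y) : 0 ≤ normalized g y :=
  div_nonneg (h0 y) (Finset.sum_nonneg fun z _ => h0 z)

theorem sum_normalized {g : Y → ℝ} (h : 0 < ∑ z, g z) : ∑ y, normalized g y = 1 := by
  simp only [normalized]
  rw [← Finset.sum_div, div_self h.ne']

theorem normalized_const_mul {c : ℝ} (hc : c ≠ 0) (g : Y → ℝ) :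
    normalized (fun y => c * g y) = normalized g := by
  funext y
  simp only [normalized]
  rw [← Finset.mul_sum, mul_div_mul_left _ _ hc]

/-- The total masses differ by no more than the weights do, so normalizing costs a factor `2`. -/
theorem sum_abs_normalized_sub_le {μ g : Y → ℝ} (hμ : ∀ y, 0 ≤ μ y) (hm : 0 < ∑ y, μ y)
    (hg : 0 < ∑ y, g y) {δ : ℝ} (h : ∑ y, |μ y - g y| ≤ δ * ∑ y, g y) :
    ∑ y, |normalized μ y - normalized g y| ≤ 2 * δ := by
  set m := ∑ y, μ y with hm'
  set b := ∑ y, g y with hb'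
  have h1 : |m - b| ≤ δ * b := by
    rw [hm', hb', ← Finset.sum_sub_distrib]
    exact (Finset.abs_sum_le_sum_abs _ _).trans h
  have h2 : ∀ y, |normalized μ y - normalized g y| ≤ |μ y - g y| / b + μ y / m * (|m - b| / b) := by
    intro y
    have e : normalized μ y - normalized g y = (μ y - g y) / b + μ y / m * ((b - m) / b) := by
      simp only [normalized, ← hm', ← hb']
      field_simp
      ring
    rw [e]
    refine (abs_add_le _ _).trans (le_of_eq ?_)
    rw [abs_div, abs_mul, abs_div, abs_div, abs_of_pos hg, abs_of_pos hm, abs_of_nonneg (hμ y),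
      abs_sub_comm b m]
  refine (Finset.sum_le_sum fun y _ => h2 y).trans ?_
  rw [Finset.sum_add_distrib, ← Finset.sum_div, ← Finset.sum_mul, ← Finset.sum_div, ← hm',
    div_self hm.ne', one_mul, ← add_div, div_le_iff₀ hg]
  linarith

theorem sum_abs_sub_le (f g h : Y → ℝ) :
    ∑ y, |f y - h y| ≤ ∑ y, |f y - g y| + ∑ y, |g y - h y| := by
  rw [← Finset.sum_add_distrib]
  exact Finset.sum_le_sum fun y _ => abs_sub_le _ _ _

end normalized

/-! ### Wrapped weights and differences of discrete Gaussians. -/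

section wrap
variable {N : ℕ} [NeZero N]

theorem sum_abs_wrap_sub_le {μ g : ℤ → ℝ} (hμ : Summable μ) (hg : Summable g) :
    ∑ y : ZMod N, |wrap μ y - wrap g y| ≤ ∑' e, |μ e - g e| := by
  have hs : Summable fun e => |μ e - g e| := (hμ.sub hg).abs
  rw [← sum_wrap (N := N) hs]
  refine Finset.sum_le_sum fun y _ => ?_
  have hμ' := summable_ite hμ fun e => (e : ZMod N) = y
  have hg' := summable_ite hg fun e => (e : ZMod N) = y
  have h1 : wrap μ y - wrap g y = ∑' e : ℤ, ((if (e : ZMod N) = y then μ e else 0) -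
      if (e : ZMod N) = y then g e else 0) := (hμ'.tsum_sub hg').symm
  rw [h1, ← Real.norm_eq_abs]
  refine (norm_tsum_le_tsum_norm (hμ'.sub hg').norm).trans (le_of_eq (tsum_congr fun e => ?_))
  rw [Real.norm_eq_abs]
  split_ifs <;> simp

/-- Bilinearity: change one argument at a time, the other being a probability distribution. -/
theorem sum_abs_diffLaw_sub_le (P P' ν ν' : ZMod N → ℝ) (hν : ∀ y, 0 ≤ ν y) (hν1 : ∑ y, ν y = 1)
    (hP' : ∀ y, 0 ≤ P' y) (hP1 : ∑ y, P' y = 1) :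
    ∑ y, |diffLaw P ν y - diffLaw P' ν' y| ≤ ∑ y, |P y - P' y| + ∑ y, |ν y - ν' y| := by
  have h1 : ∀ y, |diffLaw P ν y - diffLaw P' ν' y| ≤
      diffLaw (fun z => |P z - P' z|) ν y + diffLaw P' (fun z => |ν z - ν' z|) y := by
    intro y
    simp only [diffLaw]
    rw [← Finset.sum_sub_distrib, ← Finset.sum_add_distrib]
    refine (Finset.abs_sum_le_sum_abs _ _).trans (Finset.sum_le_sum fun z _ => ?_)
    have e : P z * ν (y + z) - P' z * ν' (y + z) =
        (P z - P' z) * ν (y + z) + P' z * (ν (y + z) - ν' (y + z)) := by ring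
    rw [e]
    refine (abs_add_le _ _).trans (le_of_eq ?_)
    rw [abs_mul, abs_mul, abs_of_nonneg (hν _), abs_of_nonneg (hP' z)]
  refine (Finset.sum_le_sum fun y _ => h1 y).trans (le_of_eq ?_)
  rw [Finset.sum_add_distrib, sum_diffLaw, sum_diffLaw, hν1, hP1, mul_one, one_mul]

/-- Wrapping commutes with taking differences, so the correlation may be computed on `ℤ`. -/
theorem diffLaw_wrap {g : ℤ → ℝ} (h0 : ∀ e, 0 ≤ g e) (hg : Summable g) (y : ZMod N) :
    diffLaw (wrap g) (wrap g) y = wrap (fun e => ∑' t, g t * g (t + e)) y := by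
  have hs : Summable fun w : ℤ × ℤ => g w.1 * g w.2 := hg.mul_of_nonneg hg h0 h0
  have hs2 : Summable fun w : ℤ × ℤ => g w.1 * g (w.1 + w.2) := by
    exact (Equiv.prodShear (Equiv.refl ℤ) Equiv.addLeft).summable_iff.2 hs
  have h1 : ∀ z : ZMod N, wrap g z * wrap g (y + z) =
      ∑' t : ℤ, if (t : ZMod N) = z then g t * wrap g (y + (t : ZMod N)) else 0 := by
    intro z
    rw [wrap, ← tsum_mul_right]
    refine tsum_congr fun t => ?_
    split_ifs with h
    · rw [h]
    · simp
  have hw : ∀ z : ZMod N, wrap g z ≤ ∑' e, g e := fun z =>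
    (summable_ite hg _).tsum_le_tsum (fun e => by split_ifs; exacts [le_rfl, h0 e]) hg
  have h2 : Summable fun t : ℤ => g t * wrap g (y + (t : ZMod N)) :=
    (hg.mul_right (∑' e, g e)).of_nonneg_of_le
      (fun t => mul_nonneg (h0 t) (wrap_nonneg h0 _))
      fun t => mul_le_mul_of_nonneg_left (hw _) (h0 t)
  have h3 : ∀ t : ℤ, g t * wrap g (y + (t : ZMod N)) =
      ∑' e : ℤ, if (e : ZMod N) = y then g t * g (t + e) else 0 := by
    intro t
    rw [wrap, ← tsum_mul_left, ← (Equiv.addLeft t).tsum_eq]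
    refine tsum_congr fun e => ?_
    simp only [Equiv.coe_addLeft, Int.cast_add, add_comm y, add_right_inj, mul_ite, mul_zero]
  rw [diffLaw, Finset.sum_congr rfl fun z _ => h1 z,
    ← Summable.tsum_finsetSum fun z _ => summable_ite h2 _]
  simp only [Finset.sum_ite_eq, Finset.mem_univ, if_true, h3]
  rw [wrap]
  rw [← Summable.tsum_comm (f := fun (t e : ℤ) => if (e : ZMod N) = y then g t * g (t + e) else 0)
    (summable_ite hs2 fun w => (w.2 : ZMod N) = y)]
  refine tsum_congr fun e => ?_
  split_ifs
  · rfl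
  · simp

/-- In the dual series the term at `0` is `1` and the others have modulus `gauss a⁻¹ n`,
independently of the translation `t`. -/
theorem abs_sqrt_mul_tsum_gauss_sub_one_le {a : ℝ} (ha : 0 < a) (t : ℝ) :
    |Real.sqrt a * ∑' n : ℤ, gauss a (n + t) - 1| ≤ theta a⁻¹ - 1 := by
  have hb : 0 < a⁻¹ := inv_pos.2 ha
  have h := tsum_exp_mul_gauss hb t
  rw [inv_inv, Real.sqrt_inv, inv_inv] at h
  have hn : ∀ n : ℤ, ‖Complex.exp (2 * Real.pi * Complex.I * n * t) * (gauss a⁻¹ n : ℂ)‖ =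
      gauss a⁻¹ n := by
    intro n
    have e : 2 * Real.pi * Complex.I * n * t = ((2 * Real.pi * n * t : ℝ) : ℂ) * Complex.I := by
      push_cast
      ring
    rw [norm_mul, e, Complex.norm_exp_ofReal_mul_I, one_mul, Complex.norm_real,
      Real.norm_of_nonneg (gauss_pos _ _).le]
  have hs : Summable fun n : ℤ =>
      Complex.exp (2 * Real.pi * Complex.I * n * t) * (gauss a⁻¹ n : ℂ) :=
    Summable.of_norm ((summable_gauss hb).congr fun n => (hn n).symm)
  have hn2 : ∀ n : ℤ, ‖(if n = 0 then 0 else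
      Complex.exp (2 * Real.pi * Complex.I * n * t) * (gauss a⁻¹ n : ℂ))‖ =
      if n = 0 then 0 else gauss a⁻¹ n := by
    intro n
    split_ifs
    · exact norm_zero
    · exact hn n
  rw [hs.tsum_eq_add_tsum_ite 0, Int.cast_zero, Int.cast_zero, gauss_zero_right, mul_zero, zero_mul,
    Complex.exp_zero, Complex.ofReal_one, one_mul] at h
  replace h := eq_sub_of_add_eq' h
  rw [← Complex.ofReal_one, ← Complex.ofReal_sub] at h
  rw [← tsum_gauss_ne_zero hb, ← Real.norm_eq_abs, ← Complex.norm_real, ← h]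
  refine (norm_tsum_le_tsum_norm ?_).trans (le_of_eq (tsum_congr hn2))
  exact (summable_gauss_ne_zero hb).congr fun n => (hn2 n).symm

/-- The difference of two discrete Gaussians is nearly a discrete Gaussian. -/
theorem sum_abs_diffLaw_gauss_le {a : ℝ} (ha : 0 < a) :
    ∑ y : ZMod N, |diffLaw (normalized (wrap fun e => gauss a e))
        (normalized (wrap fun e => gauss a e)) y - normalized (wrap fun e => gauss (a / 2) e) y| ≤
      2 * (theta (2 * a)⁻¹ - 1) := by
  set G : ZMod N → ℝ := wrap fun e => gauss a e with hG
  have ha2 : 0 < a / 2 := by positivity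
  have hs := summable_gauss ha
  have hs2 := summable_gauss ha2
  have hG1 : ∑ y, G y = theta a := sum_wrap hs
  have hG2 : ∑ y : ZMod N, wrap (fun e => gauss (a / 2) e) y = theta (a / 2) := sum_wrap hs2
  have hp : 0 < theta a := one_pos.trans_le (one_le_theta ha)
  have hp2 : 0 < theta (a / 2) := one_pos.trans_le (one_le_theta ha2)
  have h0 : ∀ y, 0 ≤ G y := wrap_nonneg fun _ => (gauss_pos _ _).le
  have h1 : diffLaw (normalized G) (normalized G) = normalized (diffLaw G G) := by
    funext y
    rw [normalized, sum_diffLaw]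
    simp only [diffLaw, normalized]
    rw [Finset.sum_div]
    refine Finset.sum_congr rfl fun z _ => ?_
    rw [div_mul_div_comm]
  -- The factor `√(2 a)` normalizes the inner lattice sum below to about `1`; it does not affect the
  -- normalized law.
  have hk : 0 < Real.sqrt (2 * a) := by positivity
  rw [h1, ← normalized_const_mul hk.ne']
  refine sum_abs_normalized_sub_le
    (fun y => mul_nonneg hk.le (diffLaw_nonneg h0 h0 y)) ?_ (by rwa [hG2]) ?_
  · rw [← Finset.mul_sum, sum_diffLaw, hG1]
    positivity
  -- Completing the square: `t² + (t + e)² = 2 (t + e / 2)² + e² / 2`.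
  have h2 : ∀ e : ℤ, ∑' t : ℤ, gauss a t * gauss a ((t + e : ℤ) : ℝ) =
      gauss (a / 2) e * ∑' t : ℤ, gauss (2 * a) (t + e / 2) := by
    intro e
    rw [← tsum_mul_left]
    refine tsum_congr fun t => ?_
    rw [gauss_mul_gauss, gauss_mul_gauss]
    push_cast
    ring_nf
  have h3 : ∀ e : ℤ, |Real.sqrt (2 * a) * (gauss (a / 2) e * ∑' t : ℤ, gauss (2 * a) (t + e / 2)) -
      gauss (a / 2) e| ≤ (theta (2 * a)⁻¹ - 1) * gauss (a / 2) e := by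
    intro e
    have := abs_sqrt_mul_tsum_gauss_sub_one_le (a := 2 * a) (by positivity) (e / 2)
    have e1 : Real.sqrt (2 * a) * (gauss (a / 2) e * ∑' t : ℤ, gauss (2 * a) (t + e / 2)) -
      gauss (a / 2) e = (Real.sqrt (2 * a) * ∑' t : ℤ, gauss (2 * a) (t + e / 2) - 1) *
        gauss (a / 2) e := by ring
    rw [e1, abs_mul, abs_of_pos (gauss_pos _ _)]
    exact mul_le_mul_of_nonneg_right this (gauss_pos _ _).le
  have hs3 : Summable fun e : ℤ =>
      Real.sqrt (2 * a) * (gauss (a / 2) e * ∑' t : ℤ, gauss (2 * a) (t + e / 2)) := by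
    have h4 : Summable fun e : ℤ => Real.sqrt (2 * a) *
        (gauss (a / 2) e * ∑' t : ℤ, gauss (2 * a) (t + e / 2)) - gauss (a / 2) e :=
      Summable.of_norm_bounded (hs2.mul_left (theta (2 * a)⁻¹ - 1)) h3
    simpa using h4.add hs2
  have h5 : ∀ y : ZMod N, Real.sqrt (2 * a) * diffLaw G G y = wrap (fun e =>
      Real.sqrt (2 * a) * (gauss (a / 2) e * ∑' t : ℤ, gauss (2 * a) (t + e / 2))) y := by
    intro y
    rw [hG, diffLaw_wrap (fun _ => (gauss_pos _ _).le) hs, wrap, wrap, ← tsum_mul_left]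
    refine tsum_congr fun e => ?_
    rw [h2]
    split_ifs
    · rfl
    · rw [mul_zero]
  simp only [h5]
  refine (sum_abs_wrap_sub_le hs3 hs2).trans ?_
  rw [hG2, theta, theta, ← theta, ← tsum_mul_left]
  exact (hs3.sub hs2).abs.tsum_le_tsum h3 (hs2.mul_left _)

end wrap

open QMachine

/-! ### The law of the rejection sampler -/

section noise
variable (p : EDCPParams) (κ : ℕ)

/-- The distribution of the residue of the result of the rejection sampler after `K` rounds. -/
noncomputable def noiseLawAt (K : ℕ) (y : ZMod p.N) : ℝ :=
  (Fintype.card (Fin K → NoiseChoice p κ) : ℝ)⁻¹ *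
    ∑ ω : Fin K → NoiseChoice p κ, if ((noiseVal p κ K ω : ℤ) : ZMod p.N) = y then 1 else 0

/-- The probability that the rejection sampler accepts the proposal `t`. -/
noncomputable def acceptWeight (t : ℤ) : ℝ :=
  if |t| ≤ noiseRange p κ then (threshold p κ t : ℝ) / noisePrec κ else 0

theorem sum_fin_sub_eq_tsum (H : ℕ) (g : ℤ → ℝ) :
    ∑ i : Fin (2 * H + 1), g ((i : ℤ) - H) = ∑' t : ℤ, if |t| ≤ (H : ℤ) then g t else 0 := by
  rw [tsum_eq_sum (s := Finset.Icc (-(H : ℤ)) H) fun t ht => if_neg fun h => ht ?_]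
  · refine Finset.sum_bij (fun i _ => (i : ℤ) - H) (fun i _ => ?_) (fun i _ j _ h => ?_)
      (fun t ht => ?_) fun i _ => ?_
    · rw [Finset.mem_Icc]
      omega
    · ext
      omega
    · rw [Finset.mem_Icc] at ht
      exact ⟨⟨(t + H).toNat, by omega⟩, Finset.mem_univ _, by simp only; omega⟩
    · rw [if_pos]
      rw [abs_le]
      omega
  · rw [Finset.mem_Icc]
    exact abs_le.1 h

theorem summable_abs_le (H : ℕ) (g : ℤ → ℝ) :
    Summable fun t : ℤ => if |t| ≤ (H : ℤ) then g t else 0 := by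
  refine summable_of_ne_finset_zero (s := Finset.Icc (-(H : ℤ)) H) fun t ht => if_neg fun h => ht ?_
  rw [Finset.mem_Icc]
  exact abs_le.1 h

theorem summable_acceptWeight : Summable (acceptWeight p κ) :=
  summable_abs_le _ fun t => (threshold p κ t : ℝ) / noisePrec κ

theorem acceptWeight_nonneg (t : ℤ) : 0 ≤ acceptWeight p κ t := by
  rw [acceptWeight]
  split_ifs
  · exact div_nonneg (by exact_mod_cast threshold_nonneg p κ t) (Nat.cast_nonneg _)
  · exact le_rfl

theorem wrap_acceptWeight (y : ZMod p.N) :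
    wrap (acceptWeight p κ) y = ∑ i : Fin (2 * noiseRange p κ + 1),
      if (((i : ℤ) - noiseRange p κ : ℤ) : ZMod p.N) = y then
        (threshold p κ ((i : ℤ) - noiseRange p κ) : ℝ) / noisePrec κ else 0 := by
  rw [sum_fin_sub_eq_tsum _ fun t => if (t : ZMod p.N) = y then
    (threshold p κ t : ℝ) / noisePrec κ else 0, wrap]
  refine tsum_congr fun t => ?_
  simp only [acceptWeight]
  split_ifs <;> rfl

theorem tsum_acceptWeight :
    ∑' t, acceptWeight p κ t = ∑ i : Fin (2 * noiseRange p κ + 1),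
      (threshold p κ ((i : ℤ) - noiseRange p κ) : ℝ) / noisePrec κ := by
  rw [sum_fin_sub_eq_tsum _ fun t => (threshold p κ t : ℝ) / noisePrec κ]
  rfl

theorem sum_fin_lt {U : ℕ} {m : ℤ} (h0 : 0 ≤ m) (h1 : m ≤ U) (A B : ℝ) :
    ∑ u : Fin U, (if (u : ℤ) < m then A else B) = m * A + (U - m) * B := by
  lift m to ℕ using h0
  have h : ∀ u : Fin U, (if ((u : ℕ) : ℤ) < (m : ℤ) then A else B) =
      if (u : ℕ) < m then A else B := fun u => by simp
  simp only [h]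
  rw [Fin.sum_univ_eq_sum_range fun u => if u < m then A else B]
  obtain ⟨d, rfl⟩ := Nat.exists_eq_add_of_le (by exact_mod_cast h1 : m ≤ U)
  rw [Finset.sum_range_add, Finset.sum_congr rfl fun u hu => if_pos (Finset.mem_range.1 hu)]
  simp

/-- Condition on the last round: if it accepts, its proposal is the result; otherwise the result is
that of the earlier rounds. -/
theorem noiseLawAt_succ (K : ℕ) (y : ZMod p.N) :
    noiseLawAt p κ (K + 1) y = (2 * noiseRange p κ + 1 : ℝ)⁻¹ * wrap (acceptWeight p κ) y +
      (1 - (2 * noiseRange p κ + 1 : ℝ)⁻¹ * ∑' t, acceptWeight p κ t) * noiseLawAt p κ K y := by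
  have hU : (noisePrec κ : ℝ) ≠ 0 := by exact_mod_cast (noisePrec_pos κ).ne'
  have hM : (2 * noiseRange p κ + 1 : ℝ) ≠ 0 := by positivity
  set S : ℝ := ∑ ω : Fin K → NoiseChoice p κ,
    if ((noiseVal p κ K ω : ℤ) : ZMod p.N) = y then 1 else 0 with hS
  set c : ℝ := (Fintype.card (Fin K → NoiseChoice p κ) : ℝ) with hc
  have hc0 : c ≠ 0 := by
    have : Nonempty (NoiseChoice p κ) := ⟨0, ⟨0, noisePrec_pos κ⟩⟩
    rw [hc]
    exact_mod_cast Fintype.card_ne_zero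
  have h1 : ∑ ω : Fin (K + 1) → NoiseChoice p κ,
      (if ((noiseVal p κ (K + 1) ω : ℤ) : ZMod p.N) = y then (1 : ℝ) else 0) =
      ∑ i : Fin (2 * noiseRange p κ + 1),
        ((threshold p κ ((i : ℤ) - noiseRange p κ) : ℝ) *
          (if (((i : ℤ) - noiseRange p κ : ℤ) : ZMod p.N) = y then c else 0) +
        (noisePrec κ - (threshold p κ ((i : ℤ) - noiseRange p κ) : ℝ)) * S) := by
    rw [← (Fin.snocEquiv fun _ => NoiseChoice p κ).sum_comp, Fintype.sum_prod_type]
    unfold NoiseChoice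
    rw [Fintype.sum_prod_type]
    refine Finset.sum_congr rfl fun i _ => ?_
    rw [← sum_fin_lt (threshold_nonneg p κ _) (threshold_le p κ _)]
    refine Finset.sum_congr rfl fun u _ => ?_
    simp only [Fin.snocEquiv, Equiv.coe_fn_mk, noiseVal, Fin.snoc_last, Fin.init_snoc]
    split_ifs with h2 h3
    · simp only [Finset.sum_const, Finset.card_univ, nsmul_eq_mul, mul_one]
      rfl
    · simp
    · rfl
  have hcard : (Fintype.card (Fin (K + 1) → NoiseChoice p κ) : ℝ) =
      c * ((2 * noiseRange p κ + 1) * noisePrec κ) := by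
    rw [hc, Fintype.card_fun, Fintype.card_fun, Fintype.card_fin, Fintype.card_fin, pow_succ]
    push_cast
    simp [NoiseChoice]
  rw [noiseLawAt, h1, hcard, Finset.sum_add_distrib, ← Finset.sum_mul, Finset.sum_sub_distrib,
    noiseLawAt, ← hS, ← hc, wrap_acceptWeight, tsum_acceptWeight, ← Finset.sum_div]
  have h4 : ∑ i : Fin (2 * noiseRange p κ + 1), (threshold p κ ((i : ℤ) - noiseRange p κ) : ℝ) *
      (if (((i : ℤ) - noiseRange p κ : ℤ) : ZMod p.N) = y then c else 0) =
      c * noisePrec κ * ∑ i : Fin (2 * noiseRange p κ + 1),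
        if (((i : ℤ) - noiseRange p κ : ℤ) : ZMod p.N) = y then
          (threshold p κ ((i : ℤ) - noiseRange p κ) : ℝ) / noisePrec κ else 0 := by
    rw [Finset.mul_sum]
    refine Finset.sum_congr rfl fun i _ => ?_
    split_ifs
    · field_simp
    · simp
  rw [h4, Finset.sum_const, Finset.card_univ, Fintype.card_fin, nsmul_eq_mul]
  push_cast
  field_simp

theorem noiseLawAt_zero (y : ZMod p.N) : noiseLawAt p κ 0 y = if y = 0 then 1 else 0 := by
  simp [noiseLawAt, noiseVal, eq_comm]

/-- The normalized weight is the fixed point of the one-round recursion, so every round multiplies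
the distance by the probability of rejection. Two probability laws are initially at distance at most
`2`. -/
theorem sum_abs_noiseLawAt_sub_le (hW : 0 < ∑' t, acceptWeight p κ t) (K : ℕ) :
    ∑ y, |noiseLawAt p κ K y - normalized (wrap (acceptWeight p κ)) y| ≤
      2 * (1 - (2 * noiseRange p κ + 1 : ℝ)⁻¹ * ∑' t, acceptWeight p κ t) ^ K := by
  have hM : (0 : ℝ) < 2 * noiseRange p κ + 1 := by positivity
  have hs : ∑ y : ZMod p.N, wrap (acceptWeight p κ) y = ∑' t, acceptWeight p κ t :=
    sum_wrap (summable_acceptWeight p κ)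
  have hle : (2 * noiseRange p κ + 1 : ℝ)⁻¹ * ∑' t, acceptWeight p κ t ≤ 1 := by
    rw [inv_mul_le_iff₀ hM, mul_one, tsum_acceptWeight]
    refine (Finset.sum_le_card_nsmul _ _ 1 fun i _ => ?_).trans (by simp)
    exact div_le_one_of_le₀ (by exact_mod_cast threshold_le p κ _) (Nat.cast_nonneg _)
  induction K with
  | zero =>
    rw [pow_zero, mul_one]
    refine (Finset.sum_le_sum fun y _ => abs_sub _ _).trans ?_
    rw [Finset.sum_add_distrib]
    have h1 : ∑ y : ZMod p.N, |noiseLawAt p κ 0 y| = 1 := by simp [noiseLawAt_zero, apply_ite abs]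
    have h2 : ∑ y : ZMod p.N, |normalized (wrap (acceptWeight p κ)) y| = 1 := by
      rw [← sum_normalized (g := wrap (N := p.N) (acceptWeight p κ)) (by rwa [hs])]
      exact Finset.sum_congr rfl fun y _ =>
        abs_of_nonneg (normalized_nonneg (wrap_nonneg (acceptWeight_nonneg p κ)) y)
    rw [h1, h2]
    norm_num
  | succ K ih =>
    have h : ∀ y, |noiseLawAt p κ (K + 1) y - normalized (wrap (acceptWeight p κ)) y| =
        (1 - (2 * noiseRange p κ + 1 : ℝ)⁻¹ * ∑' t, acceptWeight p κ t) *
          |noiseLawAt p κ K y - normalized (wrap (acceptWeight p κ)) y| := by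
      intro y
      rw [← abs_of_nonneg (sub_nonneg.2 hle), ← abs_mul, noiseLawAt_succ]
      congr 1
      rw [normalized, hs]
      field_simp
      ring
    simp only [h]
    rw [← Finset.mul_sum, pow_succ]
    calc _ ≤ (1 - (2 * noiseRange p κ + 1 : ℝ)⁻¹ * ∑' t, acceptWeight p κ t) * (2 * _) :=
          mul_le_mul_of_nonneg_left ih (sub_nonneg.2 hle)
      _ = _ := by ring

theorem threshold_eq (t : ℤ) :
    threshold p κ t = ⌊(noisePrec κ : ℝ) * gauss (2 * (p.r / p.N) ^ 2) t⌋ := by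
  rw [threshold, gauss]
  congr 3
  ring

theorem lt_of_noiseRange_lt {t : ℤ} (h : (noiseRange p κ : ℤ) < |t|) :
    (κ : ℝ) ^ 2 ≤ (p.r / p.N) ^ 2 * (t : ℝ) ^ 2 := by
  have hr := p.r_pos
  have hN : (0 : ℝ) < p.N := by exact_mod_cast Nat.pos_of_ne_zero (NeZero.ne p.N)
  have h1 : (κ * p.N / p.r : ℝ) < noiseRange p κ + 1 := Nat.lt_floor_add_one _
  have h2 : (noiseRange p κ : ℝ) + 1 ≤ |(t : ℝ)| := by exact_mod_cast h
  rw [← mul_pow, ← sq_abs (p.r / p.N * t), abs_mul, abs_of_pos (div_pos hr hN)]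
  refine pow_le_pow_left₀ (Nat.cast_nonneg _) ?_ 2
  rw [div_mul_eq_mul_div, le_div_iff₀ hN]
  have h3 : (κ * p.N / p.r : ℝ) ≤ |(t : ℝ)| := by linarith
  rw [div_le_iff₀ hr] at h3
  linarith

/-- Within the range, rounding the threshold costs at most `1 / noisePrec κ` per proposal. Outside
it `κ ≤ |r t / N|`, and half of the exponent is given up for `gauss 1 κ` while the other half keeps
the sum convergent. -/
theorem tsum_abs_acceptWeight_sub_le :
    ∑' t, |acceptWeight p κ t - gauss (2 * (p.r / p.N) ^ 2) t| ≤
      (2 * noiseRange p κ + 1) / noisePrec κ + gauss 1 κ * theta ((p.r / p.N) ^ 2) := by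
  have hr := p.r_pos
  have hN : (0 : ℝ) < p.N := by exact_mod_cast Nat.pos_of_ne_zero (NeZero.ne p.N)
  have ha : 0 < (p.r / p.N) ^ 2 := by positivity
  have hU : (0 : ℝ) < noisePrec κ := by exact_mod_cast noisePrec_pos κ
  have h : ∀ t : ℤ, |acceptWeight p κ t - gauss (2 * (p.r / p.N) ^ 2) t| ≤
      (if |t| ≤ (noiseRange p κ : ℤ) then (noisePrec κ : ℝ)⁻¹ else 0) +
        gauss 1 κ * gauss ((p.r / p.N) ^ 2) t := by
    intro t
    rw [acceptWeight]
    split_ifs with ht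
    · refine le_add_of_le_of_nonneg ?_ (mul_pos (gauss_pos _ _) (gauss_pos _ _)).le
      rw [threshold_eq, abs_sub_comm, abs_le]
      have h1 := Int.floor_le ((noisePrec κ : ℝ) * gauss (2 * (p.r / p.N) ^ 2) t)
      have h2 := Int.lt_floor_add_one ((noisePrec κ : ℝ) * gauss (2 * (p.r / p.N) ^ 2) t)
      constructor
      · rw [← sub_nonneg]
        have : 0 ≤ (noisePrec κ : ℝ)⁻¹ := by positivity
        have h3 := (div_le_iff₀' hU).2 h1
        linarith
      · rw [sub_le_iff_le_add, inv_eq_one_div, ← add_div, le_div_iff₀' hU]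
        linarith
    · rw [zero_sub, abs_neg, abs_of_pos (gauss_pos _ _), zero_add]
      refine gauss_le_mul ?_
      have := lt_of_noiseRange_lt p κ (not_le.1 ht)
      linarith
  have hs1 := summable_abs_le (noiseRange p κ) fun _ => (noisePrec κ : ℝ)⁻¹
  have hs2 : Summable fun t : ℤ => gauss 1 κ * gauss ((p.r / p.N) ^ 2) t :=
    (summable_gauss ha).mul_left _
  refine (((summable_acceptWeight p κ).sub (summable_gauss (by positivity))).abs.tsum_le_tsum h
    (hs1.add hs2)).trans (le_of_eq ?_)
  rw [hs1.tsum_add hs2, tsum_mul_left, ← sum_fin_sub_eq_tsum _ fun _ => (noisePrec κ : ℝ)⁻¹, theta,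
    Finset.sum_const, Finset.card_univ, Fintype.card_fin, nsmul_eq_mul]
  push_cast
  rfl

/-- The law of the rejection sampler is nearly a discrete Gaussian. -/
theorem sum_abs_noiseLaw_sub_le {κ : ℕ} (hκ : 110 ≤ κ) (hrN : p.r ≤ p.N) :
    ∑ y, |noiseLaw p κ y - normalized (wrap fun e => gauss (2 * (p.r / p.N) ^ 2) e) y| ≤
      58 * Real.exp (-(κ / 9)) := by
  have hr := p.r_pos
  have hN : (0 : ℝ) < p.N := by exact_mod_cast Nat.pos_of_ne_zero (NeZero.ne p.N)
  have hκ' : (110 : ℝ) ≤ κ := by exact_mod_cast hκ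
  have hρ : 0 < p.r / p.N := by positivity
  have hρ1 : p.r / p.N ≤ 1 := div_le_one_of_le₀ hrN hN.le
  have ha : 0 < 2 * (p.r / p.N) ^ 2 := by positivity
  have hH : (noiseRange p κ : ℝ) * (p.r / p.N) ≤ κ := by
    rw [mul_div_assoc', div_le_iff₀ hN, mul_comm]
    exact mul_noiseRange_le p κ
  have hV := tsum_abs_acceptWeight_sub_le p κ
  set ρ := p.r / p.N with hρ'
  set θ := theta (2 * ρ ^ 2) with hθ
  have hθ0 : 0 < θ := one_pos.trans_le (one_le_theta ha)
  -- The theta series is at least `1 / (√2 ρ)`, and `√2 ≤ 3 / 2`. This relates the number of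
  -- proposals to the total weight without a lower bound on `ρ`.
  have hθ1 : 1 ≤ 3 / 2 * ρ * θ := by
    have h1 := inv_sqrt_le_theta ha
    have h2 : Real.sqrt (2 * ρ ^ 2) ≤ 3 / 2 * ρ := by
      rw [Real.sqrt_le_left (by positivity)]
      nlinarith [sq_nonneg ρ]
    have h3 := (inv_le_iff_one_le_mul₀' (by positivity)).1 h1
    exact h3.trans (mul_le_mul_of_nonneg_right h2 hθ0.le)
  have hM : (2 * noiseRange p κ + 1 : ℝ) ≤ 9 / 2 * κ * θ := by
    have h1 : (2 * noiseRange p κ + 1 : ℝ) * ρ ≤ 3 * κ := by nlinarith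
    have h2 : (0 : ℝ) ≤ 2 * noiseRange p κ + 1 := by positivity
    nlinarith [mul_le_mul_of_nonneg_left hθ1 h2, mul_le_mul_of_nonneg_right h1 hθ0.le]
  have hx1 : (κ : ℝ) / 2 + 1 ≤ Real.exp (κ / 2) := Real.add_one_le_exp _
  set x := Real.exp (κ / 2) with hx
  have hx2 : Real.exp κ = x * x := by
    rw [hx, ← Real.exp_add]
    ring_nf
  have hx0 : 0 < x := Real.exp_pos _
  have hU : x * x / 2 ≤ noisePrec κ := by
    have := Nat.lt_floor_add_one (Real.exp κ)
    rw [hx2] at this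
    have h3 : (⌊x * x⌋₊ : ℝ) = noisePrec κ := by rw [noisePrec, hx2]
    nlinarith
  have hg : gauss 1 κ ≤ x⁻¹ := by
    rw [hx, ← Real.exp_neg, gauss, Real.exp_le_exp]
    nlinarith [Real.pi_gt_three]
  have hβ : (2 * noiseRange p κ + 1) / noisePrec κ + gauss 1 κ * theta (ρ ^ 2) ≤
      28 * x⁻¹ * θ := by
    have h1 : (2 * noiseRange p κ + 1 : ℝ) / noisePrec κ ≤ 18 * x⁻¹ * θ := by
      have hU0 : (0 : ℝ) < noisePrec κ := lt_of_lt_of_le (by positivity) hU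
      rw [div_le_iff₀ hU0]
      calc (2 * noiseRange p κ + 1 : ℝ) ≤ 9 / 2 * κ * θ := hM
        _ ≤ 9 * x * θ := mul_le_mul_of_nonneg_right (by linarith) hθ0.le
        _ = 18 * x⁻¹ * θ * (x * x / 2) := by field_simp; norm_num
        _ ≤ _ := mul_le_mul_of_nonneg_left hU (by positivity)
    have h2 : theta (ρ ^ 2) ≤ 3 / 2 * θ := by
      refine (theta_le_sqrt_two_mul (by positivity)).trans
        (mul_le_mul_of_nonneg_right ?_ hθ0.le)
      rw [Real.sqrt_le_left (by norm_num)]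
      norm_num
    have h3 : gauss 1 κ * theta (ρ ^ 2) ≤ x⁻¹ * (3 / 2 * θ) :=
      mul_le_mul hg h2 (zero_le_one.trans (one_le_theta (by positivity))) (by positivity)
    have h4 : 0 < x⁻¹ * θ := by positivity
    linarith
  -- From `κ ≥ 110`; it makes the relative error `28 x⁻¹` at most `1 / 2`, so at least half of the
  -- Gaussian mass is accepted.
  have hx3 : x⁻¹ ≤ 1 / 56 := by
    rw [inv_le_comm₀ hx0 (by norm_num)]
    linarith
  have hsV := summable_acceptWeight p κ
  have hsg := summable_gauss ha
  have hW : θ / 2 ≤ ∑' t, acceptWeight p κ t := by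
    have h1 : |∑' t, acceptWeight p κ t - θ| ≤ 28 * x⁻¹ * θ := by
      rw [hθ, theta, ← hsV.tsum_sub hsg, ← Real.norm_eq_abs]
      exact (norm_tsum_le_tsum_norm (hsV.sub hsg).norm).trans (hV.trans hβ)
    have h2 := (abs_le.1 h1).1
    nlinarith
  have hW0 : 0 < ∑' t, acceptWeight p κ t := lt_of_lt_of_le (by positivity) hW
  have hA := sum_abs_noiseLawAt_sub_le p κ hW0 (κ * κ)
  -- The acceptance probability is at least `(θ / 2) / (9 κ θ / 2)`, so `κ²` rounds all reject with
  -- probability at most `exp (-κ / 9)`.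
  have hq : 1 / (9 * (κ : ℝ)) ≤ (2 * noiseRange p κ + 1 : ℝ)⁻¹ * ∑' t, acceptWeight p κ t := by
    rw [inv_mul_eq_div, div_le_div_iff₀ (by positivity) (by positivity)]
    nlinarith
  have hq1 : (1 - (2 * noiseRange p κ + 1 : ℝ)⁻¹ * ∑' t, acceptWeight p κ t) ^ (κ * κ) ≤
      Real.exp (-(κ / 9)) := by
    have h0 : 0 ≤ 1 - (2 * noiseRange p κ + 1 : ℝ)⁻¹ * ∑' t, acceptWeight p κ t := by
      rw [sub_nonneg, inv_mul_le_iff₀ (by positivity), mul_one, tsum_acceptWeight]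
      refine (Finset.sum_le_card_nsmul _ _ 1 fun i _ => ?_).trans (by simp)
      exact div_le_one_of_le₀ (by exact_mod_cast threshold_le p κ _) (Nat.cast_nonneg _)
    calc _ ≤ Real.exp (-(1 / (9 * (κ : ℝ)))) ^ (κ * κ) := by
          refine pow_le_pow_left₀ h0 ?_ _
          have := Real.add_one_le_exp (-(1 / (9 * (κ : ℝ))))
          linarith
      _ = _ := by
          rw [← Real.exp_nat_mul]
          congr 1
          push_cast
          field_simp
  have hB : ∑ y : ZMod p.N, |normalized (wrap (acceptWeight p κ)) y -
      normalized (wrap fun e => gauss (2 * ρ ^ 2) e) y| ≤ 2 * (28 * x⁻¹) := by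
    have e1 : ∑ y : ZMod p.N, wrap (fun e => gauss (2 * ρ ^ 2) e) y = θ := sum_wrap hsg
    refine sum_abs_normalized_sub_le (wrap_nonneg (acceptWeight_nonneg p κ)) ?_ ?_ ?_
    · rwa [sum_wrap hsV]
    · rwa [e1]
    · rw [e1]
      exact (sum_abs_wrap_sub_le hsV hsg).trans (hV.trans hβ)
  have hx4 : x⁻¹ ≤ Real.exp (-(κ / 9)) := by
    rw [hx, ← Real.exp_neg, Real.exp_le_exp]
    linarith
  refine (sum_abs_sub_le _ (normalized (wrap (acceptWeight p κ))) _).trans ?_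
  have hA' : ∑ y, |noiseLaw p κ y - normalized (wrap (acceptWeight p κ)) y| ≤
    2 * (1 - (2 * noiseRange p κ + 1 : ℝ)⁻¹ * ∑' t, acceptWeight p κ t) ^ (κ * κ) := hA
  linarith

end noise

open QMachine

/-! ### The Fourier transform of a Gaussian block state -/

section fourier
variable {N : ℕ} [NeZero N]

theorem wrap_intCast (μ : ℤ → ℝ) (x : ℤ) : wrap μ (x : ZMod N) = ∑' u : ℤ, μ (N * u + x) := by
  have hN : (N : ℤ) ≠ 0 := by exact_mod_cast NeZero.ne N
  have hi : Function.Injective fun u : ℤ => N * u + x := fun u v h =>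
    mul_left_cancel₀ hN (add_right_cancel h)
  rw [wrap, ← hi.tsum_eq]
  · exact tsum_congr fun u => by simp
  · intro e he
    have h : (e : ZMod N) = x := by
      by_contra h
      simp [h] at he
    obtain ⟨u, hu⟩ := (ZMod.intCast_eq_intCast_iff_dvd_sub x e N).1 h.symm
    exact ⟨u, by simp only; omega⟩

/-- The representative of `v - N / 2` in the window that begins at `-N / 2`. -/
def windowRep (v : ZMod N) : ℤ := v.val - (N / 2 : ℕ)

theorem windowRep_cast (v : ZMod N) : (windowRep v : ZMod N) = v - ((N / 2 : ℕ) : ZMod N) := by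
  simp only [windowRep, Int.cast_sub, Int.cast_natCast, ZMod.natCast_zmod_val]

theorem abs_windowRep_le (v : ZMod N) : |(windowRep v : ℝ)| ≤ (N : ℝ) / 2 := by
  have hv := ZMod.val_lt v
  have h : |2 * windowRep v| ≤ (N : ℤ) := by
    rw [windowRep, abs_le]
    omega
  have h2 : |2 * (windowRep v : ℝ)| ≤ N := by exact_mod_cast h
  rw [abs_mul, abs_two] at h2
  linarith

theorem sum_windowRep (h : ZMod N → ℝ) : ∑ y, h y = ∑ v : ZMod N, h (windowRep v : ZMod N) := by
  rw [← Equiv.sum_comp (Equiv.subRight ((N / 2 : ℕ) : ZMod N)) h]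
  exact Finset.sum_congr rfl fun v _ => by rw [windowRep_cast, Equiv.subRight_apply]

/-- The mass of a Gaussian at the integers congruent to `x` modulo `N`, without `x`. -/
noncomputable def gaussTail (N : ℕ) (a : ℝ) (x : ℤ) : ℝ :=
  ∑' u : ℤ, if u = 0 then 0 else gauss a (N * u + x)

theorem gaussTail_nonneg (N : ℕ) (a : ℝ) (x : ℤ) : 0 ≤ gaussTail N a x :=
  tsum_nonneg fun u => by split_ifs; exacts [le_rfl, (gauss_pos _ _).le]

theorem natCast_modulus_pos : (0 : ℝ) < N := by exact_mod_cast Nat.pos_of_ne_zero (NeZero.ne N)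

theorem gaussTail_le {a : ℝ} (ha : 0 < a) (v : ZMod N) :
    gaussTail N a (windowRep v) ≤ (theta (N ^ 2 * a / 8) - 1) * gauss (a / 2) (windowRep v) :=
  (tsum_gauss_sectors_le natCast_modulus_pos ha (abs_windowRep_le v)).2

/-- Each residue class has one representative in the centred window; the remaining members form the
tail. -/
theorem wrap_gauss {a : ℝ} (ha : 0 < a) (v : ZMod N) :
    wrap (fun e => gauss a e) (windowRep v : ZMod N) =
      gauss a (windowRep v) + gaussTail N a (windowRep v) := by
  have hs := (tsum_gauss_sectors_le natCast_modulus_pos ha (abs_windowRep_le v)).1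
  have hs2 : Summable fun u : ℤ => gauss a (N * u + windowRep v) := by
    have hN : (0 : ℝ) < N := natCast_modulus_pos
    refine (summable_gauss_add (a := a * N ^ 2) (by positivity) (windowRep v / N)).congr fun u => ?_
    rw [gauss, gauss]
    congr 3
    field_simp
  rw [wrap_intCast]
  push_cast
  rw [hs2.tsum_eq_add_tsum_ite 0, Int.cast_zero, mul_zero, zero_add, gaussTail]

theorem sum_gauss_windowRep_le {a : ℝ} (ha : 0 < a) :
    ∑ v : ZMod N, gauss a (windowRep v) ≤ theta a := by
  have h : ∑ y : ZMod N, wrap (fun e => gauss a e) y = theta a := sum_wrap (summable_gauss ha)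
  rw [← h, sum_windowRep (wrap fun e => gauss a e)]
  refine Finset.sum_le_sum fun v _ => ?_
  rw [wrap_gauss ha]
  exact le_add_of_nonneg_right (gaussTail_nonneg _ _ _)

/-- The square of a wrapped Gaussian is nearly a wrapped Gaussian. -/
theorem sum_abs_sq_wrap_gauss_sub_le {a : ℝ} (ha : 0 < a) (h1 : theta (N ^ 2 * a / 8) - 1 ≤ 1) :
    ∑ y : ZMod N, |wrap (fun e => gauss a e) y ^ 2 - wrap (fun e => gauss (2 * a) e) y| ≤
      6 * (theta (N ^ 2 * a / 8) - 1) * theta (2 * a) := by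
  have hN : (0 : ℝ) < N := natCast_modulus_pos
  set η := theta (N ^ 2 * a / 8) - 1 with hη
  have hη0 : 0 ≤ η := sub_nonneg.2 (one_le_theta (by positivity))
  rw [sum_windowRep]
  -- With window value `k` and tails `t` and `s`, the difference is `2 k t + t² - s`, and each of `k
  -- t`, `t²`, `s` is at most `η k`.
  have h : ∀ v : ZMod N, |wrap (fun e => gauss a e) (windowRep v : ZMod N) ^ 2 -
      wrap (fun e => gauss (2 * a) e) (windowRep v : ZMod N)| ≤ 4 * η * gauss a (windowRep v) := by
    intro v
    have ha2 : 0 < 2 * a := by positivity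
    rw [wrap_gauss ha, wrap_gauss ha2, ← gauss_sq]
    have t0 := gaussTail_nonneg N a (windowRep v)
    have t1 := gaussTail_le ha v
    have s0 := gaussTail_nonneg N (2 * a) (windowRep v)
    have s1 := gaussTail_le ha2 v
    have s2 : theta (N ^ 2 * (2 * a) / 8) ≤ theta (N ^ 2 * a / 8) :=
      theta_le_theta (by positivity) (by
        have : 0 < (N : ℝ) ^ 2 * a := by positivity
        linarith)
    rw [mul_div_cancel_left₀ _ (two_ne_zero' ℝ)] at s1
    have e1 : gauss a (windowRep v) = gauss (a / 2) (windowRep v) ^ 2 := by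
      rw [gauss_sq, mul_div_cancel₀ _ (two_ne_zero' ℝ)]
    have g0 := (gauss_pos (a / 2) (windowRep v)).le
    have g1 := gauss_le_one (half_pos ha).le (windowRep v)
    have k0 := (gauss_pos a (windowRep v)).le
    rw [← hη] at t1
    set t := gaussTail N a (windowRep v)
    set s := gaussTail N (2 * a) (windowRep v)
    set k := gauss a (windowRep v)
    set g := gauss (a / 2) (windowRep v)
    have s3 : s ≤ η * k := s1.trans (mul_le_mul_of_nonneg_right (by linarith) k0)
    have t2 : t ≤ η := t1.trans (mul_le_of_le_one_right hη0 g1)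
    have t3 : t ^ 2 ≤ η * k := by
      have : t ^ 2 ≤ (η * g) ^ 2 := pow_le_pow_left₀ t0 t1 2
      rw [mul_pow, ← e1] at this
      refine this.trans (mul_le_mul_of_nonneg_right ?_ k0)
      nlinarith
    have t4 : t * k ≤ η * k := mul_le_mul_of_nonneg_right t2 k0
    rw [abs_le]
    constructor <;> nlinarith [mul_nonneg t0 k0, sq_nonneg t, mul_nonneg hη0 k0]
  refine (Finset.sum_le_sum fun v _ => h v).trans ?_
  rw [← Finset.mul_sum]
  have h2 : theta a ≤ 3 / 2 * theta (2 * a) := by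
    refine (theta_le_sqrt_two_mul ha).trans (mul_le_mul_of_nonneg_right ?_
      (zero_le_one.trans (one_le_theta (by positivity))))
    rw [Real.sqrt_le_left (by norm_num)]
    norm_num
  calc 4 * η * ∑ v : ZMod N, gauss a (windowRep v) ≤ 4 * η * (3 / 2 * theta (2 * a)) :=
        mul_le_mul_of_nonneg_left ((sum_gauss_windowRep_le ha).trans h2) (by positivity)
    _ = _ := by ring

theorem stdAddChar_intCast_mul (j : ℤ) (z : ZMod N) :
    ZMod.stdAddChar ((j : ZMod N) * z) =
      Complex.exp (2 * Real.pi * Complex.I * j * ((z.val / N : ℝ) : ℂ)) := by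
  have h : (j : ZMod N) * z = ((j * z.val : ℤ) : ZMod N) := by
    push_cast
    rw [ZMod.natCast_zmod_val]
  rw [h, ZMod.stdAddChar_coe]
  congr 1
  push_cast
  ring

/-- The Fourier transform of a wrapped Gaussian is a wrapped Gaussian. -/
theorem norm_dft_wrap_gauss {a : ℝ} (ha : 0 < a) (z : ZMod N) :
    ‖∑ v : ZMod N, ZMod.stdAddChar (v * z) * ((wrap (fun e => gauss a e) (windowRep v : ZMod N) : ℝ) : ℂ)‖ =
      (Real.sqrt a)⁻¹ * wrap (fun e => gauss (a⁻¹ / N ^ 2) e) z := by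
  have hN : (0 : ℝ) < N := natCast_modulus_pos
  have hs : Summable fun j : ℤ => ZMod.stdAddChar ((j : ZMod N) * z) * (gauss a j : ℂ) := by
    refine Summable.of_norm ((summable_gauss ha).congr fun j => ?_)
    rw [norm_mul, norm_stdAddChar, one_mul, Complex.norm_real, Real.norm_of_nonneg (gauss_pos _ _).le]
  -- Recentring the window is a translation of the residues, which only contributes a phase.
  have h1 : ∑ v : ZMod N, ZMod.stdAddChar (v * z) *
      ((wrap (fun e => gauss a e) (windowRep v : ZMod N) : ℝ) : ℂ) =
      ZMod.stdAddChar (((N / 2 : ℕ) : ZMod N) * z) *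
        ∑ y : ZMod N, ZMod.stdAddChar (y * z) * ((wrap (fun e => gauss a e) y : ℝ) : ℂ) := by
    rw [← Equiv.sum_comp (Equiv.subRight ((N / 2 : ℕ) : ZMod N)) fun y : ZMod N =>
      ZMod.stdAddChar (y * z) * ((wrap (fun e => gauss a e) y : ℝ) : ℂ), Finset.mul_sum]
    refine Finset.sum_congr rfl fun v _ => ?_
    rw [← mul_assoc, ← AddChar.map_add_eq_mul, ← add_mul, Equiv.subRight_apply, add_sub_cancel]
    rw [windowRep_cast]
  have h2 : ∑ y : ZMod N, ZMod.stdAddChar (y * z) * ((wrap (fun e => gauss a e) y : ℝ) : ℂ) =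
      ∑' j : ℤ, ZMod.stdAddChar ((j : ZMod N) * z) * (gauss a j : ℂ) := by
    have h3 : ∀ y : ZMod N, ZMod.stdAddChar (y * z) * ((wrap (fun e => gauss a e) y : ℝ) : ℂ) =
        ∑' j : ℤ, if (j : ZMod N) = y then
          ZMod.stdAddChar ((j : ZMod N) * z) * (gauss a j : ℂ) else 0 := by
      intro y
      rw [wrap, Complex.ofReal_tsum, ← tsum_mul_left]
      refine tsum_congr fun j => ?_
      split_ifs with h
      · rw [h]
      · simp
    simp only [h3]
    rw [← Summable.tsum_finsetSum fun y _ => ?_]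
    · exact tsum_congr fun j => by simp
    · refine (hs.indicator {j : ℤ | (j : ZMod N) = y}).congr fun j => ?_
      simp [Set.indicator_apply]
  rw [h1, h2, norm_mul, norm_stdAddChar, one_mul]
  simp only [stdAddChar_intCast_mul]
  rw [tsum_exp_mul_gauss ha, Complex.norm_real, Real.norm_of_nonneg
    (mul_nonneg (by positivity) (tsum_nonneg fun _ => (gauss_pos _ _).le))]
  congr 1
  have h4 := wrap_intCast (N := N) (fun e => gauss (a⁻¹ / N ^ 2) e) z.val
  rw [Int.cast_natCast, ZMod.natCast_zmod_val] at h4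
  rw [h4]
  refine tsum_congr fun u => ?_
  rw [gauss, gauss]
  congr 3
  push_cast
  field_simp

end fourier

open QMachine

/-! ### The outcome of the Fourier measurement is nearly Gaussian. -/

section outcome
variable {N : ℕ} [NeZero N]

theorem outcomeProb_const_mul (c : ℂ) (f : ℤ → ℂ) (z : ZMod N) :
    outcomeProb (fun j => c * f j) z = ‖c‖ ^ 2 * outcomeProb f z := by
  have h : ∀ u, ‖sectorAmp (fun j => c * f j) u z‖ ^ 2 = ‖c‖ ^ 2 * ‖sectorAmp f u z‖ ^ 2 := by
    intro u
    rw [← mul_pow, ← norm_mul]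
    simp only [sectorAmp]
    rw [Finset.mul_sum]
    congr 2
    exact Finset.sum_congr rfl fun v _ => by ring
  simp only [outcomeProb, h]
  rw [tsum_mul_left]
  ring

/-- The measured law comes from the window transform `F` together with the mass `Q` of all other
sectors. Poisson summation instead evaluates the transform of the wrapped Gaussian, `F + R`, where
`R` transforms the tails. The two agree up to the cross term, `‖R‖²` and `Q`, all small because
little mass leaves the window. -/
theorem sum_abs_outcomeProb_gauss_sub_le {b : ℝ} (hb : 0 < b) (h1 : theta (N ^ 2 * b / 8) - 1 ≤ 1) :
    ∑ z : ZMod N, |(N * b)⁻¹ * wrap (fun e => gauss (b⁻¹ / N ^ 2) e) z ^ 2 -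
      outcomeProb (fun j => (gauss b j : ℂ)) z| ≤
      6 * (theta (N ^ 2 * b / 8) - 1) * theta (2 * b) := by
  have hN : (0 : ℝ) < N := natCast_modulus_pos
  set g : ℤ → ℂ := fun j => (gauss b j : ℂ) with hg
  set η := theta (N ^ 2 * b / 8) - 1 with hη
  have hη0 : 0 ≤ η := sub_nonneg.2 (one_le_theta (by positivity))
  have hb2 : 0 < 2 * b := by positivity
  have hθ := one_le_theta hb
  have hng : ∀ j, ‖g j‖ ^ 2 = gauss (2 * b) j := fun j => by
    rw [hg, Complex.norm_real, Real.norm_of_nonneg (gauss_pos _ _).le, gauss_sq]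
  have hs : Summable fun j => ‖g j‖ ^ 2 := (summable_gauss hb2).congr fun j => (hng j).symm
  set F : ZMod N → ℂ := fun z => ∑ v : ZMod N, ZMod.stdAddChar (v * z) * (gauss b (windowRep v) : ℂ)
    with hF
  set R : ZMod N → ℂ := fun z =>
    ∑ v : ZMod N, ZMod.stdAddChar (v * z) * (gaussTail N b (windowRep v) : ℂ) with hR
  set Q : ZMod N → ℝ := fun z => ∑' u : ℤ, if u = 0 then 0 else ‖sectorAmp g u z‖ ^ 2 with hQ
  have hQ0 : ∀ z, 0 ≤ Q z := fun z => tsum_nonneg fun u => by split_ifs <;> positivity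
  have hP : ∀ z, outcomeProb g z = (N : ℝ)⁻¹ * ‖F z‖ ^ 2 + (N : ℝ)⁻¹ * Q z := by
    intro z
    have h0 : sectorAmp g 0 z = F z := by
      simp only [sectorAmp, mul_zero, zero_add, hF, hg, windowRep]
    rw [outcomeProb, (summable_sectorAmp hs z).tsum_eq_add_tsum_ite 0, h0, mul_add]
  have hW : ∀ z, (N * b)⁻¹ * wrap (fun e => gauss (b⁻¹ / N ^ 2) e) z ^ 2 =
      (N : ℝ)⁻¹ * ‖F z + R z‖ ^ 2 := by
    intro z
    have h := norm_dft_wrap_gauss (N := N) hb z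
    have e : F z + R z = ∑ v : ZMod N, ZMod.stdAddChar (v * z) *
        ((wrap (fun e => gauss b e) (windowRep v : ZMod N) : ℝ) : ℂ) := by
      simp only [hF, hR]
      rw [← Finset.sum_add_distrib]
      refine Finset.sum_congr rfl fun v _ => ?_
      rw [wrap_gauss hb, Complex.ofReal_add, mul_add]
    rw [e, h, mul_pow, inv_pow, Real.sq_sqrt hb.le, mul_inv]
    ring
  have sF : ∑ z, ‖F z‖ ^ 2 = N * ∑ v : ZMod N, gauss (2 * b) (windowRep v) := by
    simp only [hF]
    rw [sum_norm_sq_dft]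
    congr 1
    exact Finset.sum_congr rfl fun v _ => hng _
  -- The other sectors are not estimated individually: their mass is the total mass minus that of
  -- the window.
  have sQ : ∑ z, (N : ℝ)⁻¹ * Q z ≤ η * theta b := by
    have e1 : ∑ z : ZMod N, outcomeProb g z = theta (2 * b) := by
      rw [sum_outcomeProb hs, theta]
      exact tsum_congr hng
    have e2 : ∑ y : ZMod N, wrap (fun e => gauss (2 * b) e) y = theta (2 * b) :=
      sum_wrap (summable_gauss hb2)
    rw [sum_windowRep (wrap fun e => gauss (2 * b) e)] at e2
    simp only [wrap_gauss hb2] at e2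
    rw [Finset.sum_add_distrib] at e2
    simp only [hP] at e1
    rw [Finset.sum_add_distrib, ← Finset.mul_sum, sF, inv_mul_cancel_left₀ hN.ne'] at e1
    have e3 : ∑ z, (N : ℝ)⁻¹ * Q z = ∑ v : ZMod N, gaussTail N (2 * b) (windowRep v) := by linarith
    rw [e3]
    have e4 : theta (N ^ 2 * (2 * b) / 8) - 1 ≤ η :=
      sub_le_sub_right (theta_le_theta (by positivity) (by
        have : 0 < (N : ℝ) ^ 2 * b := by positivity
        linarith)) 1
    calc ∑ v : ZMod N, gaussTail N (2 * b) (windowRep v)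
        ≤ ∑ v : ZMod N, η * gauss b (windowRep v) := by
          refine Finset.sum_le_sum fun v _ => (gaussTail_le hb2 v).trans ?_
          rw [mul_div_cancel_left₀ _ (two_ne_zero' ℝ)]
          exact mul_le_mul_of_nonneg_right e4 (gauss_pos _ _).le
      _ ≤ η * theta b := by
          rw [← Finset.mul_sum]
          exact mul_le_mul_of_nonneg_left (sum_gauss_windowRep_le hb) hη0
  have sR : ∑ z, ‖R z‖ ^ 2 ≤ N * (η ^ 2 * theta b) := by
    simp only [hR]
    rw [sum_norm_sq_dft]
    refine mul_le_mul_of_nonneg_left ?_ hN.le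
    calc ∑ v : ZMod N, ‖(gaussTail N b (windowRep v) : ℂ)‖ ^ 2
        ≤ ∑ v : ZMod N, η ^ 2 * gauss b (windowRep v) := by
          refine Finset.sum_le_sum fun v _ => ?_
          have e1 : gauss b (windowRep v) = gauss (b / 2) (windowRep v) ^ 2 := by
            rw [gauss_sq, mul_div_cancel₀ _ (two_ne_zero' ℝ)]
          rw [Complex.norm_real, Real.norm_of_nonneg (gaussTail_nonneg _ _ _), e1, ← mul_pow]
          exact pow_le_pow_left₀ (gaussTail_nonneg _ _ _) (gaussTail_le hb v) 2
      _ ≤ _ := by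
          rw [← Finset.mul_sum]
          exact mul_le_mul_of_nonneg_left (sum_gauss_windowRep_le hb) (sq_nonneg _)
  have sF' : ∑ z, ‖F z‖ ^ 2 ≤ N * theta b := by
    rw [sF]
    exact mul_le_mul_of_nonneg_left ((sum_gauss_windowRep_le hb2).trans
      (theta_le_theta hb (by linarith))) hN.le
  -- Cauchy–Schwarz, so that Parseval suffices and no pointwise bound on the transforms is needed.
  have sFR : ∑ z, ‖F z‖ * ‖R z‖ ≤ N * (η * theta b) := by
    refine (Real.sum_mul_le_sqrt_mul_sqrt _ _ _).trans ?_
    rw [← Real.sqrt_mul (Finset.sum_nonneg fun _ _ => by positivity),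
      Real.sqrt_le_left (by positivity)]
    calc _ ≤ (N * theta b) * (N * (η ^ 2 * theta b)) :=
          mul_le_mul sF' sR (Finset.sum_nonneg fun _ _ => by positivity) (by positivity)
      _ = _ := by ring
  have key : ∀ z, |(N * b)⁻¹ * wrap (fun e => gauss (b⁻¹ / N ^ 2) e) z ^ 2 - outcomeProb g z| ≤
      (N : ℝ)⁻¹ * (2 * (‖F z‖ * ‖R z‖) + ‖R z‖ ^ 2) + (N : ℝ)⁻¹ * Q z := by
    intro z
    have hNi : 0 ≤ (N : ℝ)⁻¹ := by positivity
    have u1 := norm_add_le (F z) (R z)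
    have u2 := norm_sub_le (F z + R z) (R z)
    rw [add_sub_cancel_right] at u2
    have v1 : ‖F z + R z‖ ^ 2 - ‖F z‖ ^ 2 ≤ 2 * (‖F z‖ * ‖R z‖) + ‖R z‖ ^ 2 := by
      nlinarith [norm_nonneg (F z + R z), norm_nonneg (F z), norm_nonneg (R z)]
    have v2 : ‖F z‖ ^ 2 - ‖F z + R z‖ ^ 2 ≤ 2 * (‖F z‖ * ‖R z‖) + ‖R z‖ ^ 2 := by
      nlinarith [norm_nonneg (F z + R z), norm_nonneg (F z), norm_nonneg (R z)]
    have w1 := mul_le_mul_of_nonneg_left v1 hNi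
    have w2 := mul_le_mul_of_nonneg_left v2 hNi
    have w3 := mul_nonneg hNi (hQ0 z)
    rw [hW, hP, abs_le]
    constructor <;> linarith
  refine (Finset.sum_le_sum fun z _ => key z).trans ?_
  rw [Finset.sum_add_distrib, ← Finset.mul_sum, Finset.sum_add_distrib, ← Finset.mul_sum]
  have h2 : theta b ≤ 3 / 2 * theta (2 * b) := by
    refine (theta_le_sqrt_two_mul hb).trans (mul_le_mul_of_nonneg_right ?_
      (zero_le_one.trans (one_le_theta hb2)))
    rw [Real.sqrt_le_left (by norm_num)]
    norm_num
  have h3 : (N : ℝ)⁻¹ * (2 * ∑ z, ‖F z‖ * ‖R z‖ + ∑ z, ‖R z‖ ^ 2) ≤ 3 * η * theta b := by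
    rw [inv_mul_le_iff₀ hN]
    have : η ^ 2 * theta b ≤ η * theta b :=
      mul_le_mul_of_nonneg_right (by nlinarith) (by linarith)
    nlinarith [mul_le_mul_of_nonneg_left this hN.le]
  nlinarith [mul_le_mul_of_nonneg_left h2 hη0]

/-- The distribution of the outcome is nearly a discrete Gaussian. -/
theorem sum_abs_outcomeProb_sub_le {b a : ℝ} (hb : 0 < b) (hab : b⁻¹ / N ^ 2 = a)
    (h1 : theta (N ^ 2 * b / 8) - 1 ≤ 1) (h2 : theta (N ^ 2 * a / 8) - 1 ≤ 1) {f : ℤ → ℂ}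
    (hf : ∀ j, f j = ((gauss b j / Real.sqrt (theta (2 * b)) : ℝ) : ℂ)) :
    ∑ z : ZMod N, |outcomeProb f z - normalized (wrap fun e => gauss (2 * a) e) z| ≤
      12 * (theta (N ^ 2 * b / 8) - 1) + 12 * (theta (N ^ 2 * a / 8) - 1) := by
  have hN : (0 : ℝ) < N := natCast_modulus_pos
  have ha : 0 < a := by rw [← hab]; positivity
  have ha2 : 0 < 2 * a := by positivity
  have hb2 : 0 < 2 * b := by positivity
  set g : ℤ → ℂ := fun j => (gauss b j : ℂ) with hg
  have hθ : 0 < theta (2 * b) := one_pos.trans_le (one_le_theta hb2)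
  have hng : ∀ j, ‖g j‖ ^ 2 = gauss (2 * b) j := fun j => by
    rw [hg, Complex.norm_real, Real.norm_of_nonneg (gauss_pos _ _).le, gauss_sq]
  have hs : Summable fun j => ‖g j‖ ^ 2 := (summable_gauss hb2).congr fun j => (hng j).symm
  have e1 : ∑ z : ZMod N, outcomeProb g z = theta (2 * b) := by
    rw [sum_outcomeProb hs, theta]
    exact tsum_congr hng
  have e2 : outcomeProb (N := N) f = normalized (outcomeProb g) := by
    have hf' : f = fun j => (((Real.sqrt (theta (2 * b)))⁻¹ : ℝ) : ℂ) * g j := by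
      funext j
      rw [hf, hg, ← Complex.ofReal_mul, div_eq_inv_mul]
    funext z
    rw [hf', outcomeProb_const_mul, normalized, e1, Complex.norm_real, Real.norm_eq_abs, sq_abs,
      inv_pow, Real.sq_sqrt hθ.le, div_eq_inv_mul]
  have hg0 : ∀ y : ZMod N, 0 < wrap (fun e => gauss a e) y := by
    intro y
    have e : y = (windowRep (y + ((N / 2 : ℕ) : ZMod N)) : ZMod N) := by
      rw [windowRep_cast, add_sub_cancel_right]
    rw [e, wrap_gauss ha]
    exact add_pos_of_pos_of_nonneg (gauss_pos _ _) (gaussTail_nonneg _ _ _)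
  have hk : 0 < (N * b)⁻¹ := by positivity
  have hsq : 0 < ∑ y : ZMod N, wrap (fun e => gauss a e) y ^ 2 :=
    Finset.sum_pos (fun y _ => pow_pos (hg0 y) 2) Finset.univ_nonempty
  have eG : ∑ y : ZMod N, wrap (fun e => gauss (2 * a) e) y = theta (2 * a) :=
    sum_wrap (summable_gauss ha2)
  -- The intermediate law is the normalized square of a wrapped Gaussian: `c1` compares it with the
  -- measured law, `c2` with the wrapped Gaussian of doubled exponent.
  have c1 := sum_abs_normalized_sub_le (μ := fun y => (N * b)⁻¹ * wrap (fun e => gauss a e) y ^ 2)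
    (g := outcomeProb (N := N) g) (fun y => by positivity) (by rw [← Finset.mul_sum]; positivity)
    (by rwa [e1]) (by
      rw [e1, ← hab]
      exact sum_abs_outcomeProb_gauss_sub_le hb h1)
  have c2 := sum_abs_normalized_sub_le (μ := fun y : ZMod N => wrap (fun e => gauss a e) y ^ 2)
    (g := wrap fun e => gauss (2 * a) e) (fun y => by positivity) hsq
    (by rw [eG]; exact one_pos.trans_le (one_le_theta ha2)) (by
      rw [eG]
      exact sum_abs_sq_wrap_gauss_sub_le ha h2)
  rw [normalized_const_mul hk.ne'] at c1
  rw [e2]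
  refine (sum_abs_sub_le _ (normalized fun y => wrap (fun e => gauss a e) y ^ 2) _).trans ?_
  simp only [abs_sub_comm (normalized (outcomeProb g) _)]
  linarith

end outcome

open QMachine

/-! ### Discrete Gaussians -/

section discreteGaussian

theorem gaussWeight_eq (r : ℝ) (j : ℤ) : gaussWeight r j = gauss (r ^ 2)⁻¹ j := by
  rw [gaussWeight, gauss]
  congr 1
  ring

theorem discreteGaussian_eq (r : ℝ) (j : ℤ) :
    discreteGaussian r j = gauss (r ^ 2)⁻¹ j / theta (r ^ 2)⁻¹ := by
  simp only [discreteGaussian, gaussWeight_eq, theta]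

variable {r : ℝ}

theorem theta_pos {a : ℝ} (ha : 0 < a) : 0 < theta a := one_pos.trans_le (one_le_theta ha)

theorem discreteGaussian_nonneg (hr : 0 < r) (j : ℤ) : 0 ≤ discreteGaussian r j := by
  rw [discreteGaussian_eq]
  exact div_nonneg (gauss_pos _ _).le (theta_pos (by positivity)).le

theorem hasSum_discreteGaussian (hr : 0 < r) : HasSum (discreteGaussian r) 1 := by
  have ha : 0 < (r ^ 2)⁻¹ := by positivity
  have h := (summable_gauss ha).hasSum.div_const (theta (r ^ 2)⁻¹)
  rw [← theta, div_self (theta_pos ha).ne'] at h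
  exact h.congr_fun fun j => discreteGaussian_eq r j

theorem hasSum_discreteGaussian_sq (hr : 0 < r) :
    HasSum (fun j => discreteGaussian r j ^ 2)
      (theta (2 * (r ^ 2)⁻¹) / theta (r ^ 2)⁻¹ ^ 2) := by
  have ha : 0 < 2 * (r ^ 2)⁻¹ := by positivity
  refine ((summable_gauss ha).hasSum.div_const (theta (r ^ 2)⁻¹ ^ 2)).congr_fun fun j => ?_
  rw [discreteGaussian_eq, div_pow, gauss_sq]

theorem hasSum_squareDist (hr : 0 < r) : HasSum (squareDist (discreteGaussian r)) 1 := by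
  have h := hasSum_discreteGaussian_sq hr
  have h0 : 0 < theta (2 * (r ^ 2)⁻¹) / theta (r ^ 2)⁻¹ ^ 2 :=
    div_pos (theta_pos (by positivity)) (pow_pos (theta_pos (by positivity)) 2)
  have h2 := h.div_const (theta (2 * (r ^ 2)⁻¹) / theta (r ^ 2)⁻¹ ^ 2)
  rw [div_self h0.ne'] at h2
  exact h2.congr_fun fun j => by rw [squareDist, h.tsum_eq]

theorem discreteGaussian_div_sqrt (hr : 0 < r) (j : ℤ) :
    discreteGaussian r j / Real.sqrt (∑' i : ℤ, discreteGaussian r i ^ 2) =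
      gauss (r ^ 2)⁻¹ j / Real.sqrt (theta (2 * (r ^ 2)⁻¹)) := by
  have h0 : 0 < theta (r ^ 2)⁻¹ := theta_pos (by positivity)
  rw [(hasSum_discreteGaussian_sq hr).tsum_eq, Real.sqrt_div' _ (sq_nonneg _), Real.sqrt_sq h0.le,
    discreteGaussian_eq, div_div_div_cancel_right₀ h0.ne']

end discreteGaussian

/-- A bound for the statistical distance of a computed sample from an LWE sample. -/
noncomputable def sampleError (c : ℝ) (κ : ℕ) : ℝ :=
  26 * (Real.exp (1 - c * κ) * theta 1) + 58 * Real.exp (-(κ / 9))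

/-- Replace measured frequency and noise by discrete Gaussians with exponent `2 a`, where `a = (r /
N)²`; their difference is nearly the Gaussian with exponent `a`, whose parameter is `N / r`. The
coefficient `26` is `12 + 12` from the measurement and `2` from the difference. -/
theorem sum_abs_blockError_le (p : EDCPParams) {κ : ℕ} {c : ℝ} (hκ : 110 ≤ κ) (hc : 1 ≤ c * κ)
    (hc1 : Real.exp (1 - c * κ) * theta 1 ≤ 1) (hrN : p.r ≤ p.N)
    (hr : c * κ ≤ p.r ^ 2 / 8) (hN : c * κ ≤ (p.N / p.r) ^ 2 / 8) {f : ℤ → ℂ}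
    (hf : ∀ j, f j = ((gauss (p.r ^ 2)⁻¹ j / Real.sqrt (theta (2 * (p.r ^ 2)⁻¹)) : ℝ) : ℂ)) :
    ∑ y : ZMod p.N, |diffLaw (outcomeProb f) (noiseLaw p κ) y -
      wrap (discreteGaussian (1 / p.r * p.N)) y| ≤ sampleError c κ := by
  have hr0 := p.r_pos
  have hN0 : (0 : ℝ) < p.N := by exact_mod_cast Nat.pos_of_ne_zero (NeZero.ne p.N)
  have hT : 0 < 1 / p.r * p.N := by positivity
  have hη : ∀ {x : ℝ}, c * κ ≤ x → theta x - 1 ≤ Real.exp (1 - c * κ) * theta 1 := fun {x} hx =>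
    (theta_sub_one_le (hc.trans hx)).trans
      (mul_le_mul_of_nonneg_right (Real.exp_le_exp.2 (by linarith)) (theta_pos one_pos).le)
  set a := (p.r / p.N) ^ 2 with ha
  have ha0 : 0 < a := by positivity
  -- The three theta arguments: `N / r` controls the window and the difference of Gaussians, `r` the
  -- squared wrapped Gaussian.
  have e1 : ((p.N : ℝ) ^ 2 * (p.r ^ 2)⁻¹ / 8) = (p.N / p.r) ^ 2 / 8 := by ring
  have e2 : ((p.N : ℝ) ^ 2 * a / 8) = p.r ^ 2 / 8 := by rw [ha]; field_simp
  have e3 : (2 * (2 * a))⁻¹ = (p.N / p.r) ^ 2 / 8 + (p.N / p.r) ^ 2 / 8 := by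
    rw [ha]; field_simp; norm_num
  have n1 := hη hN
  have n2 := hη hr
  have n3 : theta (2 * (2 * a))⁻¹ - 1 ≤ Real.exp (1 - c * κ) * theta 1 := hη (by rw [e3]; linarith)
  have hP := sum_abs_outcomeProb_sub_le (N := p.N) (b := (p.r ^ 2)⁻¹) (a := a) (by positivity)
    (by rw [ha]; field_simp) (by rw [e1]; linarith) (by rw [e2]; linarith) hf
  have hν := sum_abs_noiseLaw_sub_le p hκ hrN
  have hD := sum_abs_diffLaw_gauss_le (N := p.N) (a := 2 * a) (by positivity)
  rw [e1, e2] at hP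
  rw [← ha] at hν
  rw [mul_div_cancel_left₀ _ (two_ne_zero' ℝ)] at hD
  have hχ : wrap (N := p.N) (discreteGaussian (1 / p.r * p.N)) =
      normalized (wrap fun e => gauss a e) := by
    have e4 : ((1 / p.r * p.N) ^ 2)⁻¹ = a := by rw [ha]; field_simp
    funext y
    have h := sum_wrap (N := p.N) (summable_gauss ha0)
    rw [normalized, h, ← theta, wrap, wrap, ← tsum_div_const]
    refine tsum_congr fun e => ?_
    rw [discreteGaussian_eq, e4]
    split_ifs
    · rfl
    · rw [zero_div]
  have hG : 0 < ∑ y : ZMod p.N, wrap (fun e => gauss (2 * a) e) y := by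
    rw [sum_wrap (summable_gauss (by positivity))]
    exact theta_pos (by positivity)
  have hc2 := sum_abs_diffLaw_sub_le (outcomeProb f) (normalized (wrap fun e => gauss (2 * a) e))
    (noiseLaw p κ) (normalized (wrap fun e => gauss (2 * a) e)) (noiseLaw_nonneg p κ)
    (sum_noiseLaw p κ) (normalized_nonneg (wrap_nonneg fun _ => (gauss_pos _ _).le))
    (sum_normalized hG)
  rw [hχ]
  refine (sum_abs_sub_le _ (diffLaw (normalized (wrap fun e => gauss (2 * a) e))
    (normalized (wrap fun e => gauss (2 * a) e))) _).trans ?_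
  rw [sampleError]
  linarith

/-- The reduction maps EDCP states to LWE samples, up to a small error, and random states to
uniform samples. -/
theorem abs_edcpAccept_sub_lweAccept_le_sampleError (p : EDCPParams) {κ X : ℕ} (hX : Fits p κ X)
    {c : ℝ} (hκ : 110 ≤ κ) (hc : 1 ≤ c * κ)
    (hc1 : Real.exp (1 - c * κ) * theta 1 ≤ 1) (hrN : p.r ≤ p.N)
    (hr : c * κ ≤ p.r ^ 2 / 8) (hN : c * κ ≤ (p.N / p.r) ^ 2 / 8)
    (A : LWESamples p.n p.N p.l → unitInterval)
    (σ : Fin p.n → ZMod p.N) (x : Fin p.l → Fin p.n → ZMod p.N) :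
    |p.edcpAccept κ reduction A σ x - lweAccept (discreteGaussian (1 / p.r * p.N)) A| ≤
      p.l * sampleError c κ := by
  have hr0 := p.r_pos
  have hN0 : (0 : ℝ) < p.N := by exact_mod_cast Nat.pos_of_ne_zero (NeZero.ne p.N)
  have hT : 0 < 1 / p.r * p.N := by positivity
  set f : ℤ → ℂ := fun j => ((discreteGaussian p.r j /
      Real.sqrt (∑' i : ℤ, discreteGaussian p.r i ^ 2) : ℝ) : ℂ) with hf
  have hf1 : HasSum (fun j => ‖f j‖ ^ 2) 1 := by
    refine (hasSum_squareDist hr0).congr_fun fun j => ?_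
    rw [hf, Complex.norm_real, Real.norm_eq_abs, sq_abs, div_pow,
      Real.sq_sqrt (tsum_nonneg fun _ => sq_nonneg _), squareDist]
  refine abs_edcpAccept_sub_lweAccept_le p κ hX A hf hf1 (discreteGaussian_nonneg hT)
    (hasSum_discreteGaussian hT) ?_ σ x
  refine sum_abs_blockError_le p hκ hc hc1 hrN hr hN fun j => ?_
  rw [hf]
  simp only [discreteGaussian_div_sqrt hr0]

open QMachine

/-! ### Resources and asymptotics -/

section resources

/-- A bound for the numbers that occur in the reduction. -/
noncomputable def memBound (p : EDCPParams) (κ : ℕ) : ℕ :=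
  (8 * (κ * κ) + κ + 8) + ((p.l + 1) * (p.n + 1) + 100) +
    (p.n * (p.N * p.N) + 2 * p.N + 2 * noiseRange p κ + κ * p.N + 1) +
    ⌈Real.exp κ⌉₊ + ⌈κ * p.N / p.r⌉₊ + ⌈p.r⌉₊

theorem fits_memBound (p : EDCPParams) (κ : ℕ) : Fits p κ (memBound p κ) where
  kappa := by unfold memBound; omega
  index := by unfold memBound; omega
  value := by unfold memBound; omega
  prec := (Nat.le_ceil _).trans (Nat.cast_le.2 (by unfold memBound; omega))
  quot := (Nat.le_ceil _).trans (Nat.cast_le.2 (by unfold memBound; omega))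
  param := (Nat.le_ceil _).trans (Nat.cast_le.2 (by unfold memBound; omega))

/-- With `E = exp M` every summand is a monomial in `E` of degree at most `3`, and the coefficients
add up to `134`; as `E ≥ 134` the sum is at most `E⁴`. -/
theorem size_memBound_le {p : EDCPParams} {κ M : ℕ} (hM : 134 ≤ M) (hκ : κ ≤ M) (hn : p.n ≤ M)
    (hl : p.l ≤ M) (hN : Real.log p.N ≤ M) (hr : 1 ≤ p.r) (hrN : p.r ≤ p.N) :
    (memBound p κ).size ≤ 8 * M := by
  have hN0 : (0 : ℝ) < p.N := by exact_mod_cast Nat.pos_of_ne_zero (NeZero.ne p.N)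
  rw [Nat.size_le]
  set E := Real.exp M with hE
  have hME : (M : ℝ) + 1 ≤ E := Real.add_one_le_exp _
  have hM' : (134 : ℝ) ≤ M := by exact_mod_cast hM
  have hE1 : 134 ≤ E := by linarith
  have hκ' : (κ : ℝ) ≤ M := by exact_mod_cast hκ
  have k1 : (κ : ℝ) ≤ E := by linarith
  have n1 : (p.n : ℝ) ≤ E := by
    have : (p.n : ℝ) ≤ M := by exact_mod_cast hn
    linarith
  have l1 : (p.l : ℝ) ≤ E := by
    have : (p.l : ℝ) ≤ M := by exact_mod_cast hl
    linarith
  have N1 : (p.N : ℝ) ≤ E := by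
    rw [← Real.exp_log hN0]
    exact Real.exp_le_exp.2 hN
  have e1 : Real.exp κ ≤ E := Real.exp_le_exp.2 hκ'
  have q0 : (κ * p.N / p.r : ℝ) ≤ E * E := by
    refine (div_le_self (by positivity) hr).trans ?_
    gcongr
  have h1 : (noiseRange p κ : ℝ) ≤ E * E := (Nat.floor_le (by positivity)).trans q0
  have c1 := (Nat.ceil_lt_add_one (Real.exp_nonneg κ)).le
  have c2 := (Nat.ceil_lt_add_one (a := (κ * p.N / p.r : ℝ)) (by positivity)).le
  have c3 := (Nat.ceil_lt_add_one (a := p.r) (by linarith)).le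
  have hX : (memBound p κ : ℝ) ≤ E ^ 4 := by
    unfold memBound
    push_cast
    have a1 : (κ : ℝ) * κ ≤ E * E := by gcongr
    have a2 : ((p.l : ℝ) + 1) * (p.n + 1) ≤ (E + 1) * (E + 1) := by gcongr
    have a3 : (p.n : ℝ) * (p.N * p.N) ≤ E * (E * E) := by gcongr
    have a4 : (κ : ℝ) * p.N ≤ E * E := by gcongr
    have b1 : E * E ≤ E * (E * E) := by nlinarith [mul_nonneg (by linarith : 0 ≤ E) (by linarith : 0 ≤ E)]
    have b2 : E ≤ E * E := by nlinarith
    have b3 : 134 * (E * (E * E)) ≤ E ^ 4 := by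
      have : E ^ 4 = E * (E * (E * E)) := by ring
      rw [this]
      exact mul_le_mul_of_nonneg_right hE1 (by positivity)
    nlinarith
  -- Since `e < 4`.
  have h2 : E ^ 4 < 2 ^ (8 * M) := by
    have e2 : E ^ 4 = Real.exp 1 ^ (4 * M) := by
      rw [hE, ← Real.exp_nat_mul, ← Real.exp_nat_mul]
      congr 1
      push_cast
      ring
    have e3 : (2 : ℝ) ^ (8 * M) = 4 ^ (4 * M) := by
      rw [show 8 * M = 2 * (4 * M) by ring, pow_mul]
      norm_num
    rw [e2, e3]
    exact pow_lt_pow_left₀ (by linarith [Real.exp_one_lt_d9]) (Real.exp_nonneg _) (by omega)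
  exact_mod_cast hX.trans_lt h2

/-- The polynomial is `13 M³ + 12 M² + 22 M + 16`, with coefficient sum `63`. -/
theorem reductionSteps_le {p : EDCPParams} {κ M : ℕ} (hM : 1 ≤ M) (hκ : κ ≤ M) (hn : p.n ≤ M)
    (hl : p.l ≤ M) : reductionSteps p κ ≤ 63 * M ^ 3 := by
  have h1 : reductionSteps p κ ≤ (1 + M * 7) + ((1 + M * (1 + M * 11 + ((1 + M * M * 13 + 1) + 9) +
      1 + 1)) + (M * (M + 1) + 1)) + 13 := by
    unfold reductionSteps
    gcongr
  have h2 : M ^ 2 ≤ M ^ 3 := Nat.pow_le_pow_right hM (by norm_num)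
  have h3 : M ^ 1 ≤ M ^ 3 := Nat.pow_le_pow_right hM (by norm_num)
  nlinarith

theorem runTime_le {p : EDCPParams} {κ M : ℕ} (hM : 134 ≤ M) (hκ : κ ≤ M) (hn : p.n ≤ M)
    (hl : p.l ≤ M) (hN : Real.log p.N ≤ M) (hr : 1 ≤ p.r) (hrN : p.r ≤ p.N) :
    reductionSteps p κ * stepCost (memBound p κ) ≤ 4592700 * M ^ 6 := by
  have h1 := reductionSteps_le (by omega) hκ hn hl
  have h2 := size_memBound_le hM hκ hn hl hN hr hrN
  have h3 : stepCost (memBound p κ) ≤ 100 * (9 * M) ^ 3 := by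
    unfold stepCost
    gcongr
    omega
  calc _ ≤ (63 * M ^ 3) * (100 * (9 * M) ^ 3) := Nat.mul_le_mul h1 h3
    _ = _ := by ring

theorem runsInTime_reduction (p : EDCPParams) (κ : ℕ)
    (A : LWESamples p.n p.N p.l → unitInterval) {T : ℕ}
    (hT : reductionSteps p κ * stepCost (memBound p κ) ≤ T) :
    p.RunsInTime κ reduction A T := by
  have key : ∀ (f : Fin p.l → ℤ → ℂ) (σ : Fin p.n → ZMod p.N) (x : Fin p.l → Fin p.n → ZMod p.N),
      ∀ c ∈ run (p.env A) reduction (p.start κ (loadStates fun k => cosetBlock (f k) σ (x k))),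
      c.time ≤ T := by
    intro f σ x c hc
    have h := (branches_reduction (fits_memBound p κ) A f σ x).time_le hc
    exact h.trans (by simpa [EDCPParams.start] using hT)
  rintro ψ (⟨s, x, rfl⟩ | ⟨j, x, rfl⟩) c hc -
  · rw [EDCPParams.edcpInput] at hc
    simp only [edcpState_eq] at hc
    exact key _ _ _ c hc
  · rw [EDCPParams.basisInput] at hc
    simp only [basisState_eq] at hc
    exact key (fun k i => if i = j k then 1 else 0) 0 x c hc

theorem tendsto_pow_mul_exp_neg (k : ℕ) {c : ℝ} (hc : 0 < c) :
    Tendsto (fun κ : ℕ => (κ : ℝ) ^ k * Real.exp (-(c * κ))) atTop (nhds 0) := by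
  have h1 : Tendsto (fun κ : ℕ => c * (κ : ℝ)) atTop atTop :=
    tendsto_natCast_atTop_atTop.const_mul_atTop hc
  have h2 := ((Real.tendsto_pow_mul_exp_neg_atTop_nhds_zero k).comp h1).const_mul (c ^ k)⁻¹
  rw [mul_zero] at h2
  refine h2.congr fun κ => ?_
  rw [Function.comp_apply, mul_pow, mul_assoc, inv_mul_cancel_left₀ (pow_pos hc k).ne']

theorem tendsto_pow_mul_sampleError (k : ℕ) {c : ℝ} (hc : 0 < c) :
    Tendsto (fun κ : ℕ => (κ : ℝ) ^ k * sampleError c κ) atTop (nhds 0) := by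
  have h1 := (tendsto_pow_mul_exp_neg k hc).const_mul (26 * (Real.exp 1 * theta 1))
  have h2 := (tendsto_pow_mul_exp_neg k (c := 1 / 9) (by norm_num)).const_mul 58
  have h3 := h1.add h2
  rw [mul_zero, mul_zero, add_zero] at h3
  refine h3.congr fun κ => ?_
  rw [sampleError, sub_eq_add_neg, Real.exp_add, one_div_mul_eq_div]
  ring

theorem sampleError_nonneg (c : ℝ) (κ : ℕ) : 0 ≤ sampleError c κ := by
  have := theta_pos one_pos
  unfold sampleError
  positivity

end resources

/-! ### Asymptotics and the conclusion. -/

section main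
variable {p : ℕ → EDCPParams}

/-- The two growth conditions say that `r` and `N / r` are at least constant multiples of `√κ`;
squaring yields theta arguments linear in `κ`. -/
theorem eventually_param_bounds
    (h1 : (fun κ : ℕ => Real.sqrt κ) =O[atTop] fun κ => (p κ).r)
    (h2 : (fun κ : ℕ => Real.sqrt κ * (p κ).r) =O[atTop] fun κ => ((p κ).N : ℝ)) :
    ∃ c > (0 : ℝ), ∀ᶠ κ : ℕ in atTop, 110 ≤ κ ∧ 1 ≤ c * κ ∧
      Real.exp (1 - c * κ) * theta 1 ≤ 1 ∧ 1 ≤ (p κ).r ∧ (p κ).r ≤ (p κ).N ∧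
      c * κ ≤ (p κ).r ^ 2 / 8 ∧ c * κ ≤ ((p κ).N / (p κ).r) ^ 2 / 8 := by
  obtain ⟨C₁, hC₁, b1⟩ := h1.exists_pos
  obtain ⟨C₂, hC₂, b2⟩ := h2.exists_pos
  -- The sum of the squared constants serves both inequalities, and `8` is the denominator in the
  -- theta arguments.
  have hc : 0 < 1 / (8 * (C₁ ^ 2 + C₂ ^ 2)) := by positivity
  refine ⟨1 / (8 * (C₁ ^ 2 + C₂ ^ 2)), hc, ?_⟩
  set c := 1 / (8 * (C₁ ^ 2 + C₂ ^ 2)) with hc'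
  have t1 : ∀ᶠ κ : ℕ in atTop, 1 ≤ c * κ :=
    (tendsto_natCast_atTop_atTop.const_mul_atTop hc).eventually_ge_atTop 1
  have t2 : ∀ᶠ κ : ℕ in atTop, Real.exp (1 - c * κ) * theta 1 ≤ 1 := by
    have h := (tendsto_pow_mul_exp_neg 0 hc).const_mul (Real.exp 1 * theta 1)
    rw [mul_zero] at h
    filter_upwards [h.eventually_le_const one_pos] with κ hκ
    rw [sub_eq_add_neg, Real.exp_add]
    linarith
  filter_upwards [b1.bound, b2.bound, t1, t2, eventually_ge_atTop 110] with κ k1 k2 k3 k4 k5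
  have hr := (p κ).r_pos
  have hN : (0 : ℝ) < (p κ).N := by exact_mod_cast Nat.pos_of_ne_zero (NeZero.ne (p κ).N)
  have hs := Real.sqrt_nonneg (κ : ℝ)
  have hsq := Real.sq_sqrt (Nat.cast_nonneg (α := ℝ) κ)
  rw [Real.norm_of_nonneg hs, Real.norm_of_nonneg hr.le] at k1
  rw [Real.norm_of_nonneg (by positivity), Real.norm_of_nonneg hN.le] at k2
  have c1 : c * κ ≤ (p κ).r ^ 2 / 8 := by
    have := pow_le_pow_left₀ hs k1 2
    rw [hsq, mul_pow] at this
    rw [hc', div_mul_eq_mul_div, div_le_div_iff₀ (by positivity) (by norm_num)]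
    nlinarith [mul_pos (pow_pos hC₂ 2) (pow_pos hr 2)]
  have c2 : c * κ ≤ ((p κ).N / (p κ).r) ^ 2 / 8 := by
    have k2' : Real.sqrt κ ≤ C₂ * ((p κ).N / (p κ).r) := by
      rw [mul_div_assoc', le_div_iff₀ hr]
      exact k2
    have := pow_le_pow_left₀ hs k2' 2
    rw [hsq, mul_pow] at this
    rw [hc', div_mul_eq_mul_div, div_le_div_iff₀ (by positivity) (by norm_num)]
    nlinarith [mul_pos (pow_pos hC₁ 2) (pow_pos (div_pos hN hr) 2)]
  refine ⟨k5, k3, k4, ?_, ?_, c1, c2⟩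
  · nlinarith
  · have : 1 ≤ (p κ).N / (p κ).r := by
      have := div_pos hN hr
      nlinarith
    rwa [one_le_div hr] at this

theorem runsInTime_eventually
    (h0 : ∃ c : ℕ, ∀ᶠ κ : ℕ in atTop,
      (p κ).n ≤ κ ^ c ∧ Real.log (p κ).N ≤ (κ : ℝ) ^ c ∧ (p κ).l ≤ κ ^ c)
    (h1 : (fun κ : ℕ => Real.sqrt κ) =O[atTop] fun κ => (p κ).r)
    (h2 : (fun κ : ℕ => Real.sqrt κ * (p κ).r) =O[atTop] fun κ => ((p κ).N : ℝ)) :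
    ∃ c : ℕ, ∀ᶠ κ in atTop, ∀ A, (p κ).RunsInTime κ reduction A (κ ^ c) := by
  obtain ⟨c, hc⟩ := h0
  obtain ⟨d, -, hd⟩ := eventually_param_bounds h1 h2
  -- The exponent `c + 1` makes `M = κ ^ (c + 1)` dominate `κ` itself; the last factor `κ` absorbs
  -- the constant.
  refine ⟨(c + 1) * 6 + 1, ?_⟩
  filter_upwards [hc, hd, eventually_ge_atTop 4592700] with κ k1 k2 k3 A
  have hle : κ ^ c ≤ κ ^ (c + 1) := Nat.pow_le_pow_right (by omega) (by omega)
  have hκ : κ ≤ κ ^ (c + 1) := Nat.le_self_pow (by omega) κ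
  refine runsInTime_reduction _ _ _ ((runTime_le (M := κ ^ (c + 1)) (by omega) hκ (k1.1.trans hle)
    (k1.2.2.trans hle) (k1.2.1.trans (by exact_mod_cast hle)) k2.2.2.2.1 k2.2.2.2.2.1).trans ?_)
  rw [← pow_mul, pow_succ, mul_comm]
  exact Nat.mul_le_mul_left _ k3

theorem solvesDGEDCP_reduction
    (h0 : ∃ c : ℕ, ∀ᶠ κ : ℕ in atTop,
      (p κ).n ≤ κ ^ c ∧ Real.log (p κ).N ≤ (κ : ℝ) ^ c ∧ (p κ).l ≤ κ ^ c)
    (h1 : (fun κ : ℕ => Real.sqrt κ) =O[atTop] fun κ => (p κ).r)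
    (h2 : (fun κ : ℕ => Real.sqrt κ * (p κ).r) =O[atTop] fun κ => ((p κ).N : ℝ))
    (A : ∀ κ, LWESamples (p κ).n (p κ).N (p κ).l → unitInterval)
    (hA : SolvesDLWE p (fun κ => 1 / (p κ).r) A) : SolvesDGEDCP p reduction A := by
  obtain ⟨c₀, hc₀⟩ := h0
  obtain ⟨d, hd0, hd⟩ := eventually_param_bounds h1 h2
  obtain ⟨C, hC, c, hadv⟩ := hA
  set adv : ℕ → ℝ := fun κ =>
    lweAccept (discreteGaussian (1 / (p κ).r * (p κ).N)) (A κ) - uniformAccept (A κ) with hadv'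
  have hrand : ∀ κ, (p κ).randomAccept κ reduction (A κ) = uniformAccept (A κ) := fun κ =>
    randomAccept_eq _ _ (fits_memBound _ _) _ (hasSum_squareDist (p κ).r_pos)
  let diff : ∀ κ, (Fin (p κ).n → ZMod (p κ).N) × (Fin (p κ).l → Fin (p κ).n → ZMod (p κ).N) → ℝ :=
    fun κ w => (p κ).edcpAccept κ reduction (A κ) w.1 w.2 - (p κ).randomAccept κ reduction (A κ)
  -- The advantage is the worst case over the finitely many secrets and shifts. Its sign is that of
  -- the oracle's advantage, hence independent of both.
  refine ⟨fun κ => if 0 ≤ adv κ then Finset.univ.inf' Finset.univ_nonempty (diff κ)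
    else Finset.univ.inf' Finset.univ_nonempty fun w => -diff κ w, ⟨C / 2, by positivity, c, ?_⟩,
    fun κ => ?_⟩
  -- The exponent collects `ℓ ≤ κ ^ c₀` and `(n log N) ^ c ≤ κ ^ ((c₀ + c₀) c)`; half of the
  -- oracle's advantage pays for the simulation error.
  · have hsmall := (tendsto_pow_mul_sampleError (c₀ + (c₀ + c₀) * c) hd0).eventually_le_const
      (half_pos hC)
    filter_upwards [hc₀, hd, hadv, hsmall, eventually_ge_atTop 1] with κ k1 k2 k3 k4 k5
    obtain ⟨m1, m2, m3, -, m5, m6, m7⟩ := k2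
    have hκ : (0 : ℝ) < κ := by exact_mod_cast k5
    have hclose : ∀ w, |diff κ w - adv κ| ≤ (p κ).l * sampleError d κ := by
      intro w
      have := abs_edcpAccept_sub_lweAccept_le_sampleError (p κ) (fits_memBound (p κ) κ) m1 m2 m3 m5
        m6 m7 (A κ) w.1 w.2
      have e : diff κ w - adv κ = (p κ).edcpAccept κ reduction (A κ) w.1 w.2 -
          lweAccept (discreteGaussian (1 / (p κ).r * (p κ).N)) (A κ) := by
        simp only [diff, hadv', hrand]
        ring
      rw [e]
      exact this
    have hn1 : (1 : ℝ) ≤ (p κ).n := by exact_mod_cast (p κ).one_le_n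
    have hlog : 0 < Real.log (p κ).N :=
      Real.log_pos (by exact_mod_cast (p κ).two_le_N)
    set B : ℝ := (p κ).n * Real.log (p κ).N with hB
    have hB0 : 0 < B := by positivity
    have hB1 : B ≤ (κ : ℝ) ^ (c₀ + c₀) := by
      rw [pow_add]
      exact mul_le_mul (by exact_mod_cast k1.1) k1.2.1 hlog.le (by positivity)
    have herr : (p κ).l * sampleError d κ ≤ C / 2 / B ^ c := by
      rw [le_div_iff₀ (by positivity)]
      calc (p κ).l * sampleError d κ * B ^ c
          ≤ (κ : ℝ) ^ c₀ * sampleError d κ * ((κ : ℝ) ^ (c₀ + c₀)) ^ c := by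
            have hs := sampleError_nonneg d κ
            have hl : ((p κ).l : ℝ) ≤ (κ : ℝ) ^ c₀ := by exact_mod_cast k1.2.2
            gcongr
        _ = (κ : ℝ) ^ (c₀ + (c₀ + c₀) * c) * sampleError d κ := by ring
        _ ≤ C / 2 := k4
    have hC2 : C / B ^ c = C / 2 / B ^ c + C / 2 / B ^ c := by ring
    have k3' : C / B ^ c ≤ |adv κ| := k3
    split_ifs with hs
    · refine Finset.le_inf' _ _ fun w _ => ?_
      have := (abs_le.1 (hclose w)).1
      rw [abs_of_nonneg hs] at k3'
      linarith
    · refine Finset.le_inf' _ _ fun w _ => ?_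
      have := (abs_le.1 (hclose w)).2
      rw [abs_of_neg (not_le.1 hs)] at k3'
      linarith
  · by_cases hs : 0 ≤ adv κ
    · refine Or.inl fun s x => ?_
      simp only [if_pos hs]
      exact Finset.inf'_le (diff κ) (Finset.mem_univ (s, x))
    · refine Or.inr fun s x => ?_
      simp only [if_neg hs]
      refine (Finset.inf'_le (fun w => -diff κ w) (Finset.mem_univ (s, x))).trans (le_of_eq ?_)
      simp only [diff]
      ring

end main

theorem mainTheorem6 :
    ∃ P : QMachine.Cmd, ∀ (p : ℕ → EDCPParams) (α : ℕ → ℝ),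
      (∃ c : ℕ, ∀ᶠ κ : ℕ in atTop,
        (p κ).n ≤ κ ^ c ∧ Real.log (p κ).N ≤ (κ : ℝ) ^ c ∧ (p κ).l ≤ κ ^ c) →
      ((fun κ : ℕ => (κ : ℝ)) =O[atTop] fun κ => ((p κ).l : ℝ)) →
      ((fun κ : ℕ => Real.sqrt κ) =O[atTop] fun κ => (p κ).r) →
      ((fun κ : ℕ => Real.sqrt κ * (p κ).r) =O[atTop] fun κ => ((p κ).N : ℝ)) →
      (∀ κ, α κ = 1 / (p κ).r) →
      IsQuantumReduction p α P := by
  refine ⟨QMachine.reduction, fun p α h0 _ h1 h2 hα => ?_⟩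
  obtain rfl : α = fun κ => 1 / (p κ).r := funext hα
  exact ⟨runsInTime_eventually h0 h1 h2, solvesDGEDCP_reduction h0 h1 h2⟩
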